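/- Let $G=SU(2,1)=\{g\in SL(3,\mathbb{C}) : g^*\gamma g=\gamma\}$ with $\gamma=\operatorname{diag}(1,1,-1)$, let $\Theta(g)=(g^*)^{-1}$, and let $K=G^{\Theta}\cong S(U(2)\times U(1))$. Let $\mathfrak{g}=\mathfrak{sl}(3,\mathbb{C})$ be the complexified Lie algebra of $G$. With $e_{ij}$ the matrix units, put $$H_1=\tfrac13(2e_{11}-e_{22}-e_{33}),\quad H_2=\tfrac13(-e_{11}+2e_{22}-e_{33}),\quad H=H_1-H_2,$$ $$E=e_{12},\ F=e_{21},\ E_1=e_{13},\ E_2=e_{23},\ F_1=e_{31},\ F_2=e_{32},\qquad \mathfrak{p}=\operatorname{span}_{\mathbb{C}}\{E_1,E_2,F_1,F_2\}.$$ Let $U(\mathfrak{g})$ be the universal enveloping algebra of $\mathfrak{g}$, and let $C(\mathfrak{p})$ be the Clifford algebra of $\mathfrak{p}$ with respect to the trace form $B(x,y)=\operatorname{tr}(xy)$, with relations $xy+yx=-2B(x,y)$ for $x,y\in\mathfrak{p}$. Let $(U(\mathfrak{g})\otimes C(\mathfrak{p}))^K$ be the algebra of invariants of the action $\operatorname{Ad}\otimes\operatorname{Ad}$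 of $K$ by algebra automorphisms on the (ordinary, ungraded) tensor product algebra over $\mathbb{C}$. Consider the elements $$\tilde a=(H_1+H_2)\otimes 1,\qquad \tilde b=(H^2+2(EF+FE))\otimes 1,\qquad \tilde g=1\otimes(E_1F_1+E_2F_2),$$ $$\tilde i=2E\otimes E_2F_1+H\otimes E_1F_1-H\otimes E_2F_2+2F\otimes E_1F_2,$$ and the Dirac operator $$D=E_1\otimes F_1+E_2\otimes F_2+F_1\otimes E_1+F_2\otimes E_2 .$$ Then $\tilde a,\tilde b,\tilde g,\tilde i$ and $D$ belong to $(U(\mathfrak{g})\otimes C(\mathfrak{p}))^K$. Let $\mathcal{I}$ be the two-sided ideal of $(U(\mathfrak{g})\otimes C(\mathfrak{p}))^K$ generated by $D$. The quotient algebra $(U(\mathfrak{g})\otimes C(\mathfrak{p}))^K/\mathcal{I}$ is generated, as a unital $\mathbb{C}$-algebra, by the classes of $\tilde a$, $\tilde b$, $\tilde i$ and $\tilde g$, and it is commutative. -/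

import Mathlib

open scoped TensorProduct Matrix

noncomputable section

namespace DiracSU21

attribute [local instance] LieRing.ofAssociativeRing

/-! ### The group `SU(2,1)` and its maximal compact subgroup `K` -/

/-- `γ = diag(1, 1, -1)`. -/
def gam : Matrix (Fin 3) (Fin 3) ℂ := Matrix.diagonal ![1, 1, -1]

lemma gam_mul_gam : gam * gam = 1 := by
  ext i j
  fin_cases i <;> fin_cases j <;> simp [gam]

/-- `G = SU(2,1) = {g ∈ SL(3,ℂ) | g* γ g = γ}`. -/
def SU21 : Subgroup (Matrix.SpecialLinearGroup (Fin 3) ℂ) where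
  carrier := {g | (g : Matrix (Fin 3) (Fin 3) ℂ)ᴴ * gam * (g : Matrix (Fin 3) (Fin 3) ℂ) = gam}
  one_mem' := by simp
  mul_mem' := by
    intro g h hg hh
    simp only [Set.mem_ofPred_eq, Matrix.SpecialLinearGroup.coe_mul,
      Matrix.conjTranspose_mul] at *
    calc _ = (h : Matrix (Fin 3) (Fin 3) ℂ)ᴴ *
          ((g : Matrix (Fin 3) (Fin 3) ℂ)ᴴ * gam * (g : Matrix (Fin 3) (Fin 3) ℂ)) *
            (h : Matrix (Fin 3) (Fin 3) ℂ) := by simp only [Matrix.mul_assoc]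
      _ = gam := by rw [hg, hh]
  inv_mem' := by
    intro g hg
    simp only [Set.mem_ofPred_eq] at *
    have h1 : (g : Matrix (Fin 3) (Fin 3) ℂ) *
        ((g⁻¹ : Matrix.SpecialLinearGroup (Fin 3) ℂ) : Matrix (Fin 3) (Fin 3) ℂ) = 1 := by
      rw [← Matrix.SpecialLinearGroup.coe_mul, mul_inv_cancel, Matrix.SpecialLinearGroup.coe_one]
    have h2 : ((g⁻¹ : Matrix.SpecialLinearGroup (Fin 3) ℂ) : Matrix (Fin 3) (Fin 3) ℂ)ᴴ *
        (g : Matrix (Fin 3) (Fin 3) ℂ)ᴴ = 1 := by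
      rw [← Matrix.conjTranspose_mul, h1, Matrix.conjTranspose_one]
    generalize ((g⁻¹ : Matrix.SpecialLinearGroup (Fin 3) ℂ) : Matrix (Fin 3) (Fin 3) ℂ) = k at *
    calc kᴴ * gam * k = kᴴ * ((g : Matrix (Fin 3) (Fin 3) ℂ)ᴴ * gam *
            (g : Matrix (Fin 3) (Fin 3) ℂ)) * k := by rw [hg]
      _ = (kᴴ * (g : Matrix (Fin 3) (Fin 3) ℂ)ᴴ) * gam *
            ((g : Matrix (Fin 3) (Fin 3) ℂ) * k) := by simp only [Matrix.mul_assoc]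
      _ = gam := by rw [h1, h2, Matrix.one_mul, Matrix.mul_one]

/-- `K = G^Θ`, the fixed points in `G` of the Cartan involution `Θ(g) = (g*)⁻¹`; this is
`S(U(2) × U(1))`, embedded block-diagonally. -/
def K : Subgroup (Matrix.SpecialLinearGroup (Fin 3) ℂ) :=
  SU21 ⊓
  { carrier := {g | ((g : Matrix (Fin 3) (Fin 3) ℂ)ᴴ)⁻¹ = (g : Matrix (Fin 3) (Fin 3) ℂ)}
    one_mem' := by simp
    mul_mem' := by
      intro g h hg hh
      simp only [Set.mem_ofPred_eq, Matrix.SpecialLinearGroup.coe_mul,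
        Matrix.conjTranspose_mul, Matrix.mul_inv_rev] at *
      rw [hg, hh]
    inv_mem' := by
      intro g hg
      simp only [Set.mem_ofPred_eq] at *
      have h1 : ((g⁻¹ : Matrix.SpecialLinearGroup (Fin 3) ℂ) : Matrix (Fin 3) (Fin 3) ℂ) =
          (g : Matrix (Fin 3) (Fin 3) ℂ)⁻¹ := by
        refine (Matrix.inv_eq_left_inv ?_).symm
        rw [← Matrix.SpecialLinearGroup.coe_mul, inv_mul_cancel,
          Matrix.SpecialLinearGroup.coe_one]
      rw [h1, Matrix.conjTranspose_nonsing_inv, hg] }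

/-! ### The Lie algebra `𝔤 = sl(3,ℂ)` and its basis -/

/-- `𝔤 = sl(3,ℂ)`, the complexification of `su(2,1)`. -/
abbrev 𝔤 : LieSubalgebra ℂ (Matrix (Fin 3) (Fin 3) ℂ) := LieAlgebra.SpecialLinear.sl (Fin 3) ℂ

lemma mem_𝔤 {x : Matrix (Fin 3) (Fin 3) ℂ} : x ∈ 𝔤 ↔ x.trace = 0 := Iff.rfl

/-- The matrix unit `e_{ij}`, `i ≠ j`, as an element of `𝔤`. -/
def unit (i j : Fin 3) (h : i ≠ j) : 𝔤 := LieAlgebra.SpecialLinear.single i j h 1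

/-- `H₁ = (1/3)(2e₁₁ - e₂₂ - e₃₃)`. -/
def H₁ : 𝔤 := ⟨Matrix.diagonal ![2 / 3, -1 / 3, -1 / 3], by
  rw [mem_𝔤]; simp [Matrix.trace, Fin.sum_univ_three]; norm_num⟩
/-- `H₂ = (1/3)(-e₁₁ + 2e₂₂ - e₃₃)`. -/
def H₂ : 𝔤 := ⟨Matrix.diagonal ![-1 / 3, 2 / 3, -1 / 3], by
  rw [mem_𝔤]; simp [Matrix.trace, Fin.sum_univ_three]; norm_num⟩
/-- `H = H₁ - H₂`. -/
def H : 𝔤 := H₁ - H₂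
def E : 𝔤 := unit 0 1 (by decide)
def F : 𝔤 := unit 1 0 (by decide)
def E₁ : 𝔤 := unit 0 2 (by decide)
def E₂ : 𝔤 := unit 1 2 (by decide)
def F₁ : 𝔤 := unit 2 0 (by decide)
def F₂ : 𝔤 := unit 2 1 (by decide)

/-- `𝔭 = span{E₁, E₂, F₁, F₂}`, the non-compact part of the Cartan decomposition
`𝔤 = 𝔨 ⊕ 𝔭`. -/
def 𝔭 : Submodule ℂ 𝔤 := Submodule.span ℂ {E₁, E₂, F₁, F₂}

/-- `𝔭` is the `-1` eigenspace of the complexified Cartan involution `x ↦ γ x γ`. -/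
lemma mem_𝔭 {x : 𝔤} : x ∈ 𝔭 ↔
    gam * (x : Matrix (Fin 3) (Fin 3) ℂ) * gam = -(x : Matrix (Fin 3) (Fin 3) ℂ) := by
  constructor
  · intro hx
    induction hx using Submodule.span_induction with
    | mem x hx =>
      rcases hx with rfl | rfl | rfl | rfl <;> ext i j <;> fin_cases i <;> fin_cases j <;>
        simp [gam, E₁, E₂, F₁, F₂, unit]
    | zero => simp
    | add x y _ _ hx hy =>
      have h : ((x + y : 𝔤) : Matrix (Fin 3) (Fin 3) ℂ) = x.1 + y.1 := rfl
      rw [h, Matrix.mul_add, Matrix.add_mul, hx, hy, neg_add]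
    | smul a x _ hx =>
      have h : ((a • x : 𝔤) : Matrix (Fin 3) (Fin 3) ℂ) = a • x.1 := rfl
      rw [h, Matrix.mul_smul, Matrix.smul_mul, hx, smul_neg]
  · intro hx
    have h00 := congrFun (congrFun hx 0) 0
    have h01 := congrFun (congrFun hx 0) 1
    have h10 := congrFun (congrFun hx 1) 0
    have h11 := congrFun (congrFun hx 1) 1
    have h22 := congrFun (congrFun hx 2) 2
    simp [gam, self_eq_neg] at h00 h01 h10 h11 h22
    have e : x = x.1 0 2 • E₁ + x.1 1 2 • E₂ + x.1 2 0 • F₁ + x.1 2 1 • F₂ := by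
      apply Subtype.ext
      change x.1 = x.1 0 2 • E₁.1 + x.1 1 2 • E₂.1 + x.1 2 0 • F₁.1 + x.1 2 1 • F₂.1
      ext i j
      fin_cases i <;> fin_cases j <;>
        simp [E₁, E₂, F₁, F₂, unit, h00, h01, h10, h11, h22]
    rw [e]
    exact add_mem (add_mem (add_mem
      (Submodule.smul_mem _ _ (Submodule.subset_span (by simp)))
      (Submodule.smul_mem _ _ (Submodule.subset_span (by simp))))
      (Submodule.smul_mem _ _ (Submodule.subset_span (by simp))))
      (Submodule.smul_mem _ _ (Submodule.subset_span (by simp)))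

def E₁p : 𝔭 := ⟨E₁, Submodule.subset_span (by simp)⟩
def E₂p : 𝔭 := ⟨E₂, Submodule.subset_span (by simp)⟩
def F₁p : 𝔭 := ⟨F₁, Submodule.subset_span (by simp)⟩
def F₂p : 𝔭 := ⟨F₂, Submodule.subset_span (by simp)⟩

/-! ### The Clifford algebra of `𝔭` -/

/-- The trace form `B(x, y) = tr(xy)` on `𝔭`. -/
def B : LinearMap.BilinForm ℂ 𝔭 :=
  LinearMap.mk₂ ℂ (fun x y => ((x : 𝔤) * (y : 𝔤) : Matrix (Fin 3) (Fin 3) ℂ).trace)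
    (by intros; simp [add_mul]) (by intros; simp) (by intros; simp [mul_add]) (by intros; simp)

/-- The quadratic form `x ↦ -B(x, x)`. -/
def Q : QuadraticForm ℂ 𝔭 := -B.toQuadraticMap

/-- `C(𝔭)`, in the convention `xy + yx = -2B(x, y)` for `x, y ∈ 𝔭`. -/
abbrev Cp : Type := CliffordAlgebra Q

/-- `U(𝔤)`. -/
abbrev Ug : Type := UniversalEnvelopingAlgebra ℂ 𝔤

/-! ### The action of `K` and the invariants -/

/-- The adjoint action `Ad(g) x = g x g⁻¹` on `𝔤`. -/
def Ad (g : Matrix.SpecialLinearGroup (Fin 3) ℂ) : 𝔤 →ₗ⁅ℂ⁆ 𝔤 where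
  toFun x := ⟨(g : Matrix (Fin 3) (Fin 3) ℂ) * (x : Matrix (Fin 3) (Fin 3) ℂ) *
    ((g⁻¹ : Matrix.SpecialLinearGroup (Fin 3) ℂ) : Matrix (Fin 3) (Fin 3) ℂ), by
      rw [mem_𝔤, Matrix.trace_mul_comm, ← Matrix.mul_assoc,
        ← Matrix.SpecialLinearGroup.coe_mul, inv_mul_cancel,
        Matrix.SpecialLinearGroup.coe_one, Matrix.one_mul]
      exact x.2⟩
  map_add' x y := by
    ext1; simp [mul_add, add_mul]
  map_smul' c x := by
    ext1; simp
  map_lie' {x y} := by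
    have h : ((g⁻¹ : Matrix.SpecialLinearGroup (Fin 3) ℂ) : Matrix (Fin 3) (Fin 3) ℂ) *
        (g : Matrix (Fin 3) (Fin 3) ℂ) = 1 := by
      rw [← Matrix.SpecialLinearGroup.coe_mul, inv_mul_cancel, Matrix.SpecialLinearGroup.coe_one]
    apply Subtype.ext
    simp only [LieSubalgebra.coe_bracket, Ring.lie_def]
    generalize ((g⁻¹ : Matrix.SpecialLinearGroup (Fin 3) ℂ) : Matrix (Fin 3) (Fin 3) ℂ) = k at *
    have key : ∀ a b : Matrix (Fin 3) (Fin 3) ℂ,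
        ((g : Matrix (Fin 3) (Fin 3) ℂ) * a * k) * ((g : Matrix (Fin 3) (Fin 3) ℂ) * b * k) =
          (g : Matrix (Fin 3) (Fin 3) ℂ) * (a * b) * k := by
      intro a b
      calc _ = (g : Matrix (Fin 3) (Fin 3) ℂ) * a *
            (k * (g : Matrix (Fin 3) (Fin 3) ℂ)) * b * k := by simp only [Matrix.mul_assoc]
        _ = _ := by rw [h, Matrix.mul_one]; simp only [Matrix.mul_assoc]
    rw [key, key, mul_sub, sub_mul]

lemma K_comm_gam {k : Matrix.SpecialLinearGroup (Fin 3) ℂ} (hk : k ∈ K) :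
    gam * (k : Matrix (Fin 3) (Fin 3) ℂ) = (k : Matrix (Fin 3) (Fin 3) ℂ) * gam := by
  have h1 : (k : Matrix (Fin 3) (Fin 3) ℂ)ᴴ * gam * (k : Matrix (Fin 3) (Fin 3) ℂ) = gam := hk.1
  have h2 : ((k : Matrix (Fin 3) (Fin 3) ℂ)ᴴ)⁻¹ = (k : Matrix (Fin 3) (Fin 3) ℂ) := hk.2
  have h3 : IsUnit ((k : Matrix (Fin 3) (Fin 3) ℂ)ᴴ).det := by
    rw [Matrix.det_conjTranspose, k.2]; simp
  have h4 : (k : Matrix (Fin 3) (Fin 3) ℂ) * (k : Matrix (Fin 3) (Fin 3) ℂ)ᴴ = 1 := by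
    conv_lhs => rw [← h2]
    rw [h2]
    nth_rewrite 1 [← h2]
    exact Matrix.nonsing_inv_mul _ h3
  calc _ = ((k : Matrix (Fin 3) (Fin 3) ℂ) * (k : Matrix (Fin 3) (Fin 3) ℂ)ᴴ) * gam *
        (k : Matrix (Fin 3) (Fin 3) ℂ) := by rw [h4, Matrix.one_mul]
    _ = (k : Matrix (Fin 3) (Fin 3) ℂ) * ((k : Matrix (Fin 3) (Fin 3) ℂ)ᴴ * gam *
        (k : Matrix (Fin 3) (Fin 3) ℂ)) := by simp only [Matrix.mul_assoc]
    _ = _ := by rw [h1]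

lemma Ad_mem_𝔭 {k : Matrix.SpecialLinearGroup (Fin 3) ℂ} (hk : k ∈ K) {x : 𝔤} (hx : x ∈ 𝔭) :
    Ad k x ∈ 𝔭 := by
  rw [mem_𝔭] at *
  have h1 := K_comm_gam hk
  have h2 := K_comm_gam (K.inv_mem hk)
  change gam * ((k : Matrix (Fin 3) (Fin 3) ℂ) * (x : Matrix (Fin 3) (Fin 3) ℂ) *
    ((k⁻¹ : Matrix.SpecialLinearGroup (Fin 3) ℂ) : Matrix (Fin 3) (Fin 3) ℂ)) * gam =
    -((k : Matrix (Fin 3) (Fin 3) ℂ) * (x : Matrix (Fin 3) (Fin 3) ℂ) *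
    ((k⁻¹ : Matrix.SpecialLinearGroup (Fin 3) ℂ) : Matrix (Fin 3) (Fin 3) ℂ))
  generalize ((k⁻¹ : Matrix.SpecialLinearGroup (Fin 3) ℂ) : Matrix (Fin 3) (Fin 3) ℂ) = l at *
  calc _ = (gam * (k : Matrix (Fin 3) (Fin 3) ℂ)) * (x : Matrix (Fin 3) (Fin 3) ℂ) *
        (l * gam) := by simp only [Matrix.mul_assoc]
    _ = (k : Matrix (Fin 3) (Fin 3) ℂ) * (gam * (x : Matrix (Fin 3) (Fin 3) ℂ) * gam) * l := by
        rw [h1, ← h2]; simp only [Matrix.mul_assoc]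
    _ = _ := by rw [hx, Matrix.mul_neg, Matrix.neg_mul]

/-- The action `Ad` of `k ∈ K` on `𝔭`, which preserves the trace form. -/
def AdP (k : K) : Q →qᵢ Q where
  toLinearMap := ((Ad k.1 : 𝔤 →ₗ⁅ℂ⁆ 𝔤) : 𝔤 →ₗ[ℂ] 𝔤).restrict (fun _ hx => Ad_mem_𝔭 k.2 hx)
  map_app' x := by
    have h : ((k.1⁻¹ : Matrix.SpecialLinearGroup (Fin 3) ℂ) : Matrix (Fin 3) (Fin 3) ℂ) *
        (k.1 : Matrix (Fin 3) (Fin 3) ℂ) = 1 := by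
      rw [← Matrix.SpecialLinearGroup.coe_mul, inv_mul_cancel, Matrix.SpecialLinearGroup.coe_one]
    change -(((k.1 : Matrix (Fin 3) (Fin 3) ℂ) * x.1.1 *
        ((k.1⁻¹ : Matrix.SpecialLinearGroup (Fin 3) ℂ) : Matrix (Fin 3) (Fin 3) ℂ)) *
      ((k.1 : Matrix (Fin 3) (Fin 3) ℂ) * x.1.1 *
        ((k.1⁻¹ : Matrix.SpecialLinearGroup (Fin 3) ℂ) : Matrix (Fin 3) (Fin 3) ℂ))).trace =
      -(x.1.1 * x.1.1).trace
    generalize ((k.1⁻¹ : Matrix.SpecialLinearGroup (Fin 3) ℂ) : Matrix (Fin 3) (Fin 3) ℂ) = l at *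
    congr 1
    calc _ = ((k.1 : Matrix (Fin 3) (Fin 3) ℂ) * (x.1.1 * (l * (k.1 : Matrix (Fin 3) (Fin 3) ℂ)) *
          x.1.1) * l).trace := by simp only [Matrix.mul_assoc]
      _ = _ := by
        rw [h, Matrix.mul_one, Matrix.trace_mul_comm, ← Matrix.mul_assoc, h, Matrix.one_mul]

/-- The action of `k ∈ K` on `U(𝔤)` by algebra automorphisms extending `Ad`. -/
def AdU (k : K) : Ug →ₐ[ℂ] Ug :=
  UniversalEnvelopingAlgebra.lift ℂ ((UniversalEnvelopingAlgebra.ι ℂ).comp (Ad k.1))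

/-- The action of `k ∈ K` on `C(𝔭)` by algebra automorphisms extending `Ad`. -/
def AdC (k : K) : Cp →ₐ[ℂ] Cp := CliffordAlgebra.map (AdP k)

/-- The action `Ad ⊗ Ad` of `k ∈ K` on `U(𝔤) ⊗ C(𝔭)`. -/
def act (k : K) : Ug ⊗[ℂ] Cp →ₐ[ℂ] Ug ⊗[ℂ] Cp := Algebra.TensorProduct.map (AdU k) (AdC k)

/-- The algebra `(U(𝔤) ⊗ C(𝔭))^K` of `K`-invariants. -/
def invariants : Subalgebra ℂ (Ug ⊗[ℂ] Cp) where
  carrier := {x | ∀ k : K, act k x = x}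
  mul_mem' hx hy k := by rw [map_mul, hx k, hy k]
  add_mem' hx hy k := by rw [map_add, hx k, hy k]
  algebraMap_mem' r k := (act k).commutes r

/-! ### The distinguished elements -/

/-- The embedding `𝔤 → U(𝔤)`. -/
abbrev u (x : 𝔤) : Ug := UniversalEnvelopingAlgebra.ι ℂ x

/-- The embedding `𝔭 → C(𝔭)`. -/
abbrev c (x : 𝔭) : Cp := CliffordAlgebra.ι Q x

/-- `ã = (H₁ + H₂) ⊗ 1`. -/
def aTilde : Ug ⊗[ℂ] Cp := (u H₁ + u H₂) ⊗ₜ 1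

/-- `b̃ = (H² + 2(EF + FE)) ⊗ 1`. -/
def bTilde : Ug ⊗[ℂ] Cp := (u H ^ 2 + 2 * (u E * u F + u F * u E)) ⊗ₜ 1

/-- `g̃ = 1 ⊗ (E₁F₁ + E₂F₂)`. -/
def gTilde : Ug ⊗[ℂ] Cp := 1 ⊗ₜ (c E₁p * c F₁p + c E₂p * c F₂p)

/-- `ĩ = 2E ⊗ E₂F₁ + H ⊗ E₁F₁ - H ⊗ E₂F₂ + 2F ⊗ E₁F₂`. -/
def iTilde : Ug ⊗[ℂ] Cp :=
  (2 * u E) ⊗ₜ (c E₂p * c F₁p) + u H ⊗ₜ (c E₁p * c F₁p) - u H ⊗ₜ (c E₂p * c F₂p)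
    + (2 * u F) ⊗ₜ (c E₁p * c F₂p)

/-- The Dirac operator `D = E₁ ⊗ F₁ + E₂ ⊗ F₂ + F₁ ⊗ E₁ + F₂ ⊗ E₂`, i.e. `∑ bᵢ ⊗ dᵢ` for a basis
`bᵢ` of `𝔭` and its dual basis `dᵢ` with respect to the trace form. -/
def D : Ug ⊗[ℂ] Cp :=
  u E₁ ⊗ₜ c F₁p + u E₂ ⊗ₜ c F₂p + u F₁ ⊗ₜ c E₁p + u F₂ ⊗ₜ c E₂p

/-- The two-sided ideal of `(U(𝔤) ⊗ C(𝔭))^K` generated by the invariant element `D`. -/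
abbrev diracIdeal (hD : D ∈ invariants) : TwoSidedIdeal invariants :=
  TwoSidedIdeal.span {⟨D, hD⟩}

/-- The quotient algebra of `(U(𝔤) ⊗ C(𝔭))^K` by the ideal generated by `D`. -/
abbrev DiracQuotient (hD : D ∈ invariants) : Type := (diracIdeal hD).ringCon.Quotient

/-- The class in the quotient algebra of an invariant element. -/
abbrev cls (hD : D ∈ invariants) (x : invariants) : DiracQuotient hD :=
  (diracIdeal hD).ringCon.mk' x

end DiracSU21

end

set_option linter.unusedSectionVars false

open scoped TensorProduct Matrix

noncomputable section

namespace DiracSU21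

attribute [local instance] LieRing.ofAssociativeRing

/-! ### Filtrations by graded generators -/

/-! The statement about the quotient follows from one about the invariants themselves: by
`invariants_eq_genAlg` they are generated by `ã, b̃, ĩ, g̃` and `D`. Killing `D` leaves four
generators, and these commute with each other already in `U(𝔤) ⊗ C(𝔭)` (`commute_of_mem`).

Generation is a first fundamental theorem for SL(2). Under the copy of `𝔰𝔩(2)` spanned by `E, F, H`,
the algebra `U(𝔤) ⊗ C(𝔭)` is generated by an invariant letter, a triplet (a symmetric matrix `X`)
and four doublets: the two halves of `𝔭`, of charge 1 and -1, once in `U(𝔤)` (even letters) and once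
in `C(𝔭)` (odd letters). The letters supercommute up to lower degree, so modulo lower degree a word
of charge zero can be sorted into central letters, then matrix entries, then doublets of alternating
charge. Such a word is a tensor in binary indices. Antisymmetrising two neighbouring indices
contracts them with the alternating form, and the result is covered by induction: the contraction
lies in the algebra `S` of known invariants up to lower degree (`Good.pair_vec_mem`,
`Good.contract_mem`), or the word has fewer matrix entries. Modulo such terms a tensor with N > 0
indices is therefore symmetric, that is of spin N/2, and the Casimir operator acts on it by N(N+2)/4
≠ 0 (`IsForm.mem_reach`). Hence every element of charge zero is carried into `S` by a polynomial in
the Casimir operator with nonzero constant term (`Good.filt_le_reach`); an element annihilated by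
the Casimir operator is only rescaled by such a polynomial, so it lies in `S`. Complete reducibility
is never used.

The contractions come from few elements. The pairing of the odd doublets is `-g̃`, and with `X`
inserted it is `ĩ/2`. Bracketing with `g̃` splits `D` into its two halves
(`Rels.pair_even_odd_mem`), bracketing with `ĩ` inserts `X`, and the anticommutator with a half of
`D` turns an odd letter into an even one (`Rels.anticommutator_pair`).

Invariance under `K` is made infinitesimal with one element of infinite order in each of three
circles of `K` (`ad_eq_zero_of_fixed`). -/

/-- The sign of supercommutation. -/
def sgn (p q : ZMod 2) : ℂ := ((if p = 1 ∧ q = 1 then -1 else 1 : ℤ) : ℂ)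

lemma sgn_add_left (p q r : ZMod 2) : sgn (p + q) r = sgn p r * sgn q r := by
  -- The sign is defined as the cast of an integer so that this identity is decidable.
  have : ∀ p q r : ZMod 2, (if p + q = 1 ∧ r = 1 then -1 else 1 : ℤ) =
    (if p = 1 ∧ r = 1 then -1 else 1) * (if q = 1 ∧ r = 1 then -1 else 1) := by decide
  rw [sgn, this, Int.cast_mul, sgn, sgn]

lemma sgn_add_right (p q r : ZMod 2) : sgn p (q + r) = sgn p q * sgn p r := by
  have : ∀ p q r : ZMod 2, (if p = 1 ∧ q + r = 1 then -1 else 1 : ℤ) =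
    (if p = 1 ∧ q = 1 then -1 else 1) * (if p = 1 ∧ r = 1 then -1 else 1) := by decide
  rw [sgn, this, Int.cast_mul, sgn, sgn]

lemma sgn_zero_left (p : ZMod 2) : sgn 0 p = 1 := by simp [sgn]

lemma sgn_zero_right (p : ZMod 2) : sgn p 0 = 1 := by simp [sgn]

/-- A family of elements of an algebra, each with a degree, a charge and a parity. -/
structure GradedGens (Γ M : Type*) where
  val : Γ → M
  deg : Γ → ℕ
  charge : Γ → ℤ
  parity : Γ → ZMod 2

namespace GradedGens

variable {Γ M : Type*} [Ring M] [Algebra ℂ M] (g : GradedGens Γ M)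

/-- The product of a word in the generators. -/
def word (l : List Γ) : M := (l.map g.val).prod
def wdeg (l : List Γ) : ℕ := (l.map g.deg).sum
def wcharge (l : List Γ) : ℤ := (l.map g.charge).sum
def wparity (l : List Γ) : ZMod 2 := (l.map g.parity).sum

/-- The span of the words of degree less than `n`, of charge `c` and of parity `p`. -/
def filt (n : ℕ) (c : ℤ) (p : ZMod 2) : Submodule ℂ M :=
  Submodule.span ℂ {x | ∃ l, g.wdeg l < n ∧ g.wcharge l = c ∧ g.wparity l = p ∧ x = g.word l}

/-- The generators supercommute up to terms of lower degree. -/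
def SuperComm : Prop := ∀ x y, g.val x * g.val y - sgn (g.parity x) (g.parity y) •
  (g.val y * g.val x) ∈ g.filt (g.deg x + g.deg y) (g.charge x + g.charge y)
    (g.parity x + g.parity y)

variable {g}

@[simp] lemma word_nil : g.word [] = 1 := rfl
@[simp] lemma word_cons (x : Γ) (l : List Γ) : g.word (x :: l) = g.val x * g.word l := by
  simp [word]
@[simp] lemma word_append (l l' : List Γ) : g.word (l ++ l') = g.word l * g.word l' := by
  simp [word]
@[simp] lemma wdeg_nil : g.wdeg [] = 0 := rfl
@[simp] lemma wdeg_cons (x : Γ) (l : List Γ) : g.wdeg (x :: l) = g.deg x + g.wdeg l := by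
  simp [wdeg]
@[simp] lemma wdeg_append (l l' : List Γ) : g.wdeg (l ++ l') = g.wdeg l + g.wdeg l' := by
  simp [wdeg]
@[simp] lemma wcharge_nil : g.wcharge [] = 0 := rfl
@[simp] lemma wcharge_cons (x : Γ) (l : List Γ) :
    g.wcharge (x :: l) = g.charge x + g.wcharge l := by
  simp [wcharge]
@[simp] lemma wcharge_append (l l' : List Γ) :
    g.wcharge (l ++ l') = g.wcharge l + g.wcharge l' := by
  simp [wcharge]
@[simp] lemma wparity_nil : g.wparity [] = 0 := rfl
@[simp] lemma wparity_cons (x : Γ) (l : List Γ) :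
    g.wparity (x :: l) = g.parity x + g.wparity l := by
  simp [wparity]
@[simp] lemma wparity_append (l l' : List Γ) :
    g.wparity (l ++ l') = g.wparity l + g.wparity l' := by
  simp [wparity]

lemma wdeg_perm {l l' : List Γ} (h : l.Perm l') : g.wdeg l = g.wdeg l' := (h.map _).sum_eq

lemma wcharge_perm {l l' : List Γ} (h : l.Perm l') : g.wcharge l = g.wcharge l' :=
  (h.map _).sum_eq

lemma wparity_perm {l l' : List Γ} (h : l.Perm l') : g.wparity l = g.wparity l' :=
  (h.map _).sum_eq

lemma word_mem {l : List Γ} {n : ℕ} (h : g.wdeg l < n) :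
    g.word l ∈ g.filt n (g.wcharge l) (g.wparity l) :=
  Submodule.subset_span ⟨l, h, rfl, rfl, rfl⟩

lemma val_mem (x : Γ) : g.val x ∈ g.filt (g.deg x + 1) (g.charge x) (g.parity x) :=
  Submodule.subset_span ⟨[x], by simp, by simp, by simp, by simp⟩

lemma one_mem_filt : (1 : M) ∈ g.filt 1 0 0 :=
  Submodule.subset_span ⟨[], by simp, by simp, by simp, by simp⟩

lemma filt_mono {m n : ℕ} (h : m ≤ n) (c : ℤ) (p : ZMod 2) : g.filt m c p ≤ g.filt n c p :=
  Submodule.span_mono fun _ ⟨l, h1, h2⟩ => ⟨l, h1.trans_le h, h2⟩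

/-- The bound on the degree is strict, so the filtration begins with zero; this starts the induction
on the degree. -/
lemma filt_zero (c : ℤ) (p : ZMod 2) : g.filt 0 c p = ⊥ := by
  rw [filt, Submodule.span_eq_bot]
  rintro _ ⟨l, h, -⟩
  omega

/-- Degrees below `m` and at most `n` add up to less than `m + n`, hence the shift by one in a
single factor. -/
lemma mul_mem_left {m n : ℕ} {c c' : ℤ} {p p' : ZMod 2} {x y : M} (hx : x ∈ g.filt m c p)
    (hy : y ∈ g.filt (n + 1) c' p') : x * y ∈ g.filt (m + n) (c + c') (p + p') := by
  induction hx using Submodule.span_induction with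
  | zero => simp
  | add x x' _ _ h h' => rw [add_mul]; exact add_mem h h'
  | smul a x _ h => rw [smul_mul_assoc]; exact Submodule.smul_mem _ _ h
  | mem x hx =>
    induction hy using Submodule.span_induction with
    | zero => simp
    | add y y' _ _ h h' => rw [mul_add]; exact add_mem h h'
    | smul a y _ h => rw [mul_smul_comm]; exact Submodule.smul_mem _ _ h
    | mem y hy =>
      obtain ⟨l, h1, rfl, rfl, rfl⟩ := hx
      obtain ⟨l', h1', rfl, rfl, rfl⟩ := hy
      exact Submodule.subset_span ⟨l ++ l', by simp; omega, by simp, by simp, by simp⟩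

lemma mul_mem_right {m n : ℕ} {c c' : ℤ} {p p' : ZMod 2} {x y : M}
    (hx : x ∈ g.filt (m + 1) c p) (hy : y ∈ g.filt n c' p') :
    x * y ∈ g.filt (m + n) (c + c') (p + p') := by
  rcases n with _ | n
  · rw [filt_zero, Submodule.mem_bot] at hy
    simp [hy]
  · have := mul_mem_left hx hy
    rwa [show m + (n + 1) = m + 1 + n by omega]

lemma mul_mem_filt {m n : ℕ} {c c' : ℤ} {p p' : ZMod 2} {x y : M}
    (hx : x ∈ g.filt (m + 1) c p) (hy : y ∈ g.filt (n + 1) c' p') :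
    x * y ∈ g.filt (m + n + 1) (c + c') (p + p') :=
  mul_mem_right (n := n + 1) hx hy

lemma SuperComm.val_word (hg : g.SuperComm) (x : Γ) (l : List Γ) :
    g.val x * g.word l - sgn (g.parity x) (g.wparity l) • (g.word l * g.val x) ∈
      g.filt (g.deg x + g.wdeg l) (g.charge x + g.wcharge l) (g.parity x + g.wparity l) := by
  induction l with
  | nil => simp [sgn_zero_right]
  | cons y l ih =>
    have h1 := mul_mem_left (hg x y) (word_mem (Nat.lt_succ_self (g.wdeg l)))
    have h2 := Submodule.smul_mem _ (sgn (g.parity x) (g.parity y)) (mul_mem_right (val_mem y) ih)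
    have h3 : g.charge y + (g.charge x + g.wcharge l) = g.charge x + g.charge y + g.wcharge l := by
      ring
    have h4 : g.parity y + (g.parity x + g.wparity l) = g.parity x + g.parity y + g.wparity l := by
      ring
    rw [h3, h4, show g.deg y + (g.deg x + g.wdeg l) = g.deg x + g.deg y + g.wdeg l by ring] at h2
    have h5 := add_mem h1 h2
    simp only [word_cons, wdeg_cons, wcharge_cons, wparity_cons, ← add_assoc]
    convert h5 using 1
    rw [sgn_add_right, mul_sub, sub_mul, smul_sub, smul_mul_assoc, mul_smul_comm, mul_smul,
      smul_comm (sgn (g.parity x) (g.parity y))]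
    simp only [mul_assoc]
    rw [smul_comm (sgn (g.parity x) (g.wparity l))]
    abel

lemma SuperComm.word_word (hg : g.SuperComm) (k l : List Γ) :
    g.word k * g.word l - sgn (g.wparity k) (g.wparity l) • (g.word l * g.word k) ∈
      g.filt (g.wdeg k + g.wdeg l) (g.wcharge k + g.wcharge l) (g.wparity k + g.wparity l) := by
  induction k with
  | nil => simp [sgn_zero_left]
  | cons x k ih =>
    have h1 := mul_mem_right (val_mem x) ih
    have h2 := Submodule.smul_mem _ (sgn (g.wparity k) (g.wparity l))
      (mul_mem_left (hg.val_word x l) (word_mem (Nat.lt_succ_self (g.wdeg k))))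
    rw [show g.charge x + g.wcharge l + g.wcharge k = g.charge x + (g.wcharge k + g.wcharge l) by
      ring, show g.parity x + g.wparity l + g.wparity k =
      g.parity x + (g.wparity k + g.wparity l) by ring,
      show g.deg x + g.wdeg l + g.wdeg k = g.deg x + (g.wdeg k + g.wdeg l) by ring] at h2
    have h5 := add_mem h1 h2
    simp only [word_cons, wdeg_cons, wcharge_cons, wparity_cons, add_assoc]
    convert h5 using 1
    rw [sgn_add_left, mul_sub, sub_mul, smul_sub, smul_mul_assoc, mul_smul_comm, mul_smul]
    simp only [mul_assoc]
    rw [smul_comm (sgn (g.parity x) (g.wparity l))]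
    abel

lemma SuperComm.mem (hg : g.SuperComm) {m n : ℕ} {c c' : ℤ} {p p' : ZMod 2} {x y : M}
    (hx : x ∈ g.filt (m + 1) c p) (hy : y ∈ g.filt (n + 1) c' p') :
    x * y - sgn p p' • (y * x) ∈ g.filt (m + n) (c + c') (p + p') := by
  induction hx using Submodule.span_induction with
  | zero => simp
  | add x x' _ _ h h' =>
    have := add_mem h h'
    rwa [show (x + x') * y - sgn p p' • (y * (x + x')) =
      x * y - sgn p p' • (y * x) + (x' * y - sgn p p' • (y * x')) by
        rw [add_mul, mul_add, smul_add]; abel]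
  | smul a x _ h =>
    have := Submodule.smul_mem _ a h
    rwa [smul_mul_assoc, mul_smul_comm, smul_comm _ a, ← smul_sub]
  | mem x hx =>
    induction hy using Submodule.span_induction with
    | zero => simp
    | add y y' _ _ h h' =>
      have := add_mem h h'
      rwa [show x * (y + y') - sgn p p' • ((y + y') * x) =
        x * y - sgn p p' • (y * x) + (x * y' - sgn p p' • (y' * x)) by
          rw [add_mul, mul_add, smul_add]; abel]
    | smul a y _ h =>
      have := Submodule.smul_mem _ a h
      rwa [smul_mul_assoc, mul_smul_comm, smul_comm _ a, ← smul_sub]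
    | mem y hy =>
      obtain ⟨l, h1, rfl, rfl, rfl⟩ := hx
      obtain ⟨l', h1', rfl, rfl, rfl⟩ := hy
      exact filt_mono (by omega) _ _ (hg.word_word l l')

/-- Each adjacent transposition costs a sign and terms of lower degree. The value of the resulting
scalar never matters, since it only multiplies a member of a subspace. -/
lemma SuperComm.perm (hg : g.SuperComm) {l l' : List Γ} (h : l.Perm l') :
    ∃ r : ℂ, g.word l - r • g.word l' ∈ g.filt (g.wdeg l) (g.wcharge l) (g.wparity l) := by
  induction h with
  | nil => exact ⟨1, by simp⟩
  | @cons x l l' _ ih =>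
    obtain ⟨r, hr⟩ := ih
    refine ⟨r, ?_⟩
    have := mul_mem_right (val_mem x) hr
    rwa [mul_sub, mul_smul_comm] at this
  | swap x y l =>
    refine ⟨sgn (g.parity y) (g.parity x), ?_⟩
    have := mul_mem_left (hg y x) (word_mem (Nat.lt_succ_self (g.wdeg l)))
    simp only [word_cons, wdeg_cons, wcharge_cons, wparity_cons, ← add_assoc]
    rw [sub_mul, smul_mul_assoc] at this
    simpa only [mul_assoc] using this
  | @trans l l' l'' h1 h2 ih1 ih2 =>
    obtain ⟨r, hr⟩ := ih1
    obtain ⟨r', hr'⟩ := ih2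
    rw [← wdeg_perm h1, ← wcharge_perm h1, ← wparity_perm h1] at hr'
    refine ⟨r * r', ?_⟩
    have := add_mem hr (Submodule.smul_mem _ r hr')
    rwa [smul_sub, smul_smul, sub_add_sub_cancel] at this

end GradedGens

/-! ### The Casimir operator and elements that it moves into a subalgebra of invariants -/

section Casimir

open Polynomial

variable {M : Type*} [Ring M] [Algebra ℂ M]

/-- The inner derivation `m ↦ x m - m x`. -/
def ad (x : M) : Module.End ℂ M := LinearMap.mulLeft ℂ x - LinearMap.mulRight ℂ x

lemma ad_apply (x m : M) : ad x m = x * m - m * x := rfl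

lemma ad_mul (x m n : M) : ad x (m * n) = ad x m * n + m * ad x n := by
  simp only [ad_apply, mul_sub, sub_mul, mul_assoc]; abel

lemma ad_one (x : M) : ad x 1 = 0 := by simp [ad_apply]

/-- The Casimir operator of the adjoint action of a triple `e, f, h`. -/
noncomputable def cas (e f h : M) : Module.End ℂ M :=
  ad f * ad e + (1 / 4 : ℂ) • (ad h * ad h) + (1 / 2 : ℂ) • ad h

lemma cas_apply (e f h m : M) : cas e f h m =
    ad f (ad e m) + (1 / 4 : ℂ) • ad h (ad h m) + (1 / 2 : ℂ) • ad h m := rfl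

/-- `S` commutes with `e`, `f`, `h`. -/
def Centralizes (S : Subalgebra ℂ M) (e f h : M) : Prop :=
  ∀ s ∈ S, ad e s = 0 ∧ ad f s = 0 ∧ ad h s = 0

variable {S : Subalgebra ℂ M} {e f h : M}

lemma Centralizes.cas_mul (hS : Centralizes S e f h) {s : M} (hs : s ∈ S) (m : M) :
    cas e f h (s * m) = s * cas e f h m := by
  obtain ⟨h1, h2, h3⟩ := hS s hs
  simp only [cas_apply, ad_mul, h1, h2, h3, zero_mul, zero_add, mul_add, mul_smul_comm]

lemma Centralizes.aeval_mul (hS : Centralizes S e f h) {s : M} (hs : s ∈ S) (q : ℂ[X]) (m : M) :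
    aeval (cas e f h) q (s * m) = s * aeval (cas e f h) q m := by
  have h1 : Commute (cas e f h) (LinearMap.mulLeft ℂ s) :=
    LinearMap.ext fun m => hS.cas_mul hs m
  have h2 : Commute (aeval (cas e f h) q) (LinearMap.mulLeft ℂ s) := by
    induction q using Polynomial.induction_on' with
    | add p q hp hq => rw [map_add]; exact hp.add_left hq
    | monomial n a =>
      rw [aeval_monomial]
      exact (Algebra.commute_algebraMap_left a _).mul_left (h1.pow_left n)
  exact congrArg (fun φ : Module.End ℂ M => φ m) h2.eq

lemma aeval_eq_of_apply_eq_zero {T : Module.End ℂ M} {m : M} (hm : T m = 0) (q : ℂ[X]) :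
    aeval T q m = q.eval 0 • m := by
  induction q using Polynomial.induction_on' with
  | add p q hp hq => rw [map_add, LinearMap.add_apply, hp, hq, eval_add, add_smul]
  | monomial n a =>
    rw [aeval_monomial, Module.algebraMap_end_eq_smul_id]
    rcases n with _ | n
    · simp
    · simp [pow_succ, hm]

lemma Centralizes.cas_eq_zero (hS : Centralizes S e f h) {s : M} (hs : s ∈ S) :
    cas e f h s = 0 := by
  obtain ⟨h1, h2, h3⟩ := hS s hs
  simp [cas_apply, h1, h3]

/-- The elements which a polynomial in the Casimir operator with nonzero constant term moves
into `S`. -/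
noncomputable def reach (hS : Centralizes S e f h) : Submodule ℂ M where
  carrier := {m | ∃ q : ℂ[X], q.eval 0 ≠ 0 ∧ aeval (cas e f h) q m ∈ S}
  zero_mem' := ⟨1, by simp, by simp⟩
  add_mem' := by
    rintro m n ⟨q, hq, hm⟩ ⟨r, hr, hn⟩
    -- Once one factor has carried its element into `S`, which the Casimir operator annihilates, the
    -- other factor acts by its constant term.
    refine ⟨q * r, by simp [hq, hr], ?_⟩
    have h1 : aeval (cas e f h) (q * r) m = r.eval 0 • aeval (cas e f h) q m := by
      rw [mul_comm, map_mul, Module.End.mul_apply,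
        aeval_eq_of_apply_eq_zero (hS.cas_eq_zero hm)]
    have h2 : aeval (cas e f h) (q * r) n = q.eval 0 • aeval (cas e f h) r n := by
      rw [map_mul, Module.End.mul_apply, aeval_eq_of_apply_eq_zero (hS.cas_eq_zero hn)]
    rw [map_add, h1, h2]
    exact add_mem (S.smul_mem hm _) (S.smul_mem hn _)
  smul_mem' := by
    rintro c m ⟨q, hq, hm⟩
    exact ⟨q, hq, by rw [map_smul]; exact S.smul_mem hm _⟩

lemma mul_mem_reach (hS : Centralizes S e f h) {s m : M} (hs : s ∈ S) (hm : m ∈ reach hS) :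
    s * m ∈ reach hS := by
  obtain ⟨q, hq, hm⟩ := hm
  exact ⟨q, hq, by rw [hS.aeval_mul hs]; exact S.mul_mem hs hm⟩

lemma le_reach (hS : Centralizes S e f h) {s : M} (hs : s ∈ S) : s ∈ reach hS :=
  ⟨1, by simp, by simpa using hs⟩

/-- A polynomial that works for `cas m - c • m` is multiplied by `X - c`, whose constant term is
nonzero. -/
lemma mem_reach_of_cas (hS : Centralizes S e f h) {c : ℂ} (hc : c ≠ 0) {m : M}
    (hm : cas e f h m - c • m ∈ reach hS) : m ∈ reach hS := by
  obtain ⟨q, hq, hm⟩ := hm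
  refine ⟨q * (X - C c), by simp [hq, hc], ?_⟩
  rwa [map_mul, Module.End.mul_apply, map_sub, aeval_X, aeval_C, LinearMap.sub_apply,
    Module.algebraMap_end_apply]

/-- On the kernel of the Casimir operator a polynomial acts by its constant term, here invertible.
-/
lemma mem_of_mem_reach (hS : Centralizes S e f h) {m : M} (hm : m ∈ reach hS)
    (h0 : cas e f h m = 0) : m ∈ S := by
  obtain ⟨q, hq, hm⟩ := hm
  rw [aeval_eq_of_apply_eq_zero h0] at hm
  have := S.smul_mem hm (q.eval 0)⁻¹
  rwa [smul_smul, inv_mul_cancel₀ hq, one_smul] at this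

/-! ### Equivariant forms in several binary indices -/

/-- `φ` is a form in the binary indices `ι s`, `lo ≤ s < hi`, on each of which `e`, `f`, `h` act
as on the standard basis of the two-dimensional representation. -/
structure IsForm (e f h : M) (φ : (ℕ → Fin 2) → M) (lo hi : ℕ) : Prop where
  le : lo ≤ hi
  congr : ∀ ι κ, (∀ s, lo ≤ s → s < hi → ι s = κ s) → φ ι = φ κ
  ad_e : ∀ ι, ad e (φ ι) =
    ∑ s ∈ Finset.Ico lo hi, if ι s = 1 then φ (Function.update ι s 0) else 0
  ad_f : ∀ ι, ad f (φ ι) =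
    ∑ s ∈ Finset.Ico lo hi, if ι s = 0 then φ (Function.update ι s 1) else 0
  ad_h : ∀ ι, ad h (φ ι) =
    (∑ s ∈ Finset.Ico lo hi, if ι s = 0 then (1 : ℂ) else -1) • φ ι

lemma IsForm.one (lo : ℕ) : IsForm e f h (fun _ => (1 : M)) lo lo where
  le := le_rfl
  congr _ _ _ := rfl
  ad_e _ := by simp [ad_one]
  ad_f _ := by simp [ad_one]
  ad_h _ := by simp [ad_one]

lemma IsForm.mul {φ ψ : (ℕ → Fin 2) → M} {lo mid hi : ℕ} (hφ : IsForm e f h φ lo mid)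
    (hψ : IsForm e f h ψ mid hi) : IsForm e f h (fun ι => φ ι * ψ ι) lo hi := by
  have e1 : ∀ ι s b, s ∈ Finset.Ico lo mid → ψ (Function.update ι s b) = ψ ι := by
    intro ι s b hs
    rw [Finset.mem_Ico] at hs
    exact hψ.congr _ _ fun t ht _ => Function.update_of_ne (by omega) _ _
  have e2 : ∀ ι s b, s ∈ Finset.Ico mid hi → φ (Function.update ι s b) = φ ι := by
    intro ι s b hs
    rw [Finset.mem_Ico] at hs
    exact hφ.congr _ _ fun t _ ht => Function.update_of_ne (by omega) _ _
  refine ⟨hφ.le.trans hψ.le, fun ι κ hικ => ?_, fun ι => ?_, fun ι => ?_, fun ι => ?_⟩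
  · have := hφ.le
    have := hψ.le
    show φ ι * ψ ι = φ κ * ψ κ
    rw [hφ.congr ι κ fun s h1 h2 => hικ s h1 (by omega),
      hψ.congr ι κ fun s h1 h2 => hικ s (by omega) h2]
  · rw [ad_mul, hφ.ad_e, hψ.ad_e, ← Finset.sum_Ico_consecutive _ hφ.le hψ.le, Finset.sum_mul,
      Finset.mul_sum]
    congr 1
    · exact Finset.sum_congr rfl fun s hs => by rw [e1 ι s 0 hs, ite_mul, zero_mul]
    · exact Finset.sum_congr rfl fun s hs => by rw [e2 ι s 0 hs, mul_ite, mul_zero]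
  · rw [ad_mul, hφ.ad_f, hψ.ad_f, ← Finset.sum_Ico_consecutive _ hφ.le hψ.le, Finset.sum_mul,
      Finset.mul_sum]
    congr 1
    · exact Finset.sum_congr rfl fun s hs => by rw [e1 ι s 1 hs, ite_mul, zero_mul]
    · exact Finset.sum_congr rfl fun s hs => by rw [e2 ι s 1 hs, mul_ite, mul_zero]
  · rw [ad_mul, hφ.ad_h, hψ.ad_h, ← Finset.sum_Ico_consecutive _ hφ.le hψ.le, add_smul,
      smul_mul_assoc, mul_smul_comm]

lemma sum_ite_zero_one (ι : ℕ → Fin 2) (N : ℕ) :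
    (∑ s ∈ Finset.Ico 0 N, if ι s = 0 then (1 : ℂ) else 0) +
      (∑ s ∈ Finset.Ico 0 N, if ι s = 1 then (1 : ℂ) else 0) = N := by
  rw [← Finset.sum_add_distrib]
  have : ∀ i : Fin 2, (if i = 0 then (1 : ℂ) else 0) + (if i = 1 then (1 : ℂ) else 0) = 1 := by
    intro i; fin_cases i <;> simp
  simp [this]

lemma update_update_eq_comp_swap {ι : ℕ → Fin 2} {s t : ℕ} (hst : t ≠ s) (hs : ι s = 1)
    (ht : ι t = 0) :
    Function.update (Function.update ι s 0) t 1 = ι ∘ Equiv.swap s t := by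
  funext r
  by_cases h1 : r = t
  · subst h1; simp [hs]
  · by_cases h2 : r = s
    · subst h2; simp [h1, ht]
    · simp [h1, h2, Equiv.swap_apply_of_ne_of_ne]

/-- A form in at least one index that is symmetric modulo `reach hS` has values in `reach hS`. -/
lemma IsForm.mem_reach (hS : Centralizes S e f h) {φ : (ℕ → Fin 2) → M} {N : ℕ}
    (hφ : IsForm e f h φ 0 N) (hN : N ≠ 0)
    (hsymm : ∀ ι, ∀ s < N, ∀ t < N, φ ι - φ (ι ∘ Equiv.swap s t) ∈ reach hS) (ι : ℕ → Fin 2) :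
    φ ι ∈ reach hS := by
  set n₀ : ℂ := ∑ s ∈ Finset.Ico 0 N, if ι s = 0 then (1 : ℂ) else 0 with hn₀
  set n₁ : ℂ := ∑ s ∈ Finset.Ico 0 N, if ι s = 1 then (1 : ℂ) else 0 with hn₁
  have hsum : n₀ + n₁ = N := sum_ite_zero_one ι N
  have hh : ad h (φ ι) = (n₀ - n₁) • φ ι := by
    rw [hφ.ad_h, hn₀, hn₁, ← Finset.sum_sub_distrib]
    congr 2
    funext s
    generalize ι s = i
    fin_cases i <;> simp
  -- `e` changes one of the `n₁` indices equal to 1; then `f` changes one of the `n₀ + 1` indices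
  -- equal to 0. Each outcome is `ι` with two entries exchanged, or `ι` itself, so it has the value
  -- `φ ι` modulo `reach hS`.
  have hfe : ad f (ad e (φ ι)) - (n₁ * (n₀ + 1)) • φ ι ∈ reach hS := by
    have h1 : ∀ s ∈ Finset.Ico 0 N, ι s = 1 →
        ad f (φ (Function.update ι s 0)) - (n₀ + 1) • φ ι ∈ reach hS := by
      intro s hs hs1
      have h2 : n₀ + 1 =
          ∑ t ∈ Finset.Ico 0 N, if Function.update ι s 0 t = 0 then (1 : ℂ) else 0 := by
        rw [hn₀, ← Finset.add_sum_erase _ _ hs, ← Finset.add_sum_erase (Finset.Ico 0 N) _ hs]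
        simp only [hs1, one_ne_zero, if_false, Function.update_self, if_true, zero_add]
        rw [add_comm]
        congr 1
        refine Finset.sum_congr rfl fun t ht => ?_
        rw [Function.update_of_ne (Finset.ne_of_mem_erase ht)]
      rw [hφ.ad_f, h2, Finset.sum_smul, ← Finset.sum_sub_distrib]
      refine sum_mem fun t ht => ?_
      by_cases hts : t = s
      · subst hts
        have : Function.update (Function.update ι t 0) t 1 = ι := by
          rw [Function.update_idem, ← hs1, Function.update_eq_self]
        simp [this]
      · rw [Function.update_of_ne hts]
        by_cases ht0 : ι t = 0
        · rw [if_pos ht0, if_pos ht0, one_smul, update_update_eq_comp_swap hts hs1 ht0,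
            ← neg_sub]
          exact neg_mem (hsymm ι s (Finset.mem_Ico.1 hs).2 t (Finset.mem_Ico.1 ht).2)
        · simp [ht0]
    rw [hφ.ad_e, map_sum, hn₁, Finset.sum_mul, Finset.sum_smul, ← Finset.sum_sub_distrib]
    refine sum_mem fun s hs => ?_
    by_cases hs1 : ι s = 1
    · rw [if_pos hs1, if_pos hs1, one_mul]
      exact h1 s hs hs1
    · simp [hs1]
  -- The Casimir scalar of spin N/2: with N = n₀ + n₁ it equals n₁(n₀ + 1) + (n₀ - n₁)²/4 + (n₀ -
  -- n₁)/2.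
  refine mem_reach_of_cas hS (c := (N * (N + 2) : ℂ) / 4) ?_ ?_
  · have h1 : (N : ℂ) ≠ 0 := by exact_mod_cast hN
    have h2 : (N + 2 : ℂ) ≠ 0 := by exact_mod_cast (by omega : N + 2 ≠ 0)
    simp [h1, h2]
  · have : cas e f h (φ ι) - ((N * (N + 2) : ℂ) / 4) • φ ι =
        ad f (ad e (φ ι)) - (n₁ * (n₀ + 1)) • φ ι := by
      rw [cas_apply, hh, map_smul, hh, smul_smul, smul_smul, smul_smul, ← hsum]
      module
    rwa [this]

/-- To be symmetric modulo a subspace it suffices to be so under adjacent transpositions. -/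
lemma symm_of_adjacent {φ : (ℕ → Fin 2) → M} {G : Submodule ℂ M} {N : ℕ}
    (hadj : ∀ s, s + 1 < N → ∀ ι, φ ι - φ (ι ∘ Equiv.swap s (s + 1)) ∈ G) (ι : ℕ → Fin 2) :
    ∀ s < N, ∀ t < N, φ ι - φ (ι ∘ Equiv.swap s t) ∈ G := by
  have key : ∀ d s, s + d < N → ∀ ι, φ ι - φ (ι ∘ Equiv.swap s (s + d)) ∈ G := by
    intro d
    induction d with
    | zero => intro s _ ι; simp
    | succ d ih =>
      intro s hs ι
      rcases Nat.eq_zero_or_pos d with rfl | hd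
      · exact hadj s hs ι
      have h1 := ih s (by omega) ι
      have h2 := hadj (s + d) hs (ι ∘ Equiv.swap s (s + d))
      have h3 := ih s (by omega) ((ι ∘ Equiv.swap s (s + d)) ∘ Equiv.swap (s + d) (s + d + 1))
      -- The transposition (s, s+d+1) is the conjugate of (s+d, s+d+1) by (s, s+d).
      have h4 : ((ι ∘ Equiv.swap s (s + d)) ∘ Equiv.swap (s + d) (s + d + 1)) ∘
          Equiv.swap s (s + d) = ι ∘ Equiv.swap s (s + (d + 1)) := by
        have h5 := Equiv.swap_mul_swap_mul_swap (x := s + d + 1) (y := s + d) (z := s) (by omega)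
          (by omega)
        rw [Equiv.swap_comm (s + d) s, Equiv.swap_comm (s + d + 1) (s + d)] at h5
        rw [← add_assoc, ← h5]
        rfl
      rw [h4] at h3
      have := add_mem (add_mem h1 h2) h3
      simpa using this
  intro s hs t ht
  rcases le_total s t with hst | hst
  · obtain ⟨d, rfl⟩ := Nat.exists_eq_add_of_le hst
    exact key d s ht ι
  · obtain ⟨d, rfl⟩ := Nat.exists_eq_add_of_le hst
    rw [Equiv.swap_comm]
    exact key d t hs ι

end Casimir

/-! ### First fundamental theorem for algebras generated by doublets and a triplet -/

/-- Generators: an invariant, a symmetric matrix, and doublets `vec c k` where `c` tells the sign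
of the charge and `k` tells whether they are odd. -/
inductive Gen
  | cen
  | mat (i j : Fin 2)
  | vec (c k : Bool) (i : Fin 2)

/-- The values of the generators in an algebra. -/
structure Letters (M : Type*) where
  a : M
  X : Fin 2 → Fin 2 → M
  d : Bool → Bool → Fin 2 → M

/-- The standard alternating form. -/
def eps : Fin 2 → Fin 2 → ℂ := ![![0, 1], ![-1, 0]]

/-- Even letters have degree 3 and odd ones 1, so that an even letter outweighs two odd ones. The
error terms in `Rels.pair_mem_of_anticommutator`, where an even letter is lost and two odd ones
appear, are then of lower degree. -/
def vdeg (k : Bool) : ℕ := if k then 1 else 3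
def vcharge (c : Bool) : ℤ := if c then 1 else -1
def vparity (k : Bool) : ZMod 2 := if k then 1 else 0

lemma vcharge_add_of_ne {c c' : Bool} (h : c ≠ c') : vcharge c + vcharge c' = 0 := by
  cases c <;> cases c' <;> simp [vcharge] at *

lemma vdeg_pos (k : Bool) : 0 < vdeg k := by cases k <;> simp [vdeg]

/-- The type of a doublet: sign of the charge, parity, and whether it is multiplied by the
matrix. -/
structure Dbl where
  c : Bool
  k : Bool
  comp : Bool

def Dbl.deg (x : Dbl) : ℕ := vdeg x.k + if x.comp then 3 else 0

lemma Dbl.deg_pos (x : Dbl) : 0 < x.deg := by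
  have := vdeg_pos x.k
  rw [Dbl.deg]; omega

section Pair

variable {M : Type*} [Ring M] [Algebra ℂ M]

/-- The alternating pairing of two doublets. -/
def pair (x y : Fin 2 → M) : M := x 0 * y 1 - x 1 * y 0

lemma mul_sub_mul_eq_pair (x y : Fin 2 → M) (i j : Fin 2) :
    x i * y j - x j * y i = eps i j • pair x y := by
  fin_cases i <;> fin_cases j <;> simp [eps, pair]

end Pair

/-! ### Contractions of doublets and Cayley–Hamilton -/

namespace Letters

variable {M : Type*} [Ring M] [Algebra ℂ M] (L : Letters M)

def gens : GradedGens Gen M where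
  val
    | .cen => L.a
    | .mat i j => L.X i j
    | .vec c k i => L.d c k i
  deg
    | .cen => 3
    | .mat _ _ => 3
    | .vec _ k _ => vdeg k
  charge
    | .cen => 0
    | .mat _ _ => 0
    | .vec c _ _ => vcharge c
  parity
    | .cen => 0
    | .mat _ _ => 0
    | .vec _ k _ => vparity k

/-- A doublet multiplied by the matrix. -/
def matVec (y : Fin 2 → M) (i : Fin 2) : M := L.X i 0 * y 1 - L.X i 1 * y 0

def vec (x : Dbl) : Fin 2 → M := if x.comp then L.matVec (L.d x.c x.k) else L.d x.c x.k

/-- The properties of the letters that the generation theorem uses. -/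
structure Good (L : Letters M) (S : Subalgebra ℂ M) (e f h ζ : M) : Prop where
  superComm : L.gens.SuperComm
  centralizes : Centralizes S e f h
  symm : ∀ i j, L.X i j = L.X j i
  e_X : ∀ i j, ad e (L.X i j) = (if i = 1 then L.X 0 j else 0) + if j = 1 then L.X i 0 else 0
  f_X : ∀ i j, ad f (L.X i j) = (if i = 0 then L.X 1 j else 0) + if j = 0 then L.X i 1 else 0
  h_X : ∀ i j, ad h (L.X i j) =
    ((if i = 0 then (1 : ℂ) else -1) + if j = 0 then (1 : ℂ) else -1) • L.X i j
  e_d : ∀ c k i, ad e (L.d c k i) = if i = 1 then L.d c k 0 else 0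
  f_d : ∀ c k i, ad f (L.d c k i) = if i = 0 then L.d c k 1 else 0
  h_d : ∀ c k i, ad h (L.d c k i) = (if i = 0 then (1 : ℂ) else -1) • L.d c k i
  X_mul : ∀ i j, L.X i 0 * L.X 1 j - L.X i 1 * L.X 0 j = eps i j • ζ + L.X i j
  a_mem : L.a ∈ S
  ζ_mem : ζ ∈ S
  pair_mem : ∀ k k', pair (L.d true k) (L.d false k') ∈ S.toSubmodule ⊔
    L.gens.filt (vdeg k + vdeg k') 0 (vparity k + vparity k')
  pair_matVec_mem : ∀ k k', pair (L.d true k) (L.matVec (L.d false k')) ∈ S.toSubmodule ⊔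
    L.gens.filt (vdeg k + vdeg k' + 3) 0 (vparity k + vparity k')

variable {L} {S : Subalgebra ℂ M} {e f h ζ : M}

lemma X_mem (i j : Fin 2) : L.X i j ∈ L.gens.filt 4 0 0 :=
  GradedGens.val_mem (g := L.gens) (.mat i j)

lemma d_mem (c k : Bool) (i : Fin 2) :
    L.d c k i ∈ L.gens.filt (vdeg k + 1) (vcharge c) (vparity k) :=
  GradedGens.val_mem (g := L.gens) (.vec c k i)

lemma matVec_mem {n : ℕ} {c : ℤ} {p : ZMod 2} {y : Fin 2 → M}
    (hy : ∀ i, y i ∈ L.gens.filt (n + 1) c p) (i : Fin 2) :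
    L.matVec y i ∈ L.gens.filt (n + 3 + 1) c p := by
  have h1 : ∀ i j k, L.X i j * y k ∈ L.gens.filt (n + 3 + 1) c p := fun i j k => by
    have := GradedGens.mul_mem_filt (m := 3) (X_mem (L := L) i j) (hy k)
    rwa [zero_add, zero_add, add_comm 3 n] at this
  exact sub_mem (h1 _ _ _) (h1 _ _ _)

lemma vec_mem (x : Dbl) (i : Fin 2) :
    L.vec x i ∈ L.gens.filt (x.deg + 1) (vcharge x.c) (vparity x.k) := by
  rcases x with ⟨c, k, _ | _⟩
  · exact d_mem c k i
  · exact matVec_mem (d_mem c k) i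

lemma pair_mem_filt {m n : ℕ} {c c' : ℤ} {p p' : ZMod 2} {x y : Fin 2 → M}
    (hx : ∀ i, x i ∈ L.gens.filt (m + 1) c p) (hy : ∀ i, y i ∈ L.gens.filt (n + 1) c' p')
    (hc : c + c' = 0) : pair x y ∈ L.gens.filt (m + n + 1) 0 (p + p') := by
  rw [← hc]
  exact sub_mem (GradedGens.mul_mem_filt (hx _) (hy _)) (GradedGens.mul_mem_filt (hx _) (hy _))

lemma pair_swap (hs : L.gens.SuperComm) {m n : ℕ} {c c' : ℤ} {p p' : ZMod 2} {x y : Fin 2 → M}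
    (hx : ∀ i, x i ∈ L.gens.filt (m + 1) c p) (hy : ∀ i, y i ∈ L.gens.filt (n + 1) c' p')
    (hc : c + c' = 0) : pair x y + sgn p p' • pair y x ∈ L.gens.filt (m + n) 0 (p + p') := by
  have := sub_mem (hs.mem (hx 0) (hy 1)) (hs.mem (hx 1) (hy 0))
  rw [hc] at this
  convert this using 1
  simp only [pair, smul_sub]
  abel

namespace Good

lemma ζ_mem_filt (hL : L.Good S e f h ζ) : ζ ∈ L.gens.filt 7 0 0 := by
  have h1 := hL.X_mul 0 1
  have h2 : ζ = L.X 0 0 * L.X 1 1 - L.X 0 1 * L.X 0 1 - L.X 0 1 := by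
    rw [h1]; simp [eps]
  rw [h2]
  have h3 : ∀ i j k l, L.X i j * L.X k l ∈ L.gens.filt 7 0 0 := fun i j k l => by
    have := GradedGens.mul_mem_filt (m := 3) (n := 3) (X_mem (L := L) i j) (X_mem k l)
    rwa [add_zero, add_zero] at this
  exact sub_mem (sub_mem (h3 _ _ _ _) (h3 _ _ _ _))
    (GradedGens.filt_mono (by norm_num) _ _ (X_mem _ _))

/-- Cayley–Hamilton for the matrix of letters, with `ζ` as determinant. A commuting matrix would
have trace zero; the linear term is the correction `L.X i j` in `X_mul`. Thanks to this no doublet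
ever needs more than one matrix factor. -/
lemma matVec_matVec (hL : L.Good S e f h ζ) (y : Fin 2 → M) (i : Fin 2) :
    L.matVec (L.matVec y) i = L.matVec y i - ζ * y i := by
  have h1 : L.matVec (L.matVec y) i = (L.X i 0 * L.X 1 0 - L.X i 1 * L.X 0 0) * y 1 -
      (L.X i 0 * L.X 1 1 - L.X i 1 * L.X 0 1) * y 0 := by
    simp only [matVec]; noncomm_ring
  rw [h1, hL.X_mul, hL.X_mul]
  fin_cases i <;> simp [eps, matVec, add_mul] <;> abel

/-- The matrix may be moved from one argument of a pairing to the other. -/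
lemma pair_matVec_left (hL : L.Good S e f h ζ) {m n : ℕ} {c c' : ℤ} {p p' : ZMod 2}
    {x y : Fin 2 → M} (hx : ∀ i, x i ∈ L.gens.filt (m + 1) c p)
    (hy : ∀ i, y i ∈ L.gens.filt (n + 1) c' p') (hc : c + c' = 0) :
    pair (L.matVec x) y + pair x (L.matVec y) ∈ L.gens.filt (m + n + 3) 0 (p + p') := by
  have h1 : ∀ i j k l, (L.X i j * x k - x k * L.X i j) * y l ∈
      L.gens.filt (m + n + 3) 0 (p + p') := fun i j k l => by
    have h2 := hL.superComm.mem (m := 3) (X_mem (L := L) i j) (hx k)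
    rw [sgn_zero_left, one_smul] at h2
    have h3 := GradedGens.mul_mem_left h2 (hy l)
    rwa [zero_add, zero_add, hc, show 3 + m + n = m + n + 3 by ring] at h3
  -- A symmetric matrix is skew for the alternating pairing; only commutators of matrix entries with
  -- `x` survive.
  have h4 : pair (L.matVec x) y + pair x (L.matVec y) =
      (L.X 0 0 * x 1 - x 1 * L.X 0 0) * y 1 - (L.X 0 1 * x 0 - x 0 * L.X 0 1) * y 1 -
      (L.X 0 1 * x 1 - x 1 * L.X 0 1) * y 0 + (L.X 1 1 * x 0 - x 0 * L.X 1 1) * y 0 := by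
    simp only [pair, matVec, hL.symm 1 0]; noncomm_ring
  rw [h4]
  exact add_mem (sub_mem (sub_mem (h1 _ _ _ _) (h1 _ _ _ _)) (h1 _ _ _ _)) (h1 _ _ _ _)

/-- A matrix on the left argument moves to the right one at the cost of lower degree. If a matrix is
already there, Cayley–Hamilton reduces the two to at most one, and `ζ` is in `S`. -/
lemma pair_vec_mem_aux (hL : L.Good S e f h ζ) (k k' m m' : Bool) :
    pair (L.vec ⟨true, k, m⟩) (L.vec ⟨false, k', m'⟩) ∈ S.toSubmodule ⊔
      L.gens.filt (Dbl.deg ⟨true, k, m⟩ + Dbl.deg ⟨false, k', m'⟩) 0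
        (vparity k + vparity k') := by
  have hc : vcharge true + vcharge false = 0 := by simp [vcharge]
  have hx := d_mem (L := L) true k
  have hy := d_mem (L := L) false k'
  have h1 := hL.pair_mem k k'
  have h2 := hL.pair_matVec_mem k k'
  rcases m with _ | _ <;> rcases m' with _ | _
  · exact h1
  · exact h2
  · have h3 := hL.pair_matVec_left hx hy hc
    have h4 := sub_mem (Submodule.mem_sup_right h3) h2
    rw [add_sub_cancel_right] at h4
    have hdeg : Dbl.deg ⟨true, k, true⟩ + Dbl.deg ⟨false, k', false⟩ =
        vdeg k + vdeg k' + 3 := add_right_comm _ _ _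
    rw [hdeg]
    exact h4
  · have h3 := hL.pair_matVec_left hx (matVec_mem hy) hc
    have hdeg : Dbl.deg ⟨true, k, true⟩ + Dbl.deg ⟨false, k', true⟩ =
        vdeg k + (vdeg k' + 3) + 3 := by simp only [Dbl.deg, if_true]; ring
    rw [hdeg]
    set n := vdeg k + (vdeg k' + 3) + 3 with hn
    set p := vparity k + vparity k'
    -- Cayley–Hamilton rewrites the double matrix factor, and `ζ` is brought to the front; the final
    -- bracket collects its commutators with the left doublet.
    have e1 : pair (L.vec ⟨true, k, true⟩) (L.vec ⟨false, k', true⟩) =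
        (pair (L.matVec (L.d true k)) (L.matVec (L.d false k')) +
          pair (L.d true k) (L.matVec (L.matVec (L.d false k')))) -
        pair (L.d true k) (L.matVec (L.d false k')) +
        ζ * pair (L.d true k) (L.d false k') -
        ((ζ * L.d true k 0 - L.d true k 0 * ζ) * L.d false k' 1 -
          (ζ * L.d true k 1 - L.d true k 1 * ζ) * L.d false k' 0) := by
      have : pair (L.d true k) (L.matVec (L.matVec (L.d false k'))) =
          pair (L.d true k) (L.matVec (L.d false k')) - (L.d true k 0 * ζ * L.d false k' 1 -
            L.d true k 1 * ζ * L.d false k' 0) := by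
        simp only [pair, hL.matVec_matVec]; noncomm_ring
      rw [this]
      simp only [pair, vec, if_true]
      noncomm_ring
    have h5 : ∀ i j, (ζ * L.d true k i - L.d true k i * ζ) * L.d false k' j ∈
        L.gens.filt n 0 p := fun i j => by
      have h6 := hL.superComm.mem (m := 6) hL.ζ_mem_filt (hx i)
      rw [sgn_zero_left, one_smul] at h6
      have h7 := GradedGens.mul_mem_left h6 (hy j)
      rwa [zero_add, zero_add, hc, show 6 + vdeg k + vdeg k' = n by rw [hn]; ring] at h7
    have h8 : ζ * pair (L.d true k) (L.d false k') ∈ S.toSubmodule ⊔ L.gens.filt n 0 p := by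
      obtain ⟨s, hs, r, hr, hsr⟩ := Submodule.mem_sup.1 h1
      rw [← hsr, mul_add]
      refine add_mem (Submodule.mem_sup_left (S.mul_mem hL.ζ_mem hs)) (Submodule.mem_sup_right ?_)
      have := GradedGens.mul_mem_right (m := 6) hL.ζ_mem_filt hr
      rwa [zero_add, zero_add, show 6 + (vdeg k + vdeg k') = n by rw [hn]; ring] at this
    rw [e1]
    refine sub_mem (add_mem (sub_mem (Submodule.mem_sup_right h3) ?_) h8)
      (Submodule.mem_sup_right (sub_mem (h5 _ _) (h5 _ _)))
    exact sup_le_sup_left (GradedGens.filt_mono (by omega) _ _) _ h2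

lemma pair_vec_mem (hL : L.Good S e f h ζ) (x y : Dbl) (hxy : x.c ≠ y.c) :
    pair (L.vec x) (L.vec y) ∈ S.toSubmodule ⊔
      L.gens.filt (x.deg + y.deg) 0 (vparity x.k + vparity y.k) := by
  rcases x with ⟨_ | _, k, m⟩ <;> rcases y with ⟨_ | _, k', m'⟩
  · exact absurd rfl hxy
  · have h1 := hL.pair_vec_mem_aux k' k m' m
    have h2 := pair_swap hL.superComm (vec_mem (L := L) ⟨false, k, m⟩)
      (vec_mem (L := L) ⟨true, k', m'⟩) (vcharge_add_of_ne hxy)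
    rw [add_comm (Dbl.deg _), add_comm (vparity _)] at h1
    have h3 := sub_mem (Submodule.mem_sup_right h2)
      (Submodule.smul_mem _ (sgn (vparity k) (vparity k')) h1)
    rwa [add_sub_cancel_right] at h3
  · exact hL.pair_vec_mem_aux k k' m m'
  · exact absurd rfl hxy

/-- A scalar inside a word may be moved to the front. -/
lemma contract_mem (hL : L.Good S e f h ζ) {n : ℕ}
    (ih : ∀ p, L.gens.filt n 0 p ≤ reach hL.centralizes) {k m j : ℕ} {c c' : ℤ}
    {p p' p'' : ZMod 2} {A s B : M} (hA : A ∈ L.gens.filt (k + 1) c p)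
    (hB : B ∈ L.gens.filt (j + 1) c' p'') (hs : s ∈ L.gens.filt (m + 1) 0 p')
    (hs' : s ∈ S.toSubmodule ⊔ L.gens.filt m 0 p') (hc : c + c' = 0) (hm : 0 < m)
    (hn : k + m + j ≤ n) : A * (s * B) ∈ reach hL.centralizes := by
  obtain ⟨t, ht, r, hr, hsr⟩ := Submodule.mem_sup.1 hs'
  have hAB := GradedGens.mul_mem_filt hA hB
  rw [hc] at hAB
  have h1 := GradedGens.mul_mem_left (hL.superComm.mem hA hs) hB
  rw [add_zero, hc] at h1
  have h2 := GradedGens.mul_mem_left hr hAB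
  rw [add_zero] at h2
  -- After `s` is supercommuted to the front, its part `t` in `S` multiplies `A * B`, whose degree
  -- is smaller because `0 < m`; both the supercommutator and the part `r` give terms of lower
  -- degree.
  have e1 : A * (s * B) = (A * s - sgn p p' • (s * A)) * B +
      sgn p p' • (t * (A * B) + r * (A * B)) := by
    rw [← add_mul, hsr, sub_mul, smul_mul_assoc]
    simp only [mul_assoc]
    abel
  rw [e1]
  exact add_mem (ih _ (GradedGens.filt_mono hn _ _ h1)) (Submodule.smul_mem _ _ (add_mem
    (mul_mem_reach _ ht (ih _ (GradedGens.filt_mono (by omega) _ _ hAB)))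
    (ih _ (GradedGens.filt_mono (by omega) _ _ h2))))

end Good

end Letters

/-! ### Words as tensors in binary indices -/

namespace Letters

variable {M : Type*} [Ring M] [Algebra ℂ M] (L : Letters M)

/-- A product of doublets, whose indices are `ι lo, ι (lo + 1), …`. -/
def dval : ℕ → List Dbl → (ℕ → Fin 2) → M
  | _, [], _ => 1
  | lo, x :: l, ι => L.vec x (ι lo) * dval (lo + 1) l ι

/-- A product of matrix entries with indices `ι 0, …, ι (2m - 1)`. -/
def xval : ℕ → (ℕ → Fin 2) → M
  | 0, _ => 1
  | m + 1, ι => xval m ι * L.X (ι (2 * m)) (ι (2 * m + 1))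

def ddeg (l : List Dbl) : ℕ := (l.map Dbl.deg).sum
def dcharge (l : List Dbl) : ℤ := (l.map fun x => vcharge x.c).sum
def dparity (l : List Dbl) : ZMod 2 := (l.map fun x => vparity x.k).sum

variable {L} {S : Subalgebra ℂ M} {e f h ζ : M}

lemma dval_congr {lo lo' : ℕ} {l : List Dbl} {ι κ : ℕ → Fin 2}
    (hικ : ∀ s < l.length, ι (lo + s) = κ (lo' + s)) : L.dval lo l ι = L.dval lo' l κ := by
  induction l generalizing lo lo' with
  | nil => rfl
  | cons x l ih =>
    rw [dval, dval, ih (lo := lo + 1) (lo' := lo' + 1)]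
    · have := hικ 0 (by simp)
      rw [add_zero, add_zero] at this
      rw [this]
    · intro s hs
      have := hικ (s + 1) (by simpa using hs)
      rwa [← add_assoc, ← add_assoc, add_right_comm, add_right_comm lo'] at this

lemma xval_congr {m : ℕ} {ι κ : ℕ → Fin 2} (hικ : ∀ s < 2 * m, ι s = κ s) :
    L.xval m ι = L.xval m κ := by
  induction m with
  | zero => rfl
  | succ m ih =>
    rw [xval, xval, ih fun s hs => hικ s (by omega), hικ _ (by omega), hικ _ (by omega)]

lemma dval_mem (lo : ℕ) (l : List Dbl) (ι : ℕ → Fin 2) :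
    L.dval lo l ι ∈ L.gens.filt (ddeg l + 1) (dcharge l) (dparity l) := by
  induction l generalizing lo with
  | nil => exact GradedGens.one_mem_filt
  | cons x l ih => exact GradedGens.mul_mem_filt (vec_mem x _) (ih _)

lemma xval_mem (m : ℕ) (ι : ℕ → Fin 2) : L.xval m ι ∈ L.gens.filt (3 * m + 1) 0 0 := by
  induction m with
  | zero => exact GradedGens.one_mem_filt
  | succ m ih =>
    have := GradedGens.mul_mem_filt (n := 3) ih (X_mem (ι (2 * m)) (ι (2 * m + 1)))
    rwa [add_zero, add_zero] at this

namespace Good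

lemma isForm_vec (hL : L.Good S e f h ζ) (x : Dbl) (lo : ℕ) :
    IsForm e f h (fun ι => L.vec x (ι lo)) lo (lo + 1) := by
  have key : (∀ i, ad e (L.vec x i) = if i = 1 then L.vec x 0 else 0) ∧
      (∀ i, ad f (L.vec x i) = if i = 0 then L.vec x 1 else 0) ∧
      ∀ i, ad h (L.vec x i) = (if i = 0 then (1 : ℂ) else -1) • L.vec x i := by
    rcases x with ⟨c, k, _ | _⟩
    · exact ⟨hL.e_d c k, hL.f_d c k, hL.h_d c k⟩
    · refine ⟨fun i => ?_, fun i => ?_, fun i => ?_⟩ <;>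
        simp only [vec, if_true, matVec, map_sub, ad_mul, hL.e_X, hL.f_X, hL.h_X, hL.e_d,
          hL.f_d, hL.h_d] <;> fin_cases i <;> simp [smul_sub, add_mul] <;> module
  refine ⟨by omega, fun ι κ hικ => ?_, fun ι => ?_, fun ι => ?_, fun ι => ?_⟩
  · simp only [hικ lo le_rfl (by omega)]
  · simp [key.1]
  · simp [key.2.1]
  · simp [key.2.2]

lemma isForm_X (hL : L.Good S e f h ζ) (lo : ℕ) :
    IsForm e f h (fun ι => L.X (ι lo) (ι (lo + 1))) lo (lo + 2) := by
  refine ⟨by omega, fun ι κ hικ => ?_, fun ι => ?_, fun ι => ?_, fun ι => ?_⟩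
  · simp only [hικ lo le_rfl (by omega), hικ (lo + 1) (by omega) (by omega)]
  · rw [hL.e_X, Finset.sum_Ico_succ_top (by omega), Finset.sum_Ico_succ_top (by omega)]
    simp
  · rw [hL.f_X, Finset.sum_Ico_succ_top (by omega), Finset.sum_Ico_succ_top (by omega)]
    simp
  · rw [hL.h_X, Finset.sum_Ico_succ_top (by omega), Finset.sum_Ico_succ_top (by omega)]
    simp

lemma isForm_dval (hL : L.Good S e f h ζ) (lo : ℕ) (l : List Dbl) :
    IsForm e f h (L.dval lo l) lo (lo + l.length) := by
  induction l generalizing lo with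
  | nil => exact IsForm.one lo
  | cons x l ih =>
    have := (hL.isForm_vec x lo).mul (ih (lo + 1))
    rwa [show lo + 1 + l.length = lo + (x :: l).length by simp; omega] at this

lemma isForm_xval (hL : L.Good S e f h ζ) (m : ℕ) : IsForm e f h (L.xval m) 0 (2 * m) := by
  induction m with
  | zero => exact IsForm.one 0
  | succ m ih => exact ih.mul (hL.isForm_X (2 * m))

/-- Adjacent doublets in a word may be transposed. -/
lemma swap_dval (hL : L.Good S e f h ζ) {n : ℕ}
    (ih : ∀ p, L.gens.filt n 0 p ≤ reach hL.centralizes) (ι : ℕ → Fin 2) (s : ℕ)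
    (l : List Dbl) (hl : l.IsChain fun x y => x.c ≠ y.c) (lo : ℕ) (hlo : lo ≤ s)
    (hs : s + 1 < lo + l.length) {A : M} {k : ℕ} {c : ℤ} {p : ZMod 2}
    (hA : A ∈ L.gens.filt (k + 1) c p) (hc : c + dcharge l = 0) (hn : k + ddeg l ≤ n) :
    A * L.dval lo l ι - A * L.dval lo l (ι ∘ Equiv.swap s (s + 1)) ∈ reach hL.centralizes := by
  induction l generalizing lo A k c p with
  | nil => simp at hs; omega
  | cons x l ihl =>
    rcases l with _ | ⟨y, l⟩
    · simp at hs; omega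
    rw [List.isChain_cons_cons] at hl
    rcases eq_or_lt_of_le hlo with rfl | hlt
    · have e1 : L.dval (lo + 1 + 1) l (ι ∘ Equiv.swap lo (lo + 1)) = L.dval (lo + 1 + 1) l ι :=
        dval_congr fun t _ => congrArg ι (Equiv.swap_apply_of_ne_of_ne (by omega) (by omega))
      simp only [dval, e1, Function.comp_apply, Equiv.swap_apply_left, Equiv.swap_apply_right]
      -- Exchanging the two indices changes the word by the contraction of the two doublets; the
      -- alternation of charges makes this contraction one of charge zero.
      have e2 : A * (L.vec x (ι lo) * (L.vec y (ι (lo + 1)) * L.dval (lo + 1 + 1) l ι)) -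
          A * (L.vec x (ι (lo + 1)) * (L.vec y (ι lo) * L.dval (lo + 1 + 1) l ι)) =
          eps (ι lo) (ι (lo + 1)) • (A * (pair (L.vec x) (L.vec y) *
            L.dval (lo + 1 + 1) l ι)) := by
        rw [← mul_smul_comm, ← smul_mul_assoc, ← mul_sub_mul_eq_pair]
        simp only [mul_sub, sub_mul, mul_assoc]
      rw [e2]
      refine Submodule.smul_mem _ _ (hL.contract_mem ih hA (dval_mem _ _ _)
        (pair_mem_filt (vec_mem x) (vec_mem y) (vcharge_add_of_ne hl.1))
        (hL.pair_vec_mem x y hl.1) ?_ (by have := x.deg_pos; omega) ?_)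
      · have := vcharge_add_of_ne hl.1
        simp only [dcharge, List.map_cons, List.sum_cons] at hc ⊢
        linarith
      · simp only [ddeg, List.map_cons, List.sum_cons] at hn ⊢
        omega
    · have h1 := ihl hl.2 (lo + 1) hlt (by simp at hs ⊢; omega)
        (GradedGens.mul_mem_filt hA (vec_mem x (ι lo)))
        (by simp only [dcharge, List.map_cons, List.sum_cons] at hc ⊢; linarith)
        (by simp only [ddeg, List.map_cons, List.sum_cons] at hn ⊢; omega)
      have e1 : (ι ∘ Equiv.swap s (s + 1)) lo = ι lo :=
        congrArg ι (Equiv.swap_apply_of_ne_of_ne (by omega) (by omega))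
      have e2 : ∀ κ, L.dval lo (x :: y :: l) κ = L.vec x (κ lo) * L.dval (lo + 1) (y :: l) κ :=
        fun _ => rfl
      rw [e2, e2, e1, ← mul_assoc, ← mul_assoc]
      exact h1

/-- Both sides are antisymmetric in the middle indices, so the case of `X_mul` suffices. -/
lemma X_mul_X_sub (hL : L.Good S e f h ζ) (i j k l : Fin 2) :
    L.X i j * L.X k l - L.X i k * L.X j l = eps j k • (eps i l • ζ + L.X i l) := by
  rw [← hL.X_mul]
  fin_cases j <;> fin_cases k <;> simp [eps]

/-- Adjacent indices of matrix entries in a word may be transposed. -/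
lemma swap_xval (hL : L.Good S e f h ζ) {n : ℕ}
    (ih : ∀ p, L.gens.filt n 0 p ≤ reach hL.centralizes) (ι : ℕ → Fin 2) (s : ℕ)
    (m : ℕ) (hs : s + 1 < 2 * m) {B : M} {j : ℕ} {p : ZMod 2}
    (hB : B ∈ L.gens.filt (j + 1) 0 p) (hn : 3 * m + j ≤ n) :
    L.xval m ι * B - L.xval m (ι ∘ Equiv.swap s (s + 1)) * B ∈ reach hL.centralizes := by
  induction m generalizing B j p with
  | zero => omega
  | succ m ihm =>
    -- The positions lie before the last matrix entry, straddle the last two entries, or are the two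
    -- indices of the last one. In the third case the symmetry of `X` gives equality.
    rcases lt_trichotomy (s + 1) (2 * m) with hlt | heq | hgt
    · have e1 : ∀ t, 2 * m ≤ t → (ι ∘ Equiv.swap s (s + 1)) t = ι t := fun t ht =>
        congrArg ι (Equiv.swap_apply_of_ne_of_ne (by omega) (by omega))
      rw [xval, xval, e1 _ le_rfl, e1 _ (by omega), mul_assoc, mul_assoc]
      have h1 := GradedGens.mul_mem_filt (m := 3)
        (X_mem (L := L) (ι (2 * m)) (ι (2 * m + 1))) hB
      rw [add_zero] at h1
      exact ihm hlt h1 (by omega)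
    · obtain ⟨m, rfl⟩ : ∃ m', m = m' + 1 := ⟨m - 1, by omega⟩
      obtain rfl : s = 2 * m + 1 := by omega
      have e0 : L.xval m (ι ∘ Equiv.swap (2 * m + 1) (2 * m + 1 + 1)) = L.xval m ι :=
        xval_congr fun t ht =>
          congrArg ι (Equiv.swap_apply_of_ne_of_ne (by omega) (by omega))
      have e1 : (ι ∘ Equiv.swap (2 * m + 1) (2 * m + 1 + 1)) (2 * m) = ι (2 * m) :=
        congrArg ι (Equiv.swap_apply_of_ne_of_ne (by omega) (by omega))
      have e2 : (ι ∘ Equiv.swap (2 * m + 1) (2 * m + 1 + 1)) (2 * m + 1) = ι (2 * (m + 1)) :=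
        congrArg ι (Equiv.swap_apply_left _ _)
      have e3 : (ι ∘ Equiv.swap (2 * m + 1) (2 * m + 1 + 1)) (2 * (m + 1)) = ι (2 * m + 1) :=
        congrArg ι (Equiv.swap_apply_right _ _)
      have e4 : (ι ∘ Equiv.swap (2 * m + 1) (2 * m + 1 + 1)) (2 * (m + 1) + 1) =
          ι (2 * (m + 1) + 1) :=
        congrArg ι (Equiv.swap_apply_of_ne_of_ne (by omega) (by omega))
      simp only [xval, e0, e1, e2, e3, e4]
      generalize ι (2 * m) = i₁
      generalize ι (2 * m + 1) = i₂
      generalize ι (2 * (m + 1)) = i₃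
      generalize ι (2 * (m + 1) + 1) = i₄
      have e5 : L.xval m ι * L.X i₁ i₂ * L.X i₃ i₄ * B - L.xval m ι * L.X i₁ i₃ * L.X i₂ i₄ * B =
          eps i₂ i₃ • (eps i₁ i₄ • (L.xval m ι * (ζ * B)) + L.xval m ι * (L.X i₁ i₄ * B)) := by
        rw [← mul_smul_comm, ← mul_add, ← mul_smul_comm, ← smul_mul_assoc, ← add_mul,
          ← smul_mul_assoc, ← hL.X_mul_X_sub]
        simp only [mul_sub, sub_mul, mul_assoc]
      rw [e5]
      refine Submodule.smul_mem _ _ (add_mem (Submodule.smul_mem _ _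
        (hL.contract_mem ih (m := 6) (xval_mem m ι) hB hL.ζ_mem_filt
          (Submodule.mem_sup_left hL.ζ_mem) (by simp) (by simp) (by omega))) ?_)
      have h1 := GradedGens.mul_mem_filt (xval_mem (L := L) m ι)
        (GradedGens.mul_mem_filt (m := 3) (X_mem (L := L) i₁ i₄) hB)
      simp only [add_zero] at h1
      exact ih _ (GradedGens.filt_mono (by omega) _ _ h1)
    · obtain rfl : s = 2 * m := by omega
      have e0 : L.xval m (ι ∘ Equiv.swap (2 * m) (2 * m + 1)) = L.xval m ι :=
        xval_congr fun t ht =>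
          congrArg ι (Equiv.swap_apply_of_ne_of_ne (by omega) (by omega))
      simp only [xval, e0, Function.comp_apply, Equiv.swap_apply_left, Equiv.swap_apply_right]
      rw [hL.symm (ι (2 * m + 1)), sub_self]
      exact zero_mem _

/-- Words in matrix entries and doublets of alternating charge. -/
lemma xval_mul_dval_mem (hL : L.Good S e f h ζ) {n : ℕ}
    (ih : ∀ p, L.gens.filt n 0 p ≤ reach hL.centralizes) (m : ℕ) (l : List Dbl)
    (hl : l.IsChain fun x y => x.c ≠ y.c) (hc : dcharge l = 0) (hn : 3 * m + ddeg l ≤ n)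
    (ι : ℕ → Fin 2) : L.xval m ι * L.dval (2 * m) l ι ∈ reach hL.centralizes := by
  -- A second induction inside that on the degree: absorbing a matrix entry into a doublet preserves
  -- the degree but lowers `m`.
  induction m generalizing l ι with
  | zero =>
    rcases l with _ | ⟨x, l⟩
    -- Without indices the Casimir scalar vanishes; the empty word is 1, which lies in `S`.
    · simpa [xval, dval] using le_reach hL.centralizes S.one_mem
    · refine (((hL.isForm_xval 0).mul (hL.isForm_dval _ _)).mem_reach hL.centralizes (by simp)
        fun ι => symm_of_adjacent (φ := fun ι => L.xval 0 ι * L.dval (2 * 0) (x :: l) ι)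
          (fun s hs ι => ?_) ι) ι
      simp only [xval]
      exact hL.swap_dval ih ι s _ hl _ (by simp) hs (c := 0) (p := 0) (k := 0)
        GradedGens.one_mem_filt (by simpa using hc) (by omega)
  | succ m ihm =>
    refine (((hL.isForm_xval _).mul (hL.isForm_dval _ _)).mem_reach hL.centralizes (by omega)
        fun ι => symm_of_adjacent (φ := fun ι => L.xval (m + 1) ι * L.dval (2 * (m + 1)) l ι)
          (fun s hs ι => ?_) ι) ι
    rcases lt_trichotomy (s + 1) (2 * (m + 1)) with hlt | heq | hgt
    · have e1 : L.dval (2 * (m + 1)) l (ι ∘ Equiv.swap s (s + 1)) = L.dval (2 * (m + 1)) l ι :=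
        dval_congr fun t _ =>
          congrArg ι (Equiv.swap_apply_of_ne_of_ne (by omega) (by omega))
      rw [e1]
      have h1 := dval_mem (L := L) (2 * (m + 1)) l ι
      rw [hc] at h1
      exact hL.swap_xval ih ι s _ hlt h1 hn
    · obtain rfl : s = 2 * m + 1 := by omega
      rcases l with _ | ⟨x, l⟩
      · simp at hs; omega
      have e0 : L.xval m (ι ∘ Equiv.swap (2 * m + 1) (2 * m + 1 + 1)) = L.xval m ι :=
        xval_congr fun t ht =>
          congrArg ι (Equiv.swap_apply_of_ne_of_ne (by omega) (by omega))
      have e1 : (ι ∘ Equiv.swap (2 * m + 1) (2 * m + 1 + 1)) (2 * m) = ι (2 * m) :=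
        congrArg ι (Equiv.swap_apply_of_ne_of_ne (by omega) (by omega))
      have e2 : (ι ∘ Equiv.swap (2 * m + 1) (2 * m + 1 + 1)) (2 * m + 1) = ι (2 * (m + 1)) :=
        congrArg ι (Equiv.swap_apply_left _ _)
      have e3 : (ι ∘ Equiv.swap (2 * m + 1) (2 * m + 1 + 1)) (2 * (m + 1)) = ι (2 * m + 1) :=
        congrArg ι (Equiv.swap_apply_right _ _)
      have e4 : L.dval (2 * (m + 1) + 1) l (ι ∘ Equiv.swap (2 * m + 1) (2 * m + 1 + 1)) =
          L.dval (2 * (m + 1) + 1) l ι :=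
        dval_congr fun t _ =>
          congrArg ι (Equiv.swap_apply_of_ne_of_ne (by omega) (by omega))
      simp only [xval, dval, e0, e1, e2, e3, e4]
      -- Antisymmetrising the last index of the matrices with that of the first doublet multiplies
      -- this doublet by the matrix.
      have e5 : ∀ i j k : Fin 2, ∀ B : M, L.xval m ι * L.X i j * (L.vec x k * B) -
          L.xval m ι * L.X i k * (L.vec x j * B) =
          eps j k • (L.xval m ι * (L.matVec (L.vec x) i * B)) := by
        intro i j k B
        have : L.X i j * L.vec x k - L.X i k * L.vec x j = eps j k • L.matVec (L.vec x) i :=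
          mul_sub_mul_eq_pair (L.X i) (L.vec x) j k
        rw [← mul_smul_comm, ← smul_mul_assoc, ← this]
        simp only [mul_sub, sub_mul, mul_assoc]
      rw [e5]
      refine Submodule.smul_mem _ _ ?_
      generalize ι (2 * m) = i
      have hB := dval_mem (L := L) (2 * (m + 1) + 1) l ι
      have hc' : vcharge x.c + dcharge l = 0 := hc
      have hn' : 3 * (m + 1) + (x.deg + ddeg l) ≤ n := hn
      rcases x with ⟨c, k, _ | _⟩
      -- The bare doublet absorbs the matrix entry. `κ` gives index `i` to the new doublet and
      -- shifts the later indices by two, one of the three indices involved being left.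
      · set κ : ℕ → Fin 2 := fun t => if t < 2 * m then ι t else if t = 2 * m then i else ι (t + 2)
        have h1 := ihm (⟨c, k, true⟩ :: l) (by
          rcases l with _ | ⟨y, l⟩
          · exact List.isChain_singleton _
          · rw [List.isChain_cons_cons] at hl ⊢
            exact hl) hc (by
          have : Dbl.deg ⟨c, k, true⟩ = Dbl.deg ⟨c, k, false⟩ + 3 := rfl
          have : ddeg (⟨c, k, true⟩ :: l) = Dbl.deg ⟨c, k, true⟩ + ddeg l := rfl
          omega) κ
        have e6 : L.xval m κ = L.xval m ι := xval_congr fun t ht => if_pos ht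
        have e7 : L.dval (2 * m + 1) l κ = L.dval (2 * (m + 1) + 1) l ι :=
          dval_congr fun t _ => by
            simp only [κ]
            rw [if_neg (by omega), if_neg (by omega)]
            congr 1
            omega
        have e8 : κ (2 * m) = i := by simp [κ]
        rw [dval, e6, e7, e8] at h1
        exact h1
      -- The doublet already carries a matrix: by Cayley–Hamilton one term has lower degree and the
      -- other contains `ζ`.
      · have e6 : L.vec ⟨c, k, true⟩ = L.matVec (L.d c k) := rfl
        have e7 : Dbl.deg ⟨c, k, true⟩ = vdeg k + 3 := rfl
        have h2 := GradedGens.mul_mem_filt (xval_mem (L := L) m ι)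
          (GradedGens.mul_mem_filt (matVec_mem (d_mem (L := L) c k) i) hB)
        have h3 := GradedGens.mul_mem_filt (d_mem (L := L) c k i) hB
        have hc'' : vcharge c + dcharge l = 0 := hc'
        rw [hc'', add_zero] at h2
        rw [hc''] at h3
        rw [e6, hL.matVec_matVec, sub_mul, mul_sub, mul_assoc ζ]
        exact sub_mem (ih _ (GradedGens.filt_mono (by omega) _ _ h2))
          (hL.contract_mem ih (m := 6) (xval_mem m ι) h3 hL.ζ_mem_filt
            (Submodule.mem_sup_left hL.ζ_mem) (by simp) (by simp) (by omega))
    · have e1 : L.xval (m + 1) (ι ∘ Equiv.swap s (s + 1)) = L.xval (m + 1) ι :=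
        xval_congr fun t ht =>
          congrArg ι (Equiv.swap_apply_of_ne_of_ne (by omega) (by omega))
      rw [e1]
      exact hL.swap_dval ih ι s _ hl _ (by omega) hs (xval_mem _ _) (by simpa using hc) hn

end Good

end Letters

/-! ### Sorting words and the induction on the degree -/

namespace Letters

variable {M : Type*} [Ring M] [Algebra ℂ M] {L : Letters M} {S : Subalgebra ℂ M} {e f h ζ : M}

/-- The sorting of a word by the kind of its generators. -/
lemma exists_perm (l : List Gen) : ∃ (n : ℕ) (xs : List (Fin 2 × Fin 2))
    (ps ms : List (Bool × Fin 2)), l.Perm (List.replicate n Gen.cen ++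
      (xs.map (fun x => Gen.mat x.1 x.2) ++ (ps.map (fun x => Gen.vec true x.1 x.2) ++
        ms.map (fun x => Gen.vec false x.1 x.2)))) := by
  induction l with
  | nil => exact ⟨0, [], [], [], List.Perm.refl _⟩
  | cons x l ih =>
    obtain ⟨n, xs, ps, ms, ih⟩ := ih
    rcases x with _ | ⟨i, j⟩ | ⟨_ | _, k, i⟩
    · exact ⟨n + 1, xs, ps, ms, ih.cons _⟩
    · exact ⟨n, (i, j) :: xs, ps, ms, (ih.cons _).trans List.perm_middle.symm⟩
    · refine ⟨n, xs, ps, (k, i) :: ms, (ih.cons _).trans ?_⟩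
      have := (List.perm_middle (a := Gen.vec false k i)
        (l₁ := List.replicate n Gen.cen ++ (xs.map (fun x => Gen.mat x.1 x.2) ++
          ps.map (fun x => Gen.vec true x.1 x.2)))
        (l₂ := ms.map (fun x => Gen.vec false x.1 x.2))).symm
      simpa only [List.append_assoc, List.map_cons] using this
    · refine ⟨n, xs, (k, i) :: ps, ms, (ih.cons _).trans ?_⟩
      have := (List.perm_middle (a := Gen.vec true k i)
        (l₁ := List.replicate n Gen.cen ++ xs.map (fun x => Gen.mat x.1 x.2))
        (l₂ := ps.map (fun x => Gen.vec true x.1 x.2) ++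
          ms.map (fun x => Gen.vec false x.1 x.2))).symm
      simpa only [List.append_assoc, List.map_cons, List.cons_append] using this

/-- The list of doublets of alternating charge with given positive and negative members. -/
def interleave : List (Bool × Fin 2) → List (Bool × Fin 2) → List (Bool × Bool × Fin 2)
  | p :: ps, m :: ms => (true, p) :: (false, m) :: interleave ps ms
  | _, _ => []

lemma interleave_perm : ∀ ps ms : List (Bool × Fin 2), ps.length = ms.length →
    ((interleave ps ms).map fun x => Gen.vec x.1 x.2.1 x.2.2).Perm
      (ps.map (fun x => Gen.vec true x.1 x.2) ++ ms.map fun x => Gen.vec false x.1 x.2)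
  | [], [], _ => List.Perm.refl _
  | p :: ps, m :: ms, h => by
    have ih := interleave_perm ps ms (by simpa using h)
    exact ((ih.cons _).trans List.perm_middle.symm).cons _

/-- The doublet without matrix factor to which a generator belongs. -/
def toDbl (x : Bool × Bool × Fin 2) : Dbl := ⟨x.1, x.2.1, false⟩

/-- The leading negative doublet is there for the induction, which must know the charge that
precedes the remaining list; it is dropped afterwards. -/
lemma isChain_interleave : ∀ (m : Bool × Fin 2) (ps ms : List (Bool × Fin 2)),
    (toDbl (false, m) :: (interleave ps ms).map toDbl).IsChain fun x y => x.c ≠ y.c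
  | _, [], _ => by simp [interleave]
  | _, _ :: _, [] => by simp [interleave]
  | _, p :: ps, m' :: ms => by
    have ih := isChain_interleave m' ps ms
    simp only [interleave, List.map_cons, List.isChain_cons_cons]
    exact ⟨by simp [toDbl], by simp [toDbl], ih⟩

/-- Prescribing the indices below `lo` lets matrix entries and doublets be read off from one common
`ι`. -/
lemma exists_dval (ds : List (Bool × Bool × Fin 2)) (lo : ℕ) (κ : ℕ → Fin 2) :
    ∃ ι : ℕ → Fin 2, (∀ s < lo, ι s = κ s) ∧
      L.gens.word (ds.map fun x => Gen.vec x.1 x.2.1 x.2.2) = L.dval lo (ds.map toDbl) ι := by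
  induction ds generalizing lo κ with
  | nil => exact ⟨κ, fun _ _ => rfl, rfl⟩
  | cons x ds ih =>
    obtain ⟨ι, h1, h2⟩ := ih (lo + 1) (Function.update κ lo x.2.2)
    refine ⟨ι, fun s hs => ?_, ?_⟩
    · rw [h1 s (by omega), Function.update_of_ne (by omega)]
    · rw [List.map_cons, GradedGens.word_cons, h2, List.map_cons, dval, h1 lo (by omega),
        Function.update_self]
      rfl

lemma exists_xval (xs : List (Fin 2 × Fin 2)) : ∃ ι : ℕ → Fin 2,
    L.gens.word (xs.map fun x => Gen.mat x.1 x.2) = L.xval xs.length ι := by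
  induction xs using List.reverseRecOn with
  | nil => exact ⟨0, rfl⟩
  | append_singleton xs x ih =>
    obtain ⟨ι, hι⟩ := ih
    refine ⟨Function.update (Function.update ι (2 * xs.length) x.1) (2 * xs.length + 1) x.2, ?_⟩
    rw [List.map_append, GradedGens.word_append, hι, List.length_append, List.length_singleton,
      xval, Function.update_self, Function.update_of_ne (by omega), Function.update_self]
    congr 1
    · refine xval_congr fun s hs => ?_
      rw [Function.update_of_ne (by omega), Function.update_of_ne (by omega)]
    · simp [gens]

lemma wcharge_map_vec (c : Bool) (ps : List (Bool × Fin 2)) :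
    L.gens.wcharge (ps.map fun x => Gen.vec c x.1 x.2) = ps.length * vcharge c := by
  induction ps with
  | nil => simp
  | cons x ps ih =>
    rw [List.map_cons, GradedGens.wcharge_cons, ih, List.length_cons, Nat.cast_succ, add_mul,
      one_mul, add_comm]
    rfl

lemma wcharge_map_mat (xs : List (Fin 2 × Fin 2)) :
    L.gens.wcharge (xs.map fun x => Gen.mat x.1 x.2) = 0 := by
  induction xs with
  | nil => rfl
  | cons x xs ih =>
    rw [List.map_cons, GradedGens.wcharge_cons, ih]
    rfl

/-- Every element of charge zero is moved into `S` by a polynomial in the Casimir operator with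
nonzero constant term. -/
theorem Good.filt_le_reach (hL : L.Good S e f h ζ) (n : ℕ) (p : ZMod 2) :
    L.gens.filt n 0 p ≤ reach hL.centralizes := by
  induction n generalizing p with
  | zero => rw [GradedGens.filt_zero]; exact bot_le
  | succ n ih =>
    rw [GradedGens.filt, Submodule.span_le]
    rintro _ ⟨l, hdeg, hc, rfl, rfl⟩
    obtain ⟨a, xs, ps, ms, hl⟩ := exists_perm l
    -- Reordering costs a scalar and terms of smaller degree, which the induction hypothesis covers.
    have reduce : ∀ l', l.Perm l' → L.gens.word l' ∈ reach hL.centralizes →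
        L.gens.word l ∈ reach hL.centralizes := by
      intro l' h1 h2
      obtain ⟨r, hr⟩ := hL.superComm.perm h1
      rw [hc] at hr
      have := add_mem (ih _ (GradedGens.filt_mono (by omega) _ _ hr))
        (Submodule.smul_mem _ r h2)
      rwa [sub_add_cancel] at this
    have hdeg' := GradedGens.wdeg_perm (g := L.gens) hl
    have hc' := GradedGens.wcharge_perm (g := L.gens) hl
    -- Without central letters, charge zero forces equally many positive and negative doublets, so
    -- they can alternate. A central letter lies in `S` and leaves a shorter word of lower degree.
    rcases a with _ | a
    · have hps := wcharge_map_vec (L := L) true ps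
      have hms := wcharge_map_vec (L := L) false ms
      have hxs := wcharge_map_mat (L := L) xs
      simp only [vcharge, if_true, mul_one, Bool.false_eq_true, if_false, mul_neg] at hps hms
      rw [List.replicate_zero, List.nil_append] at hl hc' hdeg'
      rw [GradedGens.wcharge_append, GradedGens.wcharge_append, hps, hms, hxs, hc] at hc'
      have hlen : ps.length = ms.length := by omega
      have hl' := hl.trans ((interleave_perm ps ms hlen).symm.append_left _)
      refine reduce _ hl' ?_
      obtain ⟨κ, hκ⟩ := exists_xval (L := L) xs
      obtain ⟨ι, hι, hd⟩ := exists_dval (L := L) (interleave ps ms) (2 * xs.length) κ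
      rw [GradedGens.word_append, hκ, hd, ← xval_congr hι]
      have hchain : ((interleave ps ms).map toDbl).IsChain fun x y => x.c ≠ y.c :=
        (isChain_interleave (false, 0) ps ms).tail
      refine hL.xval_mul_dval_mem ih _ _ hchain ?_ ?_ _
      · have : ∀ ds : List (Bool × Bool × Fin 2), dcharge (ds.map toDbl) =
            L.gens.wcharge (ds.map fun x => Gen.vec x.1 x.2.1 x.2.2) := fun ds => by
          simp only [dcharge, GradedGens.wcharge, List.map_map]; rfl
        rw [this, GradedGens.wcharge_perm (interleave_perm ps ms hlen), GradedGens.wcharge_append, hps, hms, hlen]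
        simp
      · have h1 : ∀ ds : List (Bool × Bool × Fin 2), ddeg (ds.map toDbl) =
            L.gens.wdeg (ds.map fun x => Gen.vec x.1 x.2.1 x.2.2) := fun ds => by
          simp only [ddeg, GradedGens.wdeg, List.map_map]; rfl
        have h2 : L.gens.wdeg (xs.map fun x => Gen.mat x.1 x.2) = 3 * xs.length := by
          simp only [GradedGens.wdeg, List.map_map]
          have : (L.gens.deg ∘ fun x : Fin 2 × Fin 2 => Gen.mat x.1 x.2) = fun _ => 3 := rfl
          rw [this, List.map_const', List.sum_replicate, smul_eq_mul, mul_comm]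
        rw [h1, ← h2, ← GradedGens.wdeg_append, ← GradedGens.wdeg_perm hl']
        exact Nat.lt_succ_iff.1 hdeg
    · refine reduce _ hl ?_
      rw [List.replicate_succ, List.cons_append] at hdeg' hc' ⊢
      rw [GradedGens.word_cons]
      rw [GradedGens.wdeg_cons] at hdeg'
      rw [GradedGens.wcharge_cons] at hc'
      have h1 : L.gens.deg .cen = 3 := rfl
      have h2 : L.gens.charge .cen = 0 := rfl
      rw [hc, h2, zero_add] at hc'
      generalize List.replicate a Gen.cen ++ _ = l' at hdeg' hc'
      have h3 := GradedGens.word_mem (g := L.gens) (l := l') (n := n) (by omega)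
      rw [← hc'] at h3
      exact mul_mem_reach _ hL.a_mem (ih _ h3)

end Letters

/-! ### Pairings obtained from the distinguished elements -/

namespace Letters

variable {M : Type*} [Ring M] [Algebra ℂ M]

/-- The relations between the letters that are needed to express their pairings. -/
structure Rels (L : Letters M) : Prop where
  symm : ∀ i j, L.X i j = L.X j i
  X_comm : ∀ i j c k, L.X i j * L.d c true k = L.d c true k * L.X i j
  d_comm : ∀ c i c' j, L.d c false i * L.d c' true j = L.d c' true j * L.d c false i
  anti : ∀ i j, L.d true true i * L.d false true j + L.d false true j * L.d true true i =
    (2 * eps i j) • (1 : M)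
  anti_self : ∀ c i j, L.d c true i * L.d c true j + L.d c true j * L.d c true i = 0
  X_d : ∀ i j c k, L.X i j * L.d c false k - L.d c false k * L.X i j =
    (1 / 2 : ℂ) • (eps j k • L.d c false i + eps i k • L.d c false j)
  d_d : ∀ i j, L.d false false i * L.d true false j - L.d true false j * L.d false false i ∈
    L.gens.filt 4 0 0

namespace Rels

variable {L : Letters M} {S : Subalgebra ℂ M}

lemma self_mul_self (hR : L.Rels) (c : Bool) (i : Fin 2) : L.d c true i * L.d c true i = 0 := by
  have h := hR.anti_self c i i
  rw [← two_smul ℂ] at h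
  exact (smul_eq_zero.1 h).resolve_left two_ne_zero

lemma X_d_mem (hR : L.Rels) (i j : Fin 2) (c : Bool) (k : Fin 2) :
    L.X i j * L.d c false k - L.d c false k * L.X i j ∈ L.gens.filt 4 (vcharge c) 0 := by
  rw [hR.X_d]
  have h := d_mem (L := L) c false
  exact Submodule.smul_mem _ _ (add_mem (Submodule.smul_mem _ _ (h i))
    (Submodule.smul_mem _ _ (h j)))

lemma ad_pair (x : M) (y z : Fin 2 → M) : ad x (pair y z) =
    ad x (y 0) * z 1 + y 0 * ad x (z 1) - (ad x (y 1) * z 0 + y 1 * ad x (z 0)) := by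
  rw [pair, map_sub, ad_mul, ad_mul]

lemma odd_mul_odd_mem (i j : Fin 2) :
    L.d true true i * L.d false true j ∈ L.gens.filt (2 + 1) 0 0 := by
  have := GradedGens.mul_mem_filt (d_mem (L := L) true true i) (d_mem (L := L) false true j)
  have h1 : vcharge true + vcharge false = 0 := by simp [vcharge]
  have h2 : vparity true + vparity true = 0 := by decide
  rwa [h1, h2] at this

lemma mul_odd_mul_odd_mem {n : ℕ} {c : ℤ} {x : M} (hx : x ∈ L.gens.filt (n + 1) c 0)
    (i j : Fin 2) : x * (L.d true true i * L.d false true j) ∈ L.gens.filt (n + 3) c 0 := by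
  have := GradedGens.mul_mem_filt hx (odd_mul_odd_mem (L := L) i j)
  rwa [add_zero, add_zero] at this

/-- Bracket of a bilinear odd expression with an odd letter. -/
lemma ad_mul_odd {x y z : M} {r s : ℂ} (hyz : y * z + z * y = r • (1 : M))
    (hxz : x * z + z * x = s • (1 : M)) : ad (x * y) z = r • x - s • y := by
  have h1 : ad (x * y) z = x * (y * z + z * y) - (x * z + z * x) * y := by
    rw [ad_apply]; noncomm_ring
  rw [h1, hyz, hxz, mul_smul_comm, smul_mul_assoc, mul_one, one_mul]

/-- The pairing of the odd doublets is twice the charge operator of the Clifford factor: its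
brackets with odd letters have eigenvalues 2 and -2 according to the charge, and it commutes with
even doublets. -/
lemma ad_odd_pair_pos (hR : L.Rels) (j : Fin 2) :
    ad (pair (L.d true true) (L.d false true)) (L.d true true j) = (2 : ℂ) • L.d true true j := by
  have h : ∀ i k, ad (L.d true true i * L.d false true k) (L.d true true j) =
      (2 * eps j k) • L.d true true i := fun i k => by
    rw [ad_mul_odd ((add_comm _ _).trans (hR.anti j k))
      ((hR.anti_self true i j).trans (zero_smul ℂ _).symm), zero_smul, sub_zero]
  have h1 : ∀ x y m : M, ad (x - y) m = ad x m - ad y m := fun x y m => by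
    simp only [ad_apply]; noncomm_ring
  rw [pair, h1, h, h]
  fin_cases j <;> simp [eps]

lemma ad_odd_pair_neg (hR : L.Rels) (j : Fin 2) :
    ad (pair (L.d true true) (L.d false true)) (L.d false true j) =
      (-2 : ℂ) • L.d false true j := by
  have h : ∀ i k, ad (L.d true true i * L.d false true k) (L.d false true j) =
      -((2 * eps i j) • L.d false true k) := fun i k => by
    rw [ad_mul_odd ((hR.anti_self false k j).trans (zero_smul ℂ _).symm) (hR.anti i j),
      zero_smul, zero_sub]
  have h1 : ∀ x y m : M, ad (x - y) m = ad x m - ad y m := fun x y m => by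
    simp only [ad_apply]; noncomm_ring
  rw [pair, h1, h, h]
  fin_cases j <;> simp [eps]

lemma ad_eq_zero_of_commute {x y m : M} (hx : x * m = m * x) (hy : y * m = m * y) :
    ad (x * y) m = 0 := by
  rw [ad_apply, mul_assoc, hy, ← mul_assoc, hx, mul_assoc, sub_self]

lemma ad_odd_pair_even (hR : L.Rels) (c : Bool) (j : Fin 2) :
    ad (pair (L.d true true) (L.d false true)) (L.d c false j) = 0 := by
  have h1 : ∀ x y m : M, ad (x - y) m = ad x m - ad y m := fun x y m => by
    simp only [ad_apply]; noncomm_ring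
  rw [pair, h1, ad_eq_zero_of_commute, ad_eq_zero_of_commute, sub_zero]
  all_goals exact (hR.d_comm _ _ _ _).symm

/-- The two halves of the Dirac operator. -/
lemma pair_even_odd_mem (hR : L.Rels) (hγ : pair (L.d true true) (L.d false true) ∈ S)
    (hD : pair (L.d true false) (L.d false true) + pair (L.d true true) (L.d false false) ∈ S) :
    pair (L.d true false) (L.d false true) ∈ S ∧
      pair (L.d true true) (L.d false false) ∈ S := by
  set γ := pair (L.d true true) (L.d false true) with hγ'
  have h1 : ad γ (pair (L.d true false) (L.d false true)) =
      (-2 : ℂ) • pair (L.d true false) (L.d false true) := by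
    rw [ad_pair, hR.ad_odd_pair_even, hR.ad_odd_pair_even,
      hR.ad_odd_pair_neg, hR.ad_odd_pair_neg, zero_mul, zero_mul, zero_add, zero_add,
      mul_smul_comm, mul_smul_comm, ← smul_sub, pair]
  have h2 : ad γ (pair (L.d true true) (L.d false false)) =
      (2 : ℂ) • pair (L.d true true) (L.d false false) := by
    rw [ad_pair, hR.ad_odd_pair_even, hR.ad_odd_pair_even,
      hR.ad_odd_pair_pos, hR.ad_odd_pair_pos, mul_zero, mul_zero, add_zero, add_zero,
      smul_mul_assoc, smul_mul_assoc, ← smul_sub, pair]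
  have h3 : ad γ (pair (L.d true false) (L.d false true) +
      pair (L.d true true) (L.d false false)) ∈ S :=
    sub_mem (mul_mem hγ hD) (mul_mem hD hγ)
  rw [map_add, h1, h2] at h3
  constructor
  -- The halves are eigenvectors of `ad γ` for -2 and 2; (2 - ad γ)/4 and (2 + ad γ)/4 project onto
  -- them.
  · have := S.smul_mem (sub_mem (S.smul_mem hD 2) h3) (1 / 4)
    convert this using 1
    module
  · have := S.smul_mem (add_mem (S.smul_mem hD 2) h3) (1 / 4)
    convert this using 1
    module

lemma odd_pair_matVec (hR : L.Rels) : pair (L.d true true) (L.matVec (L.d false true)) =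
    L.X 1 0 * (L.d true true 0 * L.d false true 1) - L.X 1 1 * (L.d true true 0 * L.d false true 0) -
      (L.X 0 0 * (L.d true true 1 * L.d false true 1) -
        L.X 0 1 * (L.d true true 1 * L.d false true 0)) := by
  simp only [pair, matVec, mul_sub, ← mul_assoc]
  simp only [hR.X_comm]

lemma ad_X_mul_odd (hR : L.Rels) (i j : Fin 2) (c : Bool) (k : Fin 2) (x : M) :
    ad (L.X i j * x) (L.d c true k) = L.X i j * ad x (L.d c true k) := by
  rw [ad_apply, ad_apply, ← mul_assoc (L.d c true k), ← hR.X_comm, mul_sub, mul_assoc, mul_assoc]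

lemma ad_sub_left (x y m : M) : ad (x - y) m = ad x m - ad y m := by
  simp only [ad_apply]; noncomm_ring

/-- An element quadratic in the odd letters acts linearly on them, here through the matrix. The sign
is the same for both charges, unlike for the pairing without `X`, because `X` is skew for the
alternating form. -/
lemma ad_odd_pair_matVec_pos (hR : L.Rels) (j : Fin 2) :
    ad (pair (L.d true true) (L.matVec (L.d false true))) (L.d true true j) =
      (-2 : ℂ) • L.matVec (L.d true true) j := by
  have h : ∀ i k, ad (L.d true true i * L.d false true k) (L.d true true j) =
      (2 * eps j k) • L.d true true i := fun i k => by
    rw [ad_mul_odd ((add_comm _ _).trans (hR.anti j k))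
      ((hR.anti_self true i j).trans (zero_smul ℂ _).symm), zero_smul, sub_zero]
  simp only [hR.odd_pair_matVec, ad_sub_left, hR.ad_X_mul_odd, h, matVec]
  fin_cases j <;> simp [eps, hR.symm 1 0] <;> module

lemma ad_odd_pair_matVec_neg (hR : L.Rels) (j : Fin 2) :
    ad (pair (L.d true true) (L.matVec (L.d false true))) (L.d false true j) =
      (-2 : ℂ) • L.matVec (L.d false true) j := by
  have h : ∀ i k, ad (L.d true true i * L.d false true k) (L.d false true j) =
      -((2 * eps i j) • L.d false true k) := fun i k => by
    rw [ad_mul_odd ((hR.anti_self false k j).trans (zero_smul ℂ _).symm) (hR.anti i j),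
      zero_smul, zero_sub]
  simp only [hR.odd_pair_matVec, ad_sub_left, hR.ad_X_mul_odd, h, matVec]
  fin_cases j <;> simp [eps] <;> module

lemma ad_X_mul_even (hR : L.Rels) (i j : Fin 2) (c : Bool) (k i' j' : Fin 2) :
    ad (L.X i j * (L.d true true i' * L.d false true j')) (L.d c false k) =
      (L.X i j * L.d c false k - L.d c false k * L.X i j) *
        (L.d true true i' * L.d false true j') := by
  rw [ad_apply, mul_assoc, mul_assoc (L.d true true i'), ← hR.d_comm, ← mul_assoc (L.d true true i'),
    ← hR.d_comm]
  noncomm_ring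

/-- The bracket with the pairing in `hι` inserts `X` next to the odd letter. Its action on the even
letter recombines into a product of two elements of `S`, so membership is exact, not only up to
lower degree. -/
lemma pair_even_matVec_odd_mem (hR : L.Rels) (hγ : pair (L.d true true) (L.d false true) ∈ S)
    (hι : pair (L.d true true) (L.matVec (L.d false true)) ∈ S)
    (hD : pair (L.d true false) (L.d false true) ∈ S) :
    pair (L.d true false) (L.matVec (L.d false true)) ∈ S := by
  have h1 : ad (pair (L.d true true) (L.matVec (L.d false true)))
      (pair (L.d true false) (L.d false true)) ∈ S := sub_mem (mul_mem hι hD) (mul_mem hD hι)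
  have h2 : ad (pair (L.d true true) (L.matVec (L.d false true)))
      (pair (L.d true false) (L.d false true)) =
      -- The 3/2 arises from the brackets `X_d` after reordering the negative odd letters, whose
      -- squares vanish.
      (-2 : ℂ) • pair (L.d true false) (L.matVec (L.d false true)) +
      (3 / 2 : ℂ) • (pair (L.d true true) (L.d false true) *
        pair (L.d true false) (L.d false true)) := by
    have h3 : ∀ k, ad (pair (L.d true true) (L.matVec (L.d false true))) (L.d true false k) =
        _ := fun k => by
      rw [hR.odd_pair_matVec, ad_sub_left, ad_sub_left, ad_sub_left, hR.ad_X_mul_even,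
        hR.ad_X_mul_even, hR.ad_X_mul_even, hR.ad_X_mul_even, hR.X_d, hR.X_d, hR.X_d, hR.X_d]
    have h4 := hR.self_mul_self false
    have h5 : L.d false true 1 * L.d false true 0 = -(L.d false true 0 * L.d false true 1) :=
      eq_neg_of_add_eq_zero_left (hR.anti_self false 1 0)
    rw [ad_pair, hR.ad_odd_pair_matVec_neg, hR.ad_odd_pair_matVec_neg, h3, h3]
    have h6 : ∀ i j k : Fin 2, ∀ m : M, L.d true true j * (L.d false true k *
        (L.d true false i * m)) = L.d true false i * (L.d true true j * (L.d false true k * m)) := by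
      intro i j k m
      rw [← mul_assoc (L.d false true k), ← hR.d_comm, mul_assoc, ← mul_assoc (L.d true true j),
        ← hR.d_comm, mul_assoc]
    simp only [pair, eps, mul_sub, sub_mul, mul_assoc, h6, h4, h5]
    simp [add_mul]
    module
  rw [h2] at h1
  have := S.smul_mem (sub_mem h1 (S.smul_mem (mul_mem hγ hD) (3 / 2))) (-1 / 2)
  convert this using 1
  module

/-- The bracket with the even letter does not recombine as before. Together with the outer odd
letter it has degree at most 1 + 3 + 2 = 6, below the degree 7 of the pairing, so it can be
neglected. -/
lemma pair_odd_matVec_even_mem (hR : L.Rels)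
    (hι : pair (L.d true true) (L.matVec (L.d false true)) ∈ S)
    (hD : pair (L.d true true) (L.d false false) ∈ S) :
    pair (L.d true true) (L.matVec (L.d false false)) ∈
      S.toSubmodule ⊔ L.gens.filt 7 0 1 := by
  set ι := pair (L.d true true) (L.matVec (L.d false true)) with hι'
  have h1 : ad ι (pair (L.d true true) (L.d false false)) ∈ S :=
    sub_mem (mul_mem hι hD) (mul_mem hD hι)
  have h2 : pair (L.matVec (L.d true true)) (L.d false false) =
      -pair (L.d true true) (L.matVec (L.d false false)) := by
    simp only [pair, matVec, sub_mul, mul_sub, ← mul_assoc, hR.X_comm, hR.symm 1 0]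
    abel
  have h3 : ad ι (pair (L.d true true) (L.d false false)) =
      (2 : ℂ) • pair (L.d true true) (L.matVec (L.d false false)) +
        (L.d true true 0 * ad ι (L.d false false 1) -
          L.d true true 1 * ad ι (L.d false false 0)) := by
    rw [ad_pair, hR.ad_odd_pair_matVec_pos, hR.ad_odd_pair_matVec_pos,
      ← neg_eq_iff_eq_neg.2 h2, pair, smul_mul_assoc, smul_mul_assoc]
    module
  have h4 : ∀ j, ad ι (L.d false false j) ∈ L.gens.filt 6 (-1) 0 := fun j => by
    have h5 : ∀ i k i' j', ad (L.X i k * (L.d true true i' * L.d false true j'))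
        (L.d false false j) ∈ L.gens.filt 6 (-1) 0 := fun i k i' j' => by
      rw [hR.ad_X_mul_even]
      exact mul_odd_mul_odd_mem (n := 3) (hR.X_d_mem i k false j) i' j'
    rw [hι', hR.odd_pair_matVec]
    simp only [ad_sub_left]
    exact sub_mem (sub_mem (h5 _ _ _ _) (h5 _ _ _ _)) (sub_mem (h5 _ _ _ _) (h5 _ _ _ _))
  have h6 : ∀ i j, L.d true true i * ad ι (L.d false false j) ∈ L.gens.filt 7 0 1 := fun i j => by
    have h7 := GradedGens.mul_mem_filt (n := 5) (d_mem (L := L) true true i) (h4 j)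
    have h8 : vcharge true + -1 = 0 := by simp [vcharge]
    have h9 : vparity true + 0 = 1 := by decide
    have h10 : vdeg true + 5 + 1 = 7 := rfl
    rwa [h8, h9, h10] at h7
  have h7 := Submodule.smul_mem _ (1 / 2 : ℂ) (sub_mem
    (Submodule.mem_sup_left (T := L.gens.filt 7 0 1) ((Subalgebra.mem_toSubmodule S).2 h1))
    (Submodule.mem_sup_right (S := S.toSubmodule) (sub_mem (h6 0 1) (h6 1 0))))
  convert h7 using 1
  rw [h3]
  module

/-- The anticommutator with half of the Dirac operator removes an odd letter. -/
lemma anticommutator_pair (hR : L.Rels) {A : Fin 2 → M}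
    (hA : ∀ i c j, A i * L.d c true j = L.d c true j * A i) :
    pair (L.d true true) (L.d false false) * pair A (L.d false true) +
      pair A (L.d false true) * pair (L.d true true) (L.d false false) =
    (2 : ℂ) • pair A (L.d false false) +
      ((L.d false false 1 * A 0 - A 0 * L.d false false 1) *
          (L.d true true 0 * L.d false true 1) -
        (L.d false false 1 * A 1 - A 1 * L.d false false 1) *
          (L.d true true 0 * L.d false true 0) -
        (L.d false false 0 * A 0 - A 0 * L.d false false 0) *
          (L.d true true 1 * L.d false true 1) +
        (L.d false false 0 * A 1 - A 1 * L.d false false 0) *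
          (L.d true true 1 * L.d false true 0)) := by
  have h : ∀ i j k l, (L.d true true i * L.d false false j) * (A k * L.d false true l) +
      (A k * L.d false true l) * (L.d true true i * L.d false false j) =
      (2 * eps i l) • (A k * L.d false false j) +
        (L.d false false j * A k - A k * L.d false false j) *
          (L.d true true i * L.d false true l) := fun i j k l => by
    have e1 : (L.d true true i * L.d false false j) * (A k * L.d false true l) =
        L.d false false j * A k * (L.d true true i * L.d false true l) := by
      rw [← hR.d_comm, mul_assoc, ← mul_assoc (L.d true true i), ← hA]
      simp only [mul_assoc]
    have e2 : (A k * L.d false true l) * (L.d true true i * L.d false false j) =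
        A k * L.d false false j * (L.d false true l * L.d true true i) := by
      rw [← hR.d_comm, mul_assoc, ← mul_assoc (L.d false true l), ← hR.d_comm]
      simp only [mul_assoc]
    rw [e1, e2, eq_sub_of_add_eq' (hR.anti i l), mul_sub, sub_mul, mul_smul_comm, mul_one]
    abel
  have e : pair (L.d true true) (L.d false false) * pair A (L.d false true) +
      pair A (L.d false true) * pair (L.d true true) (L.d false false) =
      ((L.d true true 0 * L.d false false 1) * (A 0 * L.d false true 1) +
        (A 0 * L.d false true 1) * (L.d true true 0 * L.d false false 1)) -
      ((L.d true true 0 * L.d false false 1) * (A 1 * L.d false true 0) +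
        (A 1 * L.d false true 0) * (L.d true true 0 * L.d false false 1)) -
      ((L.d true true 1 * L.d false false 0) * (A 0 * L.d false true 1) +
        (A 0 * L.d false true 1) * (L.d true true 1 * L.d false false 0)) +
      ((L.d true true 1 * L.d false false 0) * (A 1 * L.d false true 0) +
        (A 1 * L.d false true 0) * (L.d true true 1 * L.d false false 0)) := by
    simp only [pair]; noncomm_ring
  rw [e, h, h, h, h]
  simp only [pair, eps]
  simp
  module

/-- The odd negative letter is exchanged for the even one. The error is a commutator of degree at
most `n` times two odd letters. -/
lemma pair_mem_of_anticommutator (hR : L.Rels) {A : Fin 2 → M} {n : ℕ}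
    (hA : ∀ i c j, A i * L.d c true j = L.d c true j * A i)
    (hn : ∀ i j, L.d false false i * A j - A j * L.d false false i ∈ L.gens.filt (n + 1) 0 0)
    (hS : pair A (L.d false true) ∈ S) (hD : pair (L.d true true) (L.d false false) ∈ S) :
    pair A (L.d false false) ∈ S.toSubmodule ⊔ L.gens.filt (n + 3) 0 0 := by
  have h1 := add_mem (mul_mem hD hS) (mul_mem hS hD)
  rw [hR.anticommutator_pair hA] at h1
  have h2 : ∀ i j k l, (L.d false false i * A j - A j * L.d false false i) *
      (L.d true true k * L.d false true l) ∈ L.gens.filt (n + 3) 0 0 := fun i j k l =>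
    mul_odd_mul_odd_mem (hn i j) k l
  have h7 := Submodule.smul_mem _ (1 / 2 : ℂ) (sub_mem
    (Submodule.mem_sup_left (T := L.gens.filt (n + 3) 0 0) ((Subalgebra.mem_toSubmodule S).2 h1))
    (Submodule.mem_sup_right (S := S.toSubmodule)
      (add_mem (sub_mem (sub_mem (h2 1 0 0 1) (h2 1 1 0 0)) (h2 0 0 1 1)) (h2 0 1 1 0))))
  rw [add_sub_cancel_right, smul_smul] at h7
  norm_num at h7
  exact h7

/-- The pairings of doublets of opposite charge. -/
lemma pair_mem (hR : L.Rels) (hγ : pair (L.d true true) (L.d false true) ∈ S)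
    (hD : pair (L.d true false) (L.d false true) + pair (L.d true true) (L.d false false) ∈ S)
    (k k' : Bool) : pair (L.d true k) (L.d false k') ∈ S.toSubmodule ⊔
      L.gens.filt (vdeg k + vdeg k') 0 (vparity k + vparity k') := by
  obtain ⟨h1, h2⟩ := hR.pair_even_odd_mem hγ hD
  rcases k with _ | _ <;> rcases k' with _ | _
  · have h3 : vparity false + vparity false = 0 := by decide
    rw [h3]
    exact hR.pair_mem_of_anticommutator (n := 3) (fun i c j => hR.d_comm _ _ _ _) hR.d_d h1 h2
  · exact Submodule.mem_sup_left h1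
  · exact Submodule.mem_sup_left h2
  · exact Submodule.mem_sup_left hγ

lemma pair_matVec_mem (hR : L.Rels) (hγ : pair (L.d true true) (L.d false true) ∈ S)
    (hι : pair (L.d true true) (L.matVec (L.d false true)) ∈ S)
    (hD : pair (L.d true false) (L.d false true) + pair (L.d true true) (L.d false false) ∈ S)
    (k k' : Bool) : pair (L.d true k) (L.matVec (L.d false k')) ∈ S.toSubmodule ⊔
      L.gens.filt (vdeg k + vdeg k' + 3) 0 (vparity k + vparity k') := by
  obtain ⟨h1, h2⟩ := hR.pair_even_odd_mem hγ hD
  have h3 := hR.pair_even_matVec_odd_mem hγ hι h1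
  rcases k with _ | _ <;> rcases k' with _ | _
  -- The matrix is attached to the left doublet without changing the order of factors. `A` commutes
  -- with the odd letters, so the anticommutator argument applies to it.
  · set A : Fin 2 → M := fun i => L.d true false 0 * L.X i 1 - L.d true false 1 * L.X i 0 with hA
    have e1 : ∀ y, pair (L.d true false) (L.matVec y) = pair A y := fun y => by
      simp only [hA, pair, matVec, hR.symm 1 0]; noncomm_ring
    have h4 : vparity false + vparity false = 0 := by decide
    rw [e1] at h3 ⊢
    rw [h4]
    refine hR.pair_mem_of_anticommutator (n := 6) (fun i c j => ?_) (fun i j => ?_) h3 h2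
    · simp only [hA, sub_mul, mul_sub, mul_assoc, hR.X_comm]
      simp only [← mul_assoc, hR.d_comm]
    · have h4 : ∀ i k l m, L.d false false i * (L.d true false k * L.X l m) -
          L.d true false k * L.X l m * L.d false false i ∈ L.gens.filt 7 0 0 := fun i k l m => by
        have e2 : L.d false false i * (L.d true false k * L.X l m) -
            L.d true false k * L.X l m * L.d false false i =
            (L.d false false i * L.d true false k - L.d true false k * L.d false false i) *
              L.X l m - L.d true false k * (L.X l m * L.d false false i -
                L.d false false i * L.X l m) := by noncomm_ring
        rw [e2]
        have h5 := GradedGens.mul_mem_filt (m := 3) (n := 3) (hR.d_d i k) (X_mem l m)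
        have h6 := GradedGens.mul_mem_filt (n := 3) (d_mem (L := L) true false k)
          (hR.X_d_mem l m false i)
        have h7 : vcharge true + vcharge false = 0 := by simp [vcharge]
        have h8 : vparity false = 0 := rfl
        have h9 : vdeg false + 3 + 1 = 7 := rfl
        rw [h7, h8, h9, add_zero] at h6
        rw [add_zero, add_zero] at h5
        exact sub_mem h5 h6
      have := sub_mem (h4 i 0 j 1) (h4 i 1 j 0)
      convert this using 1
      simp only [hA]
      noncomm_ring
  · exact Submodule.mem_sup_left h3
  · have h4 : vparity true + vparity false = 1 := by decide
    have h5 : vdeg true + vdeg false + 3 = 7 := rfl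
    rw [h4, h5]
    exact hR.pair_odd_matVec_even_mem hι h2
  · exact Submodule.mem_sup_left hι

end Rels

end Letters

/-! ### The letters of `U(𝔤) ⊗ C(𝔭)` -/

abbrev Alg : Type := Ug ⊗[ℂ] Cp

/-- The embedding `x ↦ x ⊗ 1` of `𝔤`. -/
def inU : 𝔤 →ₗ[ℂ] Alg :=
  (Algebra.TensorProduct.includeLeft : Ug →ₐ[ℂ] Alg).toLinearMap ∘ₗ
    (UniversalEnvelopingAlgebra.ι ℂ : 𝔤 →ₗ⁅ℂ⁆ Ug).toLinearMap

/-- The embedding `y ↦ 1 ⊗ y` of `𝔭`. -/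
def inC : 𝔭 →ₗ[ℂ] Alg :=
  (Algebra.TensorProduct.includeRight : Cp →ₐ[ℂ] Alg).toLinearMap ∘ₗ CliffordAlgebra.ι Q

lemma inU_apply (x : 𝔤) : inU x = u x ⊗ₜ 1 := rfl

lemma inC_apply (y : 𝔭) : inC y = 1 ⊗ₜ c y := rfl

lemma inU_bracket (x y : 𝔤) : inU x * inU y - inU y * inU x = inU ⁅x, y⁆ := by
  rw [inU_apply, inU_apply, inU_apply, Algebra.TensorProduct.tmul_mul_tmul,
    Algebra.TensorProduct.tmul_mul_tmul, ← TensorProduct.sub_tmul, mul_one, u, u, u,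
    LieHom.map_lie, Ring.lie_def]

lemma inU_comm_inC (x : 𝔤) (y : 𝔭) : inU x * inC y = inC y * inU x := by
  simp [inU_apply, inC_apply]

lemma B_apply (x y : 𝔭) : B x y = ((x : 𝔤).1 * (y : 𝔤).1).trace := rfl

lemma inC_anti (x y : 𝔭) : inC x * inC y + inC y * inC x = (-2 * B x y) • (1 : Alg) := by
  rw [inC_apply, inC_apply, Algebra.TensorProduct.tmul_mul_tmul,
    Algebra.TensorProduct.tmul_mul_tmul, ← TensorProduct.tmul_add, one_mul,
    CliffordAlgebra.ι_mul_ι_add_swap, Algebra.algebraMap_eq_smul_one, TensorProduct.tmul_smul,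
    ← Algebra.TensorProduct.one_def]
  congr 1
  have h : B y x = B x y := by rw [B_apply, B_apply, Matrix.trace_mul_comm]
  simp only [QuadraticMap.polar, Q, neg_apply, LinearMap.BilinMap.toQuadraticMap_apply,
    map_add, LinearMap.add_apply, h]
  ring

/-- The symmetric matrix of elements of `𝔰𝔩(2)`. -/
def Xg : Fin 2 → Fin 2 → 𝔤 := ![![E, -(1 / 2 : ℂ) • H], ![-(1 / 2 : ℂ) • H, -F]]

/-- The doublets in `𝔭`. -/
def dp : Bool → Fin 2 → 𝔭
  | true => ![E₁p, E₂p]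
  | false => ![F₂p, -F₁p]

lemma coe_bracket (x y : 𝔤) : (⁅x, y⁆ : 𝔤).1 = x.1 * y.1 - y.1 * x.1 := rfl

lemma coe_E : E.1 = !![0, 1, 0; 0, 0, 0; 0, 0, 0] := by
  ext i j; fin_cases i <;> fin_cases j <;> simp [E, unit]
lemma coe_F : F.1 = !![0, 0, 0; 1, 0, 0; 0, 0, 0] := by
  ext i j; fin_cases i <;> fin_cases j <;> simp [F, unit]
lemma coe_E₁ : E₁.1 = !![0, 0, 1; 0, 0, 0; 0, 0, 0] := by
  ext i j; fin_cases i <;> fin_cases j <;> simp [E₁, unit]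
lemma coe_E₂ : E₂.1 = !![0, 0, 0; 0, 0, 1; 0, 0, 0] := by
  ext i j; fin_cases i <;> fin_cases j <;> simp [E₂, unit]
lemma coe_F₁ : F₁.1 = !![0, 0, 0; 0, 0, 0; 1, 0, 0] := by
  ext i j; fin_cases i <;> fin_cases j <;> simp [F₁, unit]
lemma coe_F₂ : F₂.1 = !![0, 0, 0; 0, 0, 0; 0, 1, 0] := by
  ext i j; fin_cases i <;> fin_cases j <;> simp [F₂, unit]
lemma coe_H : H.1 = !![1, 0, 0; 0, -1, 0; 0, 0, 0] := by
  ext i j; fin_cases i <;> fin_cases j <;> simp [H, H₁, H₂] <;> norm_num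
lemma coe_H₁_add_H₂ : (H₁ + H₂).1 = !![1 / 3, 0, 0; 0, 1 / 3, 0; 0, 0, -2 / 3] := by
  ext i j; fin_cases i <;> fin_cases j <;> simp [H₁, H₂] <;> norm_num

lemma coe_Xg (i j : Fin 2) : (Xg i j).1 = (![![!![0, 1, 0; 0, 0, 0; 0, 0, 0],
    !![-1 / 2, 0, 0; 0, 1 / 2, 0; 0, 0, 0]], ![!![-1 / 2, 0, 0; 0, 1 / 2, 0; 0, 0, 0],
    !![0, 0, 0; -1, 0, 0; 0, 0, 0]]] : Fin 2 → Fin 2 → Matrix (Fin 3) (Fin 3) ℂ) i j := by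
  fin_cases i <;> fin_cases j <;> simp [Xg, coe_E, coe_F, coe_H] <;> norm_num

lemma coe_dp (c : Bool) (i : Fin 2) : (dp c i : 𝔤).1 = (if c then
    ![!![0, 0, 1; 0, 0, 0; 0, 0, 0], !![0, 0, 0; 0, 0, 1; 0, 0, 0]] else
    ![!![0, 0, 0; 0, 0, 0; 0, 1, 0], !![0, 0, 0; 0, 0, 0; -1, 0, 0]] :
      Fin 2 → Matrix (Fin 3) (Fin 3) ℂ) i := by
  rcases c with _ | _ <;> fin_cases i <;>
    simp [dp, E₁p, E₂p, F₁p, F₂p, coe_E₁, coe_E₂, coe_F₁, coe_F₂]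

/-! ### Brackets of the letters by matrix computation -/

section Brackets

lemma vecCons_zero_empty {α : Type*} [Zero α] : ![(0 : α)] = 0 := by
  funext i; fin_cases i; rfl

attribute [local simp] vecCons_zero_empty coe_bracket coe_E coe_F coe_H coe_H₁_add_H₂ coe_Xg coe_dp

lemma bracket_E_Xg (i j : Fin 2) :
    ⁅E, Xg i j⁆ = (if i = 1 then Xg 0 j else 0) + if j = 1 then Xg i 0 else 0 := by
  apply Subtype.ext
  fin_cases i <;> fin_cases j <;> simp [Ring.lie_def] <;> norm_num

lemma bracket_F_Xg (i j : Fin 2) :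
    ⁅F, Xg i j⁆ = (if i = 0 then Xg 1 j else 0) + if j = 0 then Xg i 1 else 0 := by
  apply Subtype.ext
  fin_cases i <;> fin_cases j <;> simp [Ring.lie_def] <;> norm_num

lemma bracket_H_Xg (i j : Fin 2) : ⁅H, Xg i j⁆ =
    ((if i = 0 then (1 : ℂ) else -1) + if j = 0 then (1 : ℂ) else -1) • Xg i j := by
  apply Subtype.ext
  fin_cases i <;> fin_cases j <;> simp [Ring.lie_def]

lemma bracket_E_dp (c : Bool) (i : Fin 2) :
    ⁅E, (dp c i : 𝔤)⁆ = if i = 1 then (dp c 0 : 𝔤) else 0 := by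
  apply Subtype.ext
  rcases c with _ | _ <;> fin_cases i <;> simp [Ring.lie_def]

lemma bracket_F_dp (c : Bool) (i : Fin 2) :
    ⁅F, (dp c i : 𝔤)⁆ = if i = 0 then (dp c 1 : 𝔤) else 0 := by
  apply Subtype.ext
  rcases c with _ | _ <;> fin_cases i <;> simp [Ring.lie_def]

lemma bracket_H_dp (c : Bool) (i : Fin 2) :
    ⁅H, (dp c i : 𝔤)⁆ = (if i = 0 then (1 : ℂ) else -1) • (dp c i : 𝔤) := by
  apply Subtype.ext
  rcases c with _ | _ <;> fin_cases i <;> simp [Ring.lie_def]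

lemma bracket_Xg_dp (i j : Fin 2) (c : Bool) (k : Fin 2) : ⁅Xg i j, (dp c k : 𝔤)⁆ =
    (1 / 2 : ℂ) • (eps j k • (dp c i : 𝔤) + eps i k • (dp c j : 𝔤)) := by
  apply Subtype.ext
  rcases c with _ | _ <;> fin_cases i <;> fin_cases j <;> fin_cases k <;>
    simp [Ring.lie_def, eps] <;> norm_num

lemma bracket_cen_Xg (i j : Fin 2) : ⁅H₁ + H₂, Xg i j⁆ = 0 := by
  apply Subtype.ext
  rw [coe_bracket, coe_H₁_add_H₂, coe_Xg]
  fin_cases i <;> fin_cases j <;> simp <;> norm_num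

lemma bracket_cen_dp (c : Bool) (i : Fin 2) :
    ⁅H₁ + H₂, (dp c i : 𝔤)⁆ = (vcharge c : ℂ) • (dp c i : 𝔤) := by
  apply Subtype.ext
  rw [coe_bracket, coe_H₁_add_H₂, coe_dp]
  rcases c with _ | _ <;> fin_cases i <;> simp [vcharge] <;> norm_num

lemma B_dp (i j : Fin 2) : B (dp true i) (dp false j) = -eps i j := by
  rw [B_apply]
  fin_cases i <;> fin_cases j <;> simp [eps, Matrix.trace, Fin.sum_univ_three]

lemma B_dp_self (c : Bool) (i j : Fin 2) : B (dp c i) (dp c j) = 0 := by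
  rw [B_apply]
  rcases c with _ | _ <;> fin_cases i <;> fin_cases j <;>
    simp [Matrix.trace]

/-- The decomposition of an element of `𝔤` into letters. -/
lemma eq_sum_letters (x : 𝔤) : x = (3 / 2 * (x.1 0 0 + x.1 1 1)) • (H₁ + H₂) +
    (x.1 0 1 • Xg 0 0 + (x.1 1 1 - x.1 0 0) • Xg 0 1 + (-x.1 1 0) • Xg 1 1) +
    (x.1 0 2 • (dp true 0 : 𝔤) + x.1 1 2 • (dp true 1 : 𝔤)) +
    (x.1 2 1 • (dp false 0 : 𝔤) + (-x.1 2 0) • (dp false 1 : 𝔤)) := by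
  apply Subtype.ext
  have h := mem_𝔤.1 x.2
  rw [Matrix.trace, Fin.sum_univ_three] at h
  simp only [Matrix.diag_apply] at h
  have h2 : x.1 2 2 = -(x.1 0 0 + x.1 1 1) := by linear_combination h
  change x.1 = (3 / 2 * (x.1 0 0 + x.1 1 1)) • (H₁ + H₂).1 +
    (x.1 0 1 • (Xg 0 0).1 + (x.1 1 1 - x.1 0 0) • (Xg 0 1).1 + (-x.1 1 0) • (Xg 1 1).1) +
    (x.1 0 2 • (dp true 0 : 𝔤).1 + x.1 1 2 • (dp true 1 : 𝔤).1) +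
    (x.1 2 1 • (dp false 0 : 𝔤).1 + (-x.1 2 0) • (dp false 1 : 𝔤).1)
  rw [coe_H₁_add_H₂, coe_Xg, coe_Xg, coe_Xg, coe_dp, coe_dp, coe_dp, coe_dp]
  ext i j
  fin_cases i <;> fin_cases j <;> simp [h2] <;> ring

end Brackets

/-- The letters of `U(𝔤) ⊗ C(𝔭)`. -/
def letters : Letters Alg where
  a := inU (H₁ + H₂)
  X i j := inU (Xg i j)
  d c k i := if k then inC (dp c i) else inU (dp c i)

lemma letters_X (i j : Fin 2) : letters.X i j = inU (Xg i j) := rfl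

lemma letters_d_false (c : Bool) (i : Fin 2) : letters.d c false i = inU (dp c i) := rfl

lemma letters_d_true (c : Bool) (i : Fin 2) : letters.d c true i = inC (dp c i) := rfl

lemma smul_mem_filt_of_eq {x : Alg} {n : ℕ} {c q : ℤ} {t : ℂ}
    (hx : x ∈ letters.gens.filt n q 0) (h : (c - q : ℂ) * t = 0) :
    t • x ∈ letters.gens.filt n c 0 := by
  rcases mul_eq_zero.1 h with h | h
  · have : c = q := by exact_mod_cast sub_eq_zero.1 h
    rw [this]
    exact Submodule.smul_mem _ _ hx
  · rw [h, zero_smul]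
    exact zero_mem _

/-- The weight spaces of `𝔤` consist of elements of the corresponding charge. -/
lemma inU_mem_filt {x : 𝔤} {c : ℤ} (hx : ⁅H₁ + H₂, x⁆ = (c : ℂ) • x) :
    inU x ∈ letters.gens.filt 4 c 0 := by
  have hx' : (H₁ + H₂).1 * x.1 - x.1 * (H₁ + H₂).1 = (c : ℂ) • x.1 := congrArg Subtype.val hx
  rw [coe_H₁_add_H₂] at hx'
  -- The bracket with a diagonal matrix multiplies each entry by a difference of diagonal entries,
  -- so only entries of charge `c` can be nonzero.
  have h : ∀ i j, (![1 / 3, 1 / 3, -2 / 3] i - ![1 / 3, 1 / 3, -2 / 3] j - (c : ℂ)) * x.1 i j = 0 := by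
    intro i j
    have h1 := congrFun (congrFun hx' i) j
    simp only [Matrix.sub_apply, Matrix.smul_apply, Matrix.mul_apply, Fin.sum_univ_three] at h1
    fin_cases i <;> fin_cases j <;> simp [-mul_eq_zero] at h1 ⊢ <;>
      first | linear_combination h1 | linear_combination -h1
  have ha : inU (H₁ + H₂) ∈ letters.gens.filt 4 0 0 :=
    GradedGens.val_mem (g := letters.gens) .cen
  have hX : ∀ i j, inU (Xg i j) ∈ letters.gens.filt 4 0 0 := Letters.X_mem (L := letters)
  have hp : ∀ i, inU (dp true i) ∈ letters.gens.filt 4 1 0 := Letters.d_mem (L := letters) true false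
  have hm : ∀ i, inU (dp false i) ∈ letters.gens.filt 4 (-1) 0 :=
    Letters.d_mem (L := letters) false false
  have h00 := h 0 0
  have h01 := h 0 1
  have h02 := h 0 2
  have h10 := h 1 0
  have h11 := h 1 1
  have h12 := h 1 2
  have h20 := h 2 0
  have h21 := h 2 1
  simp at h00 h01 h02 h10 h11 h12 h20 h21
  norm_num at h00 h01 h02 h10 h11 h12 h20 h21
  rw [eq_sum_letters x]
  simp only [map_add, map_smul]
  refine add_mem (add_mem (add_mem ?_ (add_mem (add_mem ?_ ?_) ?_)) (add_mem ?_ ?_))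
    (add_mem ?_ ?_)
  · rw [← map_add]
    refine smul_mem_filt_of_eq ha ?_
    rcases h00 with h00 | h00
    · simp [h00]
    · rcases h11 with h11 | h11
      · simp [h11]
      · simp [h00, h11]
  · refine smul_mem_filt_of_eq (hX _ _) ?_
    simpa using h01
  · refine smul_mem_filt_of_eq (hX _ _) ?_
    rcases h00 with h00 | h00
    · simp [h00]
    · rcases h11 with h11 | h11
      · simp [h11]
      · simp [h00, h11]
  · refine smul_mem_filt_of_eq (hX _ _) ?_
    simpa using h10
  · refine smul_mem_filt_of_eq (hp _) ?_
    push_cast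
    rcases h02 with h02 | h02
    · rw [sub_eq_zero.1 h02]; simp
    · simp [h02]
  · refine smul_mem_filt_of_eq (hp _) ?_
    push_cast
    rcases h12 with h12 | h12
    · rw [sub_eq_zero.1 h12]; simp
    · simp [h12]
  · refine smul_mem_filt_of_eq (hm _) ?_
    push_cast
    rcases h21 with h21 | h21
    · rw [← sub_eq_zero.1 h21]; simp
    · simp [h21]
  · refine smul_mem_filt_of_eq (hm _) ?_
    push_cast
    rcases h20 with h20 | h20
    · rw [← sub_eq_zero.1 h20]; simp
    · simp [h20]

/-- By the Jacobi identity charges add, which locates the bracket without computing it; when no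
letter has the resulting charge, the bracket is zero. -/
lemma bracket_mem_filt {x y : 𝔤} {c c' : ℤ} (hx : ⁅H₁ + H₂, x⁆ = (c : ℂ) • x)
    (hy : ⁅H₁ + H₂, y⁆ = (c' : ℂ) • y) :
    inU x * inU y - inU y * inU x ∈ letters.gens.filt 4 (c + c') 0 := by
  rw [inU_bracket]
  refine inU_mem_filt ?_
  rw [leibniz_lie, hx, hy, smul_lie, lie_smul, ← add_smul, Int.cast_add]

/-- The generators of `U(𝔤) ⊗ C(𝔭)`, as elements of `𝔤`. -/
def genLie : Gen → 𝔤
  | .cen => H₁ + H₂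
  | .mat i j => Xg i j
  | .vec c _ i => dp c i

lemma genLie_weight (x : Gen) :
    ⁅H₁ + H₂, genLie x⁆ = (letters.gens.charge x : ℂ) • genLie x := by
  rcases x with _ | ⟨i, j⟩ | ⟨c, k, i⟩
  · exact (lie_self _).trans (by rw [show letters.gens.charge .cen = 0 from rfl]; simp)
  · exact (bracket_cen_Xg i j).trans
      (by rw [show letters.gens.charge (.mat i j) = 0 from rfl]; simp)
  · exact bracket_cen_dp c i

lemma gen_cases (x : Gen) : (letters.gens.val x = inU (genLie x) ∧ letters.gens.deg x = 3 ∧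
    letters.gens.parity x = 0) ∨ ∃ c i, x = .vec c true i := by
  rcases x with _ | ⟨i, j⟩ | ⟨c, _ | _, i⟩
  · exact Or.inl ⟨rfl, rfl, rfl⟩
  · exact Or.inl ⟨rfl, rfl, rfl⟩
  · exact Or.inl ⟨rfl, rfl, rfl⟩
  · exact Or.inr ⟨c, i, rfl⟩

lemma inC_anti_pos_neg (i j : Fin 2) : inC (dp true i) * inC (dp false j) +
    inC (dp false j) * inC (dp true i) = (2 * eps i j) • (1 : Alg) := by
  rw [inC_anti, B_dp]
  congr 1
  ring

lemma inC_anti_self (c : Bool) (i j : Fin 2) : inC (dp c i) * inC (dp c j) +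
    inC (dp c j) * inC (dp c i) = 0 := by
  rw [inC_anti, B_dp_self, mul_zero, zero_smul]

/-- Two letters from `𝔤` have a bracket in `𝔤`, of degree 3 < 6; letters of the two tensor factors
commute; two Clifford letters anticommute up to a scalar, of degree 0 < 2. -/
lemma superComm_letters : letters.gens.SuperComm := by
  intro x y
  rcases gen_cases x with ⟨hx1, hx2, hx3⟩ | ⟨c, i, rfl⟩ <;>
    rcases gen_cases y with ⟨hy1, hy2, hy3⟩ | ⟨c', j, rfl⟩
  · rw [hx1, hy1, hx2, hy2, hx3, hy3, sgn_zero_left, one_smul, add_zero]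
    exact GradedGens.filt_mono (by norm_num) _ _
      (bracket_mem_filt (genLie_weight x) (genLie_weight y))
  · rw [hx1, hx3, sgn_zero_left, one_smul]
    have : letters.gens.val (.vec c' true j) = inC (dp c' j) := rfl
    rw [this, inU_comm_inC, sub_self]
    exact zero_mem _
  · rw [hy1, hy3, sgn_zero_right, one_smul]
    have : letters.gens.val (.vec c true i) = inC (dp c i) := rfl
    rw [this, inU_comm_inC, sub_self]
    exact zero_mem _
  · have e1 : letters.gens.val (.vec c true i) = inC (dp c i) := rfl
    have e2 : letters.gens.val (.vec c' true j) = inC (dp c' j) := rfl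
    have e3 : letters.gens.parity (.vec c true i) = 1 := rfl
    have e4 : letters.gens.parity (.vec c' true j) = 1 := rfl
    have e5 : sgn 1 1 = -1 := by simp [sgn]
    have e6 : letters.gens.charge (.vec c true i) = vcharge c := rfl
    have e7 : letters.gens.charge (.vec c' true j) = vcharge c' := rfl
    have e8 : (1 : ZMod 2) + 1 = 0 := by decide
    have h1 : (1 : Alg) ∈ letters.gens.filt 2 0 0 :=
      GradedGens.filt_mono one_le_two _ _ GradedGens.one_mem_filt
    rw [e1, e2, e3, e4, e5, e6, e7, e8, neg_smul, one_smul, sub_neg_eq_add]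
    rcases c with _ | _ <;> rcases c' with _ | _
    · rw [inC_anti_self]; exact zero_mem _
    · rw [add_comm (inC _ * inC _), inC_anti_pos_neg, vcharge_add_of_ne (by simp)]
      exact Submodule.smul_mem _ _ h1
    · rw [inC_anti_pos_neg, vcharge_add_of_ne (by simp)]
      exact Submodule.smul_mem _ _ h1
    · rw [inC_anti_self]; exact zero_mem _

lemma rels_letters : letters.Rels where
  symm i j := by
    fin_cases i <;> fin_cases j <;> simp [letters, Xg]
  X_comm i j c k := inU_comm_inC _ _
  d_comm c i c' j := inU_comm_inC _ _
  anti := inC_anti_pos_neg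
  anti_self := inC_anti_self
  X_d i j c k := by
    rw [letters_X, letters_d_false, inU_bracket, bracket_Xg_dp]
    simp only [map_smul, map_add, letters_d_false]
  d_d i j := by
    have h := bracket_mem_filt (bracket_cen_dp false i) (bracket_cen_dp true j)
    rwa [vcharge_add_of_ne (by simp)] at h

/-! ### The diagonal action of `𝔤𝔩(2)` -/

/-- The image of `E` under the diagonal map of `𝔨` into `U(𝔤) ⊗ C(𝔭)`. The quadratic Clifford term
has the bracket with `𝔭` prescribed by `ad E`; its 1/2 cancels the 2 of the Clifford relation. The
next three elements are built alike, `aΔ` being the charge operator. -/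
def eΔ : Alg := inU E - (1 / 2 : ℂ) • (inC (dp true 0) * inC (dp false 0))
def fΔ : Alg := inU F + (1 / 2 : ℂ) • (inC (dp true 1) * inC (dp false 1))
def hΔ : Alg := inU H + (1 / 2 : ℂ) • (inC (dp true 0) * inC (dp false 1) +
  inC (dp true 1) * inC (dp false 0))
def aΔ : Alg := inU (H₁ + H₂) + (1 / 2 : ℂ) • (inC (dp true 0) * inC (dp false 1) -
  inC (dp true 1) * inC (dp false 0))

lemma ad_add_left (x y m : Alg) : ad (x + y) m = ad x m + ad y m := by
  simp only [ad_apply]; noncomm_ring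

lemma ad_smul_left (r : ℂ) (x m : Alg) : ad (r • x) m = r • ad x m := by
  simp only [ad_apply, smul_mul_assoc, mul_smul_comm, smul_sub]

lemma ad_inU_inU (x y : 𝔤) : ad (inU x) (inU y) = inU ⁅x, y⁆ := inU_bracket x y

lemma ad_inU_inC (x : 𝔤) (y : 𝔭) : ad (inU x) (inC y) = 0 := by
  rw [ad_apply, inU_comm_inC, sub_self]

lemma ad_inC_mul_inU (x y : 𝔭) (z : 𝔤) : ad (inC x * inC y) (inU z) = 0 := by
  rw [ad_apply, mul_assoc, ← inU_comm_inC, ← mul_assoc, ← mul_assoc, ← inU_comm_inC, sub_self]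

lemma ad_inC_mul_pos (i j k : Fin 2) : ad (inC (dp true i) * inC (dp false j)) (inC (dp true k)) =
    (2 * eps k j) • inC (dp true i) := by
  rw [Letters.Rels.ad_mul_odd ((add_comm _ _).trans (inC_anti_pos_neg k j))
    ((inC_anti_self true i k).trans (zero_smul ℂ _).symm), zero_smul, sub_zero]

lemma ad_inC_mul_neg (i j k : Fin 2) : ad (inC (dp true i) * inC (dp false j)) (inC (dp false k)) =
    -((2 * eps i k) • inC (dp false j)) := by
  rw [Letters.Rels.ad_mul_odd ((inC_anti_self false j k).trans (zero_smul ℂ _).symm)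
    (inC_anti_pos_neg i k), zero_smul, zero_sub]

section Action

attribute [local simp] eΔ fΔ hΔ aΔ ad_add_left ad_smul_left ad_inU_inU ad_inU_inC ad_inC_mul_inU
  ad_inC_mul_pos ad_inC_mul_neg Letters.Rels.ad_sub_left

lemma ad_eΔ_inU (x : 𝔤) : ad eΔ (inU x) = inU ⁅E, x⁆ := by simp

lemma ad_fΔ_inU (x : 𝔤) : ad fΔ (inU x) = inU ⁅F, x⁆ := by simp

lemma ad_hΔ_inU (x : 𝔤) : ad hΔ (inU x) = inU ⁅H, x⁆ := by simp

lemma ad_aΔ_inU (x : 𝔤) : ad aΔ (inU x) = inU ⁅H₁ + H₂, x⁆ := by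
  simp [-map_add]

lemma ad_eΔ_inC (c : Bool) (i : Fin 2) :
    ad eΔ (inC (dp c i)) = if i = 1 then inC (dp c 0) else 0 := by
  rcases c with _ | _ <;> fin_cases i <;> simp [eps]

lemma ad_fΔ_inC (c : Bool) (i : Fin 2) :
    ad fΔ (inC (dp c i)) = if i = 0 then inC (dp c 1) else 0 := by
  rcases c with _ | _ <;> fin_cases i <;> simp [eps]

lemma ad_hΔ_inC (c : Bool) (i : Fin 2) :
    ad hΔ (inC (dp c i)) = (if i = 0 then (1 : ℂ) else -1) • inC (dp c i) := by
  rcases c with _ | _ <;> fin_cases i <;> simp [eps]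

lemma ad_aΔ_inC (c : Bool) (i : Fin 2) :
    ad aΔ (inC (dp c i)) = (vcharge c : ℂ) • inC (dp c i) := by
  rcases c with _ | _ <;> fin_cases i <;> simp [eps, vcharge, -map_add, ad_inU_inC]

end Action

/-! ### The distinguished elements as pairings of letters -/

lemma aTilde_eq : aTilde = inU (H₁ + H₂) := by
  rw [aTilde, map_add, inU_apply, inU_apply, TensorProduct.add_tmul]

lemma gTilde_eq : gTilde = -pair (letters.d true true) (letters.d false true) := by
  simp only [gTilde, pair, letters_d_true, dp, Matrix.cons_val_zero, Matrix.cons_val_one, map_neg,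
    inC_apply, Algebra.TensorProduct.tmul_mul_tmul, one_mul, TensorProduct.tmul_add, mul_neg]
  abel

lemma D_eq : D = -(pair (letters.d true false) (letters.d false true) +
    pair (letters.d true true) (letters.d false false)) := by
  simp only [D, pair, letters_d_true, letters_d_false, dp, Matrix.cons_val_zero,
    Matrix.cons_val_one, map_neg, Submodule.coe_neg, E₁p, E₂p, F₁p, F₂p,
    inC_apply, inU_apply, Algebra.TensorProduct.tmul_mul_tmul, one_mul, mul_one, mul_neg]
  abel

lemma two_mul_tmul (x : Ug) (y : Cp) : (2 * x) ⊗ₜ[ℂ] y = (2 : ℂ) • (x ⊗ₜ y) := by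
  rw [TensorProduct.smul_tmul', two_smul, two_mul]

lemma iTilde_eq : iTilde =
    (2 : ℂ) • pair (letters.d true true) (letters.matVec (letters.d false true)) := by
  simp only [iTilde, two_mul_tmul, pair, Letters.matVec, letters_d_true, letters_X, Xg, dp,
    Matrix.cons_val_zero, Matrix.cons_val_one, map_neg, map_smul,
    inC_apply, inU_apply, Algebra.TensorProduct.tmul_mul_tmul, one_mul, mul_one, mul_neg, mul_sub,
    smul_mul_assoc, mul_smul_comm, neg_mul]
  module

/-- The determinant of the matrix of letters. -/
def zeta : Alg := letters.X 0 0 * letters.X 1 1 - letters.X 0 1 * letters.X 0 1 - letters.X 0 1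

lemma inU_E_mul_F : inU E * inU F = inU F * inU E + inU H := by
  have h : ⁅E, F⁆ = H := by
    apply Subtype.ext
    rw [coe_bracket, coe_E, coe_F, coe_H]
    ext i j
    fin_cases i <;> fin_cases j <;> simp
  rw [← h, ← inU_bracket]
  abel

lemma bTilde_eq : bTilde = (-4 : ℂ) • zeta := by
  have h1 : bTilde = inU H * inU H + (2 : ℂ) • (inU E * inU F + inU F * inU E) := by
    simp only [bTilde, TensorProduct.add_tmul, two_mul_tmul, inU_apply,
      Algebra.TensorProduct.tmul_mul_tmul, one_mul, pow_two]
  rw [h1, zeta, letters_X, letters_X, letters_X]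
  simp only [Xg, Matrix.cons_val_zero, Matrix.cons_val_one, map_neg, map_smul, smul_mul_assoc,
    mul_smul_comm, mul_neg, inU_E_mul_F]
  module

/-- The algebra generated by the distinguished elements and the Dirac operator. -/
def genAlg : Subalgebra ℂ Alg := Algebra.adjoin ℂ {aTilde, bTilde, iTilde, gTilde, D}

/-! ### Infinitesimal invariance of the distinguished elements -/

section Doublets

variable {M : Type*} [Ring M] [Algebra ℂ M]

/-- `e`, `f`, `h` act on `x` as on the standard basis of the two-dimensional representation. -/
structure IsDoublet (e f h : M) (x : Fin 2 → M) : Prop where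
  ad_e : ∀ i, ad e (x i) = if i = 1 then x 0 else 0
  ad_f : ∀ i, ad f (x i) = if i = 0 then x 1 else 0
  ad_h : ∀ i, ad h (x i) = (if i = 0 then (1 : ℂ) else -1) • x i

lemma IsDoublet.ad_pair {e f h : M} {x y : Fin 2 → M} (hx : IsDoublet e f h x)
    (hy : IsDoublet e f h y) :
    ad e (pair x y) = 0 ∧ ad f (pair x y) = 0 ∧ ad h (pair x y) = 0 := by
  refine ⟨?_, ?_, ?_⟩ <;> rw [Letters.Rels.ad_pair]
  · simp [hx.ad_e, hy.ad_e]
  · simp [hx.ad_f, hy.ad_f]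
  · simp [hx.ad_h, hy.ad_h]

end Doublets

lemma ad_eΔ_X (i j : Fin 2) : ad eΔ (letters.X i j) =
    (if i = 1 then letters.X 0 j else 0) + if j = 1 then letters.X i 0 else 0 := by
  rw [letters_X, ad_eΔ_inU, bracket_E_Xg]
  fin_cases i <;> fin_cases j <;> simp [letters_X]

lemma ad_fΔ_X (i j : Fin 2) : ad fΔ (letters.X i j) =
    (if i = 0 then letters.X 1 j else 0) + if j = 0 then letters.X i 1 else 0 := by
  rw [letters_X, ad_fΔ_inU, bracket_F_Xg]
  fin_cases i <;> fin_cases j <;> simp [letters_X]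

lemma ad_hΔ_X (i j : Fin 2) : ad hΔ (letters.X i j) =
    ((if i = 0 then (1 : ℂ) else -1) + if j = 0 then (1 : ℂ) else -1) • letters.X i j := by
  rw [letters_X, ad_hΔ_inU, bracket_H_Xg, map_smul]

lemma isDoublet_d (c k : Bool) : IsDoublet eΔ fΔ hΔ (letters.d c k) := by
  rcases k with _ | _
  · refine ⟨fun i => ?_, fun i => ?_, fun i => ?_⟩
    · rw [letters_d_false, ad_eΔ_inU, bracket_E_dp, apply_ite inU, map_zero]; rfl
    · rw [letters_d_false, ad_fΔ_inU, bracket_F_dp, apply_ite inU, map_zero]; rfl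
    · rw [letters_d_false, ad_hΔ_inU, bracket_H_dp, map_smul]
  · exact ⟨ad_eΔ_inC c, ad_fΔ_inC c, ad_hΔ_inC c⟩

lemma isDoublet_matVec {x : Fin 2 → Alg} (hx : IsDoublet eΔ fΔ hΔ x) :
    IsDoublet eΔ fΔ hΔ (letters.matVec x) := by
  have hs := rels_letters.symm 1 0
  refine ⟨fun i => ?_, fun i => ?_, fun i => ?_⟩
  · simp only [Letters.matVec, map_sub, ad_mul, ad_eΔ_X, hx.ad_e]
    fin_cases i <;> simp [hs, add_mul]
  · simp only [Letters.matVec, map_sub, ad_mul, ad_fΔ_X, hx.ad_f]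
    fin_cases i <;> simp [hs, add_mul]
  · simp only [Letters.matVec, map_sub, ad_mul, ad_hΔ_X, hx.ad_h]
    fin_cases i <;> simp [smul_sub] <;> module

lemma letters_X_zero_zero : letters.X 0 0 = inU E := rfl

lemma letters_X_zero_one : letters.X 0 1 = (-(1 / 2) : ℂ) • inU H := by
  rw [letters_X, ← map_smul]; rfl

lemma letters_X_one_one : letters.X 1 1 = -inU F := by rw [letters_X, ← map_neg]; rfl

lemma inU_E_mul_H : inU E * inU H = inU H * inU E - (2 : ℂ) • inU E := by
  have h := inU_bracket H (Xg 0 0)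
  rw [bracket_H_Xg, map_smul, ← letters_X, letters_X_zero_zero, sub_eq_iff_eq_add] at h
  rw [h]
  norm_num

lemma inU_F_mul_H : inU F * inU H = inU H * inU F + (2 : ℂ) • inU F := by
  have h := inU_bracket H (Xg 1 1)
  rw [bracket_H_Xg, map_smul, ← letters_X, letters_X_one_one, sub_eq_iff_eq_add] at h
  simp only [mul_neg, neg_mul] at h
  rw [← neg_neg (inU H * inU F), h]
  simp
  norm_num

lemma letters_X_mul (i j : Fin 2) : letters.X i 0 * letters.X 1 j - letters.X i 1 * letters.X 0 j =
    eps i j • zeta + letters.X i j := by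
  have hs := rels_letters.symm 1 0
  fin_cases i <;> fin_cases j <;> simp [eps, zeta] <;>
    simp only [hs, letters_X_zero_zero, letters_X_zero_one, letters_X_one_one, smul_mul_assoc,
      mul_smul_comm, mul_neg, neg_mul, inU_E_mul_H, inU_F_mul_H, inU_E_mul_F] <;> module

lemma ad_zeta : ad eΔ zeta = 0 ∧ ad fΔ zeta = 0 ∧ ad hΔ zeta = 0 := by
  have hs := rels_letters.symm 1 0
  refine ⟨?_, ?_, ?_⟩
  · simp only [zeta, map_sub, ad_mul, ad_eΔ_X]
    simp [hs]
    simp only [letters_X_zero_zero, letters_X_zero_one, smul_mul_assoc, mul_smul_comm, mul_add,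
      inU_E_mul_H]
    module
  · simp only [zeta, map_sub, ad_mul, ad_fΔ_X]
    simp [hs]
    simp only [letters_X_zero_one, letters_X_one_one, smul_mul_assoc, mul_smul_comm, mul_neg,
      neg_mul, add_mul, inU_F_mul_H]
    module
  · simp only [zeta, map_sub, ad_mul, ad_hΔ_X]
    simp
    module

lemma centralizes_genAlg : Centralizes genAlg eΔ fΔ hΔ := by
  intro s hs
  induction hs using Algebra.adjoin_induction with
  | mem x hx =>
    rcases hx with rfl | rfl | rfl | rfl | rfl
    · rw [aTilde_eq, ad_eΔ_inU, ad_fΔ_inU, ad_hΔ_inU]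
      have h : ∀ x : 𝔤, ⁅H₁ + H₂, x⁆ = 0 → inU ⁅x, H₁ + H₂⁆ = 0 := fun x hx => by
        rw [← lie_skew, hx, neg_zero, map_zero]
      have hE : E = Xg 0 0 := rfl
      have hF : F = -Xg 1 1 := (neg_neg F).symm
      have hH : H = (-2 : ℂ) • Xg 0 1 := by
        show H = (-2 : ℂ) • (-(1 / 2 : ℂ) • H)
        module
      refine ⟨h _ ?_, h _ ?_, h _ ?_⟩
      · rw [hE, bracket_cen_Xg]
      · rw [hF, lie_neg, bracket_cen_Xg, neg_zero]
      · rw [hH, lie_smul, bracket_cen_Xg, smul_zero]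
    · simp [bTilde_eq, ad_zeta]
    · simp [iTilde_eq, (isDoublet_d true true).ad_pair (isDoublet_matVec (isDoublet_d false true))]
    · simp [gTilde_eq, (isDoublet_d true true).ad_pair (isDoublet_d false true)]
    · simp [D_eq, (isDoublet_d true false).ad_pair (isDoublet_d false true),
        (isDoublet_d true true).ad_pair (isDoublet_d false false)]
  | algebraMap r => simp [Algebra.algebraMap_eq_smul_one, ad_one]
  | add x y _ _ hx hy => simp [hx, hy]
  | mul x y _ _ hx hy => simp [ad_mul, hx, hy]

lemma good_letters : letters.Good genAlg eΔ fΔ hΔ zeta := by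
  have ha : aTilde ∈ genAlg := Algebra.subset_adjoin (by simp)
  have hb : bTilde ∈ genAlg := Algebra.subset_adjoin (by simp)
  have hi : iTilde ∈ genAlg := Algebra.subset_adjoin (by simp)
  have hg : gTilde ∈ genAlg := Algebra.subset_adjoin (by simp)
  have hD : D ∈ genAlg := Algebra.subset_adjoin (by simp)
  rw [aTilde_eq] at ha
  rw [bTilde_eq] at hb
  rw [iTilde_eq] at hi
  rw [gTilde_eq, neg_mem_iff] at hg
  rw [D_eq, neg_mem_iff] at hD
  have hi' := genAlg.smul_mem hi (1 / 2)
  rw [smul_smul] at hi'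
  norm_num at hi'
  have hb' := genAlg.smul_mem hb (-1 / 4)
  rw [smul_smul] at hb'
  norm_num at hb'
  exact
  { superComm := superComm_letters
    centralizes := centralizes_genAlg
    symm := rels_letters.symm
    e_X := ad_eΔ_X
    f_X := ad_fΔ_X
    h_X := ad_hΔ_X
    e_d := fun c k => (isDoublet_d c k).ad_e
    f_d := fun c k => (isDoublet_d c k).ad_f
    h_d := fun c k => (isDoublet_d c k).ad_h
    X_mul := letters_X_mul
    a_mem := ha
    ζ_mem := hb'
    pair_mem := rels_letters.pair_mem hg hD
    pair_matVec_mem := rels_letters.pair_matVec_mem hg hi' hD }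

/-! ### The action of `K` on the letters -/

lemma act_inU (k : K) (x : 𝔤) : act k (inU x) = inU (Ad k.1 x) := by
  rw [inU_apply, inU_apply, act, Algebra.TensorProduct.map_tmul, map_one, AdU, u, u,
    UniversalEnvelopingAlgebra.lift_ι_apply]
  rfl

lemma act_inC (k : K) (y : 𝔭) : act k (inC y) = inC (AdP k y) := by
  rw [inC_apply, inC_apply, act, Algebra.TensorProduct.map_tmul, map_one, AdC, c, c,
    CliffordAlgebra.map_apply_ι]

lemma coe_Ad (k : Matrix.SpecialLinearGroup (Fin 3) ℂ) (x : 𝔤) :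
    (Ad k x).1 = k.1 * x.1 * (k⁻¹).1 := rfl

/-- `k` acts on the letters through the upper left block with columns `(p, q)` and `(r, s)`, where
`t` is the inverse of the determinant of the block. -/
structure ActsBy (k : K) (p q r s t : ℂ) : Prop where
  det : t * (p * s - q * r) = 1
  cen : Ad k.1 (H₁ + H₂) = H₁ + H₂
  X00 : Ad k.1 (Xg 0 0) = t • (p ^ 2 • Xg 0 0 + (2 * p * q) • Xg 0 1 + q ^ 2 • Xg 1 1)
  X01 : Ad k.1 (Xg 0 1) = t • ((p * r) • Xg 0 0 + (p * s + q * r) • Xg 0 1 + (q * s) • Xg 1 1)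
  X11 : Ad k.1 (Xg 1 1) = t • (r ^ 2 • Xg 0 0 + (2 * r * s) • Xg 0 1 + s ^ 2 • Xg 1 1)
  pos0 : Ad k.1 (dp true 0) = (p * s - q * r) • (p • (dp true 0 : 𝔤) + q • (dp true 1 : 𝔤))
  pos1 : Ad k.1 (dp true 1) = (p * s - q * r) • (r • (dp true 0 : 𝔤) + s • (dp true 1 : 𝔤))
  neg0 : Ad k.1 (dp false 0) = t ^ 2 • (p • (dp false 0 : 𝔤) + q • (dp false 1 : 𝔤))
  neg1 : Ad k.1 (dp false 1) = t ^ 2 • (r • (dp false 0 : 𝔤) + s • (dp false 1 : 𝔤))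

lemma actsBy_of_coe {k : K} {p q r s t : ℂ} (hk : k.1.1 = !![p, r, 0; q, s, 0; 0, 0, t]) :
    ActsBy k p q r s t := by
  have hdet : t * (p * s - q * r) = 1 := by
    have := k.1.2
    rw [hk, Matrix.det_fin_three] at this
    simp at this
    linear_combination this
  have hinv : (k.1⁻¹).1 = !![t * s, -(t * r), 0; -(t * q), t * p, 0; 0, 0, p * s - q * r] := by
    have h := Matrix.SpecialLinearGroup.coe_inv k.1
    rw [hk, Matrix.adjugate_fin_three] at h
    refine h.trans ?_
    ext i j
    fin_cases i <;> fin_cases j <;> simp <;> ring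
  have key : ∀ x y : 𝔤, !![p, r, 0; q, s, 0; 0, 0, t] * x.1 *
      !![t * s, -(t * r), 0; -(t * q), t * p, 0; 0, 0, p * s - q * r] = y.1 → Ad k.1 x = y :=
    fun x y h => Subtype.ext (by rw [coe_Ad, hinv, hk, h])
  refine ⟨hdet, key _ _ ?_, key _ _ ?_, key _ _ ?_, key _ _ ?_, key _ _ ?_, key _ _ ?_, key _ _ ?_,
    key _ _ ?_⟩
  · rw [coe_H₁_add_H₂]
    ext i j
    fin_cases i <;> fin_cases j <;> simp [Matrix.mul_apply, Fin.sum_univ_three] <;> first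
      | ring1
      | linear_combination (1 / 3 : ℂ) * hdet
      | linear_combination (-2 / 3 : ℂ) * hdet
  all_goals
    ext i j
    fin_cases i <;> fin_cases j <;>
      simp [Matrix.mul_apply, Fin.sum_univ_three, coe_Xg, coe_dp] <;> ring

lemma exists_actsBy (k : K) : ∃ p q r s t : ℂ, ActsBy k p q r s t := by
  have h := K_comm_gam k.2
  have h02 := congrFun (congrFun h 0) 2
  have h12 := congrFun (congrFun h 1) 2
  have h20 := congrFun (congrFun h 2) 0
  have h21 := congrFun (congrFun h 2) 1
  simp [gam, self_eq_neg, neg_eq_self] at h02 h12 h20 h21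
  refine ⟨k.1.1 0 0, k.1.1 1 0, k.1.1 0 1, k.1.1 1 1, k.1.1 2 2, actsBy_of_coe ?_⟩
  ext i j
  fin_cases i <;> fin_cases j <;> simp [h02, h12, h20, h21]

/-- The automorphism `α` acts on the doublet `x` by the matrix with columns `(p, q)`, `(r, s)`
and a scalar. -/
def ActsOn (α : Alg →ₐ[ℂ] Alg) (p q r s b : ℂ) (x : Fin 2 → Alg) : Prop :=
  α (x 0) = b • (p • x 0 + q • x 1) ∧ α (x 1) = b • (r • x 0 + s • x 1)

/-- The alternating pairing is multiplied by the determinant, which the scalars `b`, `b'` cancel. -/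
lemma ActsOn.pair {α : Alg →ₐ[ℂ] Alg} {p q r s b b' : ℂ} {x y : Fin 2 → Alg}
    (hx : ActsOn α p q r s b x) (hy : ActsOn α p q r s b' y) (h : b * b' * (p * s - q * r) = 1) :
    α (pair x y) = pair x y := by
  rw [DiracSU21.pair, map_sub, map_mul, map_mul, hx.1, hx.2, hy.1, hy.2]
  simp only [smul_mul_assoc, mul_smul_comm, mul_add, add_mul, smul_add]
  match_scalars <;> first
    | ring1
    | linear_combination h
    | linear_combination -h

namespace ActsBy

variable {k : K} {p q r s t : ℂ}

lemma d (h : ActsBy k p q r s t) (c i : Bool) :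
    ActsOn (act k) p q r s (if c then p * s - q * r else t ^ 2) (letters.d c i) := by
  rcases i with _ | _
  · rcases c with _ | _
    · constructor
      · rw [letters_d_false, letters_d_false, act_inU, h.neg0]; simp
      · rw [letters_d_false, letters_d_false, act_inU, h.neg1]; simp
    · constructor
      · rw [letters_d_false, letters_d_false, act_inU, h.pos0]; simp
      · rw [letters_d_false, letters_d_false, act_inU, h.pos1]; simp
  · have key : ∀ {y : 𝔭} (z : 𝔭), (Ad k.1 y : 𝔤) = z → act k (inC y) = inC z := fun {y} z hyz => by
      rw [act_inC]
      exact congrArg inC (Subtype.ext hyz)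
    rcases c with _ | _
    · constructor
      · rw [letters_d_true, letters_d_true,
          key (t ^ 2 • (p • dp false 0 + q • dp false 1)) h.neg0]
        simp
      · rw [letters_d_true, letters_d_true,
          key (t ^ 2 • (r • dp false 0 + s • dp false 1)) h.neg1]
        simp
    · constructor
      · rw [letters_d_true, letters_d_true,
          key ((p * s - q * r) • (p • dp true 0 + q • dp true 1)) h.pos0]
        simp
      · rw [letters_d_true, letters_d_true,
          key ((p * s - q * r) • (r • dp true 0 + s • dp true 1)) h.pos1]
        simp

lemma X (h : ActsBy k p q r s t) : act k (letters.X 0 0) =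
      t • (p ^ 2 • letters.X 0 0 + (2 * p * q) • letters.X 0 1 + q ^ 2 • letters.X 1 1) ∧
    act k (letters.X 0 1) = t • ((p * r) • letters.X 0 0 + (p * s + q * r) • letters.X 0 1 +
      (q * s) • letters.X 1 1) ∧
    act k (letters.X 1 1) =
      t • (r ^ 2 • letters.X 0 0 + (2 * r * s) • letters.X 0 1 + s ^ 2 • letters.X 1 1) := by
  refine ⟨?_, ?_, ?_⟩
  · rw [letters_X, act_inU, h.X00]; simp only [map_smul, map_add, letters_X]
  · rw [letters_X, act_inU, h.X01]; simp only [map_smul, map_add, letters_X]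
  · rw [letters_X, act_inU, h.X11]; simp only [map_smul, map_add, letters_X]

/-- `X` transforms as the symmetric square twisted by the inverse determinant; the twist undoes the
factor produced by contracting with the alternating form. -/
lemma matVec (h : ActsBy k p q r s t) {b : ℂ} {y : Fin 2 → Alg} (hy : ActsOn (act k) p q r s b y) :
    ActsOn (act k) p q r s b (letters.matVec y) := by
  obtain ⟨h00, h01, h11⟩ := h.X
  have hs := rels_letters.symm 1 0
  have hd := h.det
  constructor <;>
  · simp only [Letters.matVec, map_sub, map_mul, hs, h00, h01, h11, hy.1, hy.2]
    simp only [smul_mul_assoc, mul_smul_comm, mul_add, add_mul, smul_add, smul_sub]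
    match_scalars <;> first
      | ring1
      | linear_combination (b * p) * hd
      | linear_combination (-b * p) * hd
      | linear_combination (b * q) * hd
      | linear_combination (-b * q) * hd
      | linear_combination (b * r) * hd
      | linear_combination (-b * r) * hd
      | linear_combination (b * s) * hd
      | linear_combination (-b * s) * hd

lemma zeta (h : ActsBy k p q r s t) : act k zeta = zeta := by
  obtain ⟨h00, h01, h11⟩ := h.X
  have hs := rels_letters.symm 1 0
  have hd := h.det
  -- The symmetrised expression is homogeneous: it has no linear term, so only the quadratic
  -- transformation law is needed.
  have h1 : DiracSU21.zeta = (1 / 2 : ℂ) • (letters.X 0 0 * letters.X 1 1 +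
      letters.X 1 1 * letters.X 0 0) - letters.X 0 1 * letters.X 0 1 := by
    have h2 := letters_X_mul 1 0
    simp only [eps, hs] at h2
    simp at h2
    have h3 : letters.X 1 1 * letters.X 0 0 = letters.X 0 1 * letters.X 0 1 + DiracSU21.zeta -
      letters.X 0 1 := by
      rw [sub_eq_iff_eq_add] at h2
      rw [h2]; abel
    rw [h3, DiracSU21.zeta]
    module
  rw [h1]
  simp only [map_sub, map_add, map_smul, map_mul, h00, h01, h11]
  simp only [smul_mul_assoc, mul_smul_comm, mul_add, add_mul, smul_add]
  match_scalars <;> first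
    | ring1
    | linear_combination (t * (p * s - q * r) + 1) * hd
    | linear_combination (-(t * (p * s - q * r) + 1)) * hd
    | linear_combination (1 / 2 * (t * (p * s - q * r) + 1)) * hd

lemma pair_eq (h : ActsBy k p q r s t) {x y : Fin 2 → Alg}
    (hx : ActsOn (act k) p q r s (p * s - q * r) x) (hy : ActsOn (act k) p q r s (t ^ 2) y) :
    act k (pair x y) = pair x y :=
  hx.pair hy (by linear_combination (t * (p * s - q * r) + 1) * h.det)

end ActsBy

lemma aTilde_mem : aTilde ∈ invariants := fun k => by
  obtain ⟨p, q, r, s, t, h⟩ := exists_actsBy k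
  rw [aTilde_eq, act_inU, h.cen]

lemma bTilde_mem : bTilde ∈ invariants := fun k => by
  obtain ⟨p, q, r, s, t, h⟩ := exists_actsBy k
  rw [bTilde_eq, map_smul, h.zeta]

lemma iTilde_mem : iTilde ∈ invariants := fun k => by
  obtain ⟨p, q, r, s, t, h⟩ := exists_actsBy k
  rw [iTilde_eq, map_smul, h.pair_eq (h.d true true) (h.matVec (h.d false true))]

lemma gTilde_mem : gTilde ∈ invariants := fun k => by
  obtain ⟨p, q, r, s, t, h⟩ := exists_actsBy k
  rw [gTilde_eq, map_neg, h.pair_eq (h.d true true) (h.d false true)]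

lemma D_mem : D ∈ invariants := fun k => by
  obtain ⟨p, q, r, s, t, h⟩ := exists_actsBy k
  rw [D_eq, map_neg, map_add, h.pair_eq (h.d true false) (h.d false true),
    h.pair_eq (h.d true true) (h.d false false)]

lemma genAlg_le_invariants : genAlg ≤ invariants := by
  rw [genAlg, Algebra.adjoin_le_iff]
  rintro x (rfl | rfl | rfl | rfl | rfl)
  exacts [aTilde_mem, bTilde_mem, iTilde_mem, gTilde_mem, D_mem]

/-! ### Generation by the letters -/

lemma adjoin_range_ι_Ug :
    Algebra.adjoin ℂ (Set.range (UniversalEnvelopingAlgebra.ι ℂ : 𝔤 → Ug)) = ⊤ := by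
  set S := Algebra.adjoin ℂ (Set.range (UniversalEnvelopingAlgebra.ι ℂ : 𝔤 → Ug)) with hS
  let φ : 𝔤 →ₗ⁅ℂ⁆ S :=
    { toFun := fun x => ⟨u x, Algebra.subset_adjoin ⟨x, rfl⟩⟩
      map_add' := fun x y => Subtype.ext (map_add _ x y)
      map_smul' := fun r x => Subtype.ext (map_smul _ r x)
      map_lie' := fun {x y} => Subtype.ext (LieHom.map_lie _ x y) }
  have h : S.val.comp (UniversalEnvelopingAlgebra.lift ℂ φ) = AlgHom.id ℂ Ug := by
    refine UniversalEnvelopingAlgebra.hom_ext ℂ (LieHom.ext fun x => ?_)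
    change ((UniversalEnvelopingAlgebra.lift ℂ φ (UniversalEnvelopingAlgebra.ι ℂ x) : S) : Ug) = _
    rw [UniversalEnvelopingAlgebra.lift_ι_apply]
    rfl
  refine top_unique fun x _ => ?_
  have h1 := congrArg (fun f : Ug →ₐ[ℂ] Ug => f x) h
  change ((UniversalEnvelopingAlgebra.lift ℂ φ x : S) : Ug) = x at h1
  rw [← h1]
  exact Subtype.prop _

lemma eq_top_of_inU_inC {S : Subalgebra ℂ Alg} (hU : ∀ x, inU x ∈ S) (hC : ∀ y, inC y ∈ S) :
    S = ⊤ := by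
  have h1 : ∀ a : Ug, a ⊗ₜ[ℂ] (1 : Cp) ∈ S := fun a => by
    have h : Algebra.adjoin ℂ (Set.range (UniversalEnvelopingAlgebra.ι ℂ : 𝔤 → Ug)) ≤
        S.comap (Algebra.TensorProduct.includeLeft : Ug →ₐ[ℂ] Alg) := by
      rw [Algebra.adjoin_le_iff]
      rintro _ ⟨x, rfl⟩
      exact hU x
    rw [adjoin_range_ι_Ug] at h
    exact h (Algebra.mem_top : a ∈ _)
  have h2 : ∀ b : Cp, (1 : Ug) ⊗ₜ[ℂ] b ∈ S := fun b => by
    have h : Algebra.adjoin ℂ (Set.range (CliffordAlgebra.ι Q)) ≤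
        S.comap (Algebra.TensorProduct.includeRight : Cp →ₐ[ℂ] Alg) := by
      rw [Algebra.adjoin_le_iff]
      rintro _ ⟨x, rfl⟩
      exact hC x
    rw [CliffordAlgebra.adjoin_range_ι] at h
    exact h (Algebra.mem_top : b ∈ _)
  refine top_unique fun x _ => ?_
  induction x using TensorProduct.induction_on with
  | zero => exact zero_mem S
  | add x y hx hy => exact add_mem (hx trivial) (hy trivial)
  | tmul a b =>
    have := mul_mem (h1 a) (h2 b)
    rwa [Algebra.TensorProduct.tmul_mul_tmul, mul_one, one_mul] at this

lemma eq_sum_dp (y : 𝔭) : ∃ p q r s : ℂ,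
    y = p • dp true 0 + q • dp true 1 + r • dp false 0 + s • dp false 1 := by
  obtain ⟨y, hy⟩ := y
  rw [𝔭, Submodule.mem_span_insert] at hy
  obtain ⟨p, z, hz, rfl⟩ := hy
  rw [Submodule.mem_span_insert] at hz
  obtain ⟨q, z, hz, rfl⟩ := hz
  rw [Submodule.mem_span_pair] at hz
  obtain ⟨s, r, rfl⟩ := hz
  refine ⟨p, q, r, -s, Subtype.ext ?_⟩
  change p • E₁ + (q • E₂ + (s • F₁ + r • F₂)) = p • E₁ + q • E₂ + r • F₂ + (-s) • (-F₁)
  module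

lemma eq_top_of_letters {S : Subalgebra ℂ Alg} (ha : letters.a ∈ S)
    (hX : letters.X 0 0 ∈ S ∧ letters.X 0 1 ∈ S ∧ letters.X 1 1 ∈ S)
    (hd : ∀ c k i, letters.d c k i ∈ S) : S = ⊤ := by
  refine eq_top_of_inU_inC (fun x => ?_) (fun y => ?_)
  · have ha' : inU (H₁ + H₂) ∈ S := ha
    rw [map_add] at ha'
    rw [eq_sum_letters x]
    simp only [map_add, map_smul]
    exact add_mem (add_mem (add_mem (S.smul_mem ha' _) (add_mem (add_mem (S.smul_mem hX.1 _)
      (S.smul_mem hX.2.1 _)) (S.smul_mem hX.2.2 _)))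
      (add_mem (S.smul_mem (hd true false 0) _) (S.smul_mem (hd true false 1) _)))
      (add_mem (S.smul_mem (hd false false 0) _) (S.smul_mem (hd false false 1) _))
  · obtain ⟨p, q, r, s, rfl⟩ := eq_sum_dp y
    rw [map_add, map_add, map_add, map_smul, map_smul, map_smul, map_smul]
    exact add_mem (add_mem (add_mem (S.smul_mem (hd true true 0) _)
      (S.smul_mem (hd true true 1) _)) (S.smul_mem (hd false true 0) _))
      (S.smul_mem (hd false true 1) _)

/-! ### Gradings by weights -/

section Weights

variable {M : Type*} [Ring M] [Algebra ℂ M]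

/-- The subalgebra spanned by a multiplicative family of subspaces. -/
def gradedAlg (N : ℤ → Submodule ℂ M) (one : (1 : M) ∈ N 0)
    (mul : ∀ c c' x y, x ∈ N c → y ∈ N c' → x * y ∈ N (c + c')) : Subalgebra ℂ M :=
  Submodule.toSubalgebra (⨆ c, N c) (Submodule.mem_iSup_of_mem 0 one) fun x y hx hy => by
    induction hx using Submodule.iSup_induction' with
    | zero => simp
    | add x x' _ _ h h' => rw [add_mul]; exact add_mem h h'
    | mem c x hx =>
      induction hy using Submodule.iSup_induction' with
      | zero => simp
      | add y y' _ _ h h' => rw [mul_add]; exact add_mem h h'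
      | mem c' y hy => exact Submodule.mem_iSup_of_mem _ (mul c c' x y hx hy)

/-- By independence of eigenspaces: the component of `x` outside `N 0` lies both in the eigenspace
of `μ 0` and in the sum of the others. -/
lemma mem_zero_of_eigen {T : Module.End ℂ M} {μ : ℤ → ℂ} (hμ : Function.Injective μ)
    {N : ℤ → Submodule ℂ M} (hN : ∀ c, N c ≤ T.eigenspace (μ c)) {x : M} (hx : x ∈ ⨆ c, N c)
    (hT : T x = μ 0 • x) : x ∈ N 0 := by
  have hind := T.eigenspaces_iSupIndep.comp hμ 0
  rw [iSup_split_single N 0, Submodule.mem_sup] at hx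
  obtain ⟨y, hy, z, hz, rfl⟩ := hx
  have h1 : z ∈ T.eigenspace (μ 0) := by
    have h2 := sub_mem (Module.End.mem_eigenspace_iff.2 hT) (hN 0 hy)
    rwa [add_sub_cancel_left] at h2
  have h3 : z ∈ ⨆ (c) (_ : c ≠ 0), T.eigenspace (μ c) :=
    (iSup₂_mono fun c _ => hN c) hz
  have h4 : z = 0 := Submodule.disjoint_def.1 hind z h1 h3
  rw [h4, add_zero]
  exact hy

/-- The joint eigenvectors of an inner derivation and of an automorphism that integrates it. -/
def wtSpace (y : M) (α : M →ₐ[ℂ] M) (τ : ℂ) (c : ℤ) : Submodule ℂ M :=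
  (ad y).eigenspace c ⊓ Module.End.eigenspace α.toLinearMap (τ ^ c)

lemma mem_wtSpace {y : M} {α : M →ₐ[ℂ] M} {τ : ℂ} {c : ℤ} {x : M} :
    x ∈ wtSpace y α τ c ↔ ad y x = (c : ℂ) • x ∧ α x = τ ^ c • x := by
  rw [wtSpace, Submodule.mem_inf, Module.End.mem_eigenspace_iff, Module.End.mem_eigenspace_iff]
  rfl

/-- The subalgebra spanned by joint eigenvectors. -/
def wtAlg (y : M) (α : M →ₐ[ℂ] M) {τ : ℂ} (hτ : τ ≠ 0) : Subalgebra ℂ M :=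
  gradedAlg (wtSpace y α τ) (by simp [mem_wtSpace, ad_one]) fun c c' x z hx hz => by
    rw [mem_wtSpace] at *
    refine ⟨?_, ?_⟩
    · rw [ad_mul, hx.1, hz.1, smul_mul_assoc, mul_smul_comm, ← add_smul, Int.cast_add]
    · rw [map_mul, hx.2, hz.2, smul_mul_assoc, mul_smul_comm, smul_smul, zpow_add₀ hτ]

lemma mem_wtAlg {y : M} {α : M →ₐ[ℂ] M} {τ : ℂ} (hτ : τ ≠ 0) (c : ℤ) {x : M}
    (h : ad y x = (c : ℂ) • x ∧ α x = τ ^ c • x) : x ∈ wtAlg y α hτ :=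
  Submodule.mem_iSup_of_mem (p := wtSpace y α τ) c (mem_wtSpace.2 h)

/-- An element fixed by the automorphism is annihilated by the derivation. -/
lemma ad_eq_zero_of_fixed {y : M} {α : M →ₐ[ℂ] M} {τ : ℂ} (hτ : τ ≠ 0)
    (hinj : Function.Injective fun c : ℤ => τ ^ c) (htop : wtAlg y α hτ = ⊤) {x : M}
    (hx : α x = x) : ad y x = 0 := by
  have h1 : x ∈ wtAlg y α hτ := htop ▸ Algebra.mem_top
  -- A fixed element has eigenvalue 1 = τ⁰, so it is in the joint weight space of weight 0, which
  -- the derivation annihilates.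
  have h2 := mem_zero_of_eigen (T := α.toLinearMap) hinj
    (N := wtSpace y α τ) (fun c => inf_le_right) h1 (by simpa using hx)
  simpa using (mem_wtSpace.1 h2).1

end Weights

/-! ### Elements of `K` -/

lemma exists_mem_K {g : Matrix (Fin 3) (Fin 3) ℂ} (h1 : g.det = 1) (h2 : gᴴ * g = 1)
    (h3 : gam * g = g * gam) : ∃ k : K, k.1.1 = g := by
  refine ⟨⟨⟨g, h1⟩, ?_, ?_⟩, rfl⟩
  · change gᴴ * gam * g = gam
    rw [Matrix.mul_assoc, h3, ← Matrix.mul_assoc, h2, Matrix.one_mul]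
  · change (gᴴ)⁻¹ = g
    exact Matrix.inv_eq_right_inv h2

/-- The number `exp i` is not a root of unity since π is irrational. One element with distinct
powers separates all integral weights and stands in for a whole circle. -/
lemma exists_unit : ∃ z w : ℂ, starRingEnd ℂ z = w ∧ z * w = 1 ∧ Function.Injective fun c : ℤ => z ^ c := by
  have h0 : ∀ n : ℤ, Complex.exp Complex.I ^ n = 1 → n = 0 := by
    intro n hn
    rw [← Complex.exp_int_mul, Complex.exp_eq_one_iff] at hn
    obtain ⟨m, hm⟩ := hn
    have h1 : (n : ℂ) = m * (2 * Real.pi) := by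
      have := Complex.I_ne_zero
      apply mul_right_cancel₀ this
      linear_combination hm
    have h2 : (n : ℝ) = m * (2 * Real.pi) := by exact_mod_cast h1
    by_contra h
    have hm0 : (m : ℝ) ≠ 0 := by
      intro h3
      rw [h3, zero_mul] at h2
      exact h (by exact_mod_cast h2)
    refine irrational_pi ⟨n / (2 * m), ?_⟩
    push_cast
    rw [h2]
    field_simp
  refine ⟨Complex.exp Complex.I, _, rfl, ?_, fun a b hab => ?_⟩
  · rw [← Complex.exp_conj, Complex.conj_I, ← Complex.exp_add]
    simp
  · have := h0 (a - b) (by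
      simp only at hab
      rw [zpow_sub₀ (Complex.exp_ne_zero _), hab, div_self (zpow_ne_zero _ (Complex.exp_ne_zero _))])
    omega

/-! ### Invariants are annihilated by the diagonal action -/

lemma ActsBy.a {k : K} {p q r s t : ℂ} (h : ActsBy k p q r s t) :
    act k letters.a = letters.a := by
  change act k (inU (H₁ + H₂)) = _
  rw [act_inU, h.cen]
  rfl

lemma ad_a : ad eΔ letters.a = 0 ∧ ad fΔ letters.a = 0 ∧ ad hΔ letters.a = 0 := by
  have h := centralizes_genAlg aTilde (Algebra.subset_adjoin (by simp))
  rwa [aTilde_eq] at h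

lemma ad_aΔ_a : ad aΔ letters.a = 0 := by
  change ad aΔ (inU (H₁ + H₂)) = 0
  rw [ad_aΔ_inU, lie_self, map_zero]

lemma ad_aΔ_X (i j : Fin 2) : ad aΔ (letters.X i j) = 0 := by
  rw [letters_X, ad_aΔ_inU, bracket_cen_Xg, map_zero]

lemma ad_aΔ_d (c k : Bool) (i : Fin 2) :
    ad aΔ (letters.d c k i) = (vcharge c : ℂ) • letters.d c k i := by
  rcases k with _ | _
  · rw [letters_d_false, ad_aΔ_inU, bracket_cen_dp, map_smul]
  · rw [letters_d_true, ad_aΔ_inC]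

section Torus

variable {z w : ℂ}

lemma exists_scalar (hw : starRingEnd ℂ z = w) (hzw : z * w = 1) : ∃ k : K, ActsBy k z 0 0 z (w ^ 2) := by
  have hw' : starRingEnd ℂ w = z := by rw [← hw, Complex.conj_conj]
  obtain ⟨k, hk⟩ := exists_mem_K (g := !![z, 0, 0; 0, z, 0; 0, 0, w ^ 2]) (by
      rw [Matrix.det_fin_three]
      simp
      linear_combination (z * w + 1) * hzw) (by
      ext i j
      fin_cases i <;> fin_cases j <;>
        simp [Matrix.mul_apply, Fin.sum_univ_three, hw, hw'] <;> first
          | linear_combination hzw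
          | linear_combination (z * w + 1) * hzw) (by
      ext i j
      fin_cases i <;> fin_cases j <;> simp [gam])
  exact ⟨k, actsBy_of_coe hk⟩

lemma exists_diag (hw : starRingEnd ℂ z = w) (hzw : z * w = 1) : ∃ k : K, ActsBy k z 0 0 w 1 := by
  have hw' : starRingEnd ℂ w = z := by rw [← hw, Complex.conj_conj]
  obtain ⟨k, hk⟩ := exists_mem_K (g := !![z, 0, 0; 0, w, 0; 0, 0, 1]) (by
      rw [Matrix.det_fin_three]
      simp
      linear_combination hzw) (by
      ext i j
      fin_cases i <;> fin_cases j <;>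
        simp [Matrix.mul_apply, Fin.sum_univ_three, hw, hw'] <;>
          linear_combination hzw) (by
      ext i j
      fin_cases i <;> fin_cases j <;> simp [gam])
  exact ⟨k, actsBy_of_coe hk⟩

/-- For z = exp(iθ) the entries are cos θ and i sin θ: this is the circle generated by i(E + F). -/
lemma exists_rotation (hw : starRingEnd ℂ z = w) (hzw : z * w = 1) :
    ∃ k : K, ActsBy k ((z + w) / 2) ((z - w) / 2) ((z - w) / 2) ((z + w) / 2) 1 := by
  have hw' : starRingEnd ℂ w = z := by rw [← hw, Complex.conj_conj]
  obtain ⟨k, hk⟩ := exists_mem_K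
    (g := !![(z + w) / 2, (z - w) / 2, 0; (z - w) / 2, (z + w) / 2, 0; 0, 0, 1]) (by
      rw [Matrix.det_fin_three]
      simp
      linear_combination hzw) (by
      ext i j
      fin_cases i <;> fin_cases j <;>
        simp [Matrix.mul_apply, Fin.sum_univ_three, hw, hw', Complex.conj_ofNat] <;> first
          | ring1
          | linear_combination hzw) (by
      ext i j
      fin_cases i <;> fin_cases j <;> simp [gam])
  exact ⟨k, actsBy_of_coe hk⟩

lemma ad_aΔ_eq_zero (hw : starRingEnd ℂ z = w) (hzw : z * w = 1)
    (hz : Function.Injective fun c : ℤ => z ^ c) {x : Alg} (hx : x ∈ invariants) : ad aΔ x = 0 := by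
  obtain ⟨k, hk⟩ := exists_scalar hw hzw
  have hz0 : z ≠ 0 := left_ne_zero_of_mul_eq_one hzw
  have hz3 : z ^ 3 ≠ 0 := pow_ne_zero 3 hz0
  have hw3 : (z ^ 3)⁻¹ = w ^ 3 := inv_eq_of_mul_eq_one_right (by rw [← mul_pow, hzw, one_pow])
  -- The element diag(z, z, z⁻²) acts on doublets of charge 1 by z · z² = z³.
  refine ad_eq_zero_of_fixed hz3 (α := act k) (fun a b hab => ?_) ?_ (hx k)
  · have h1 : z ^ (3 * a) = z ^ (3 * b) := by
      rw [zpow_mul, zpow_mul]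
      exact_mod_cast hab
    have := hz h1
    omega
  refine eq_top_of_letters (mem_wtAlg hz3 0 (by simp [ad_aΔ_a, hk.a])) ⟨?_, ?_, ?_⟩
    fun c k' i => mem_wtAlg hz3 (vcharge c) ⟨ad_aΔ_d c k' i, ?_⟩
  · refine mem_wtAlg hz3 0 ⟨by simp [ad_aΔ_X], ?_⟩
    rw [hk.X.1]
    match_scalars <;> simp
    linear_combination (z * w + 1) * hzw
  · refine mem_wtAlg hz3 0 ⟨by simp [ad_aΔ_X], ?_⟩
    rw [hk.X.2.1]
    match_scalars <;> simp
    linear_combination (z * w + 1) * hzw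
  · refine mem_wtAlg hz3 0 ⟨by simp [ad_aΔ_X], ?_⟩
    rw [hk.X.2.2]
    match_scalars <;> simp
    linear_combination (z * w + 1) * hzw
  · have h0 := (hk.d c k').1
    have h1 := (hk.d c k').2
    have h2 : act k (letters.d c k' i) =
        ((if c then z * z - 0 * 0 else (w ^ 2) ^ 2) * z) • letters.d c k' i := by
      fin_cases i
      · simpa [mul_smul] using h0
      · simpa [mul_smul] using h1
    rw [h2]
    congr 1
    rcases c with _ | _
    · have h3 : (z ^ 3) ^ vcharge false = w ^ 3 := by simpa [vcharge] using hw3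
      rw [h3, if_neg Bool.false_ne_true]
      linear_combination w ^ 3 * hzw
    · have h3 : (z ^ 3) ^ vcharge true = z ^ 3 := by simp [vcharge]
      rw [h3, if_pos rfl]
      ring

lemma ad_hΔ_eq_zero (hw : starRingEnd ℂ z = w) (hzw : z * w = 1)
    (hz : Function.Injective fun c : ℤ => z ^ c) {x : Alg} (hx : x ∈ invariants) : ad hΔ x = 0 := by
  obtain ⟨k, hk⟩ := exists_diag hw hzw
  have hz0 : z ≠ 0 := left_ne_zero_of_mul_eq_one hzw
  have hw1 : z⁻¹ = w := inv_eq_of_mul_eq_one_right hzw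
  refine ad_eq_zero_of_fixed hz0 (α := act k) hz ?_ (hx k)
  refine eq_top_of_letters (mem_wtAlg hz0 0 (by simp [ad_a, hk.a])) ⟨?_, ?_, ?_⟩
    fun c k' i => mem_wtAlg hz0 (if i = 0 then 1 else -1) ⟨?_, ?_⟩
  · refine mem_wtAlg hz0 2 ⟨by rw [ad_hΔ_X]; norm_num, ?_⟩
    rw [hk.X.1]
    simp
  · refine mem_wtAlg hz0 0 ⟨by rw [ad_hΔ_X]; norm_num, ?_⟩
    rw [hk.X.2.1]
    simp [hzw]
  · refine mem_wtAlg hz0 (-2) ⟨by rw [ad_hΔ_X]; norm_num, ?_⟩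
    rw [hk.X.2.2, ← hw1]
    simp
  · rw [(isDoublet_d c k').ad_h]
    push_cast
    rfl
  · have h0 := (hk.d c k').1
    have h1 := (hk.d c k').2
    have hb : (if c then z * w - 0 * 0 else (1 : ℂ) ^ 2) = 1 := by
      split_ifs <;> simp [hzw]
    rw [hb] at h0 h1
    fin_cases i
    · simpa using h0
    · simpa [hw1] using h1

lemma ad_eΔ_add_fΔ_eq_zero (hw : starRingEnd ℂ z = w) (hzw : z * w = 1)
    (hz : Function.Injective fun c : ℤ => z ^ c) {x : Alg} (hx : x ∈ invariants) : ad (eΔ + fΔ) x = 0 := by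
  obtain ⟨k, hk⟩ := exists_rotation hw hzw
  have hz0 : z ≠ 0 := left_ne_zero_of_mul_eq_one hzw
  have hw1 : z⁻¹ = w := inv_eq_of_mul_eq_one_right hzw
  have hs := rels_letters.symm 1 0
  refine ad_eq_zero_of_fixed hz0 (α := act k) hz ?_ (hx k)
  -- The weight vectors of `eΔ + fΔ`: in the triplet X₀₀ - X₁₁ of weight 0 and X₀₀ + X₁₁ ± 2X₀₁ of
  -- weight ±2, in a doublet the sum and difference of its entries, of weight ±1.
  have h0 : letters.X 0 0 - letters.X 1 1 ∈ wtAlg (eΔ + fΔ) (act k) hz0 := by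
    refine mem_wtAlg hz0 0 ⟨?_, ?_⟩
    · simp [ad_add_left, ad_eΔ_X, ad_fΔ_X, hs]
    · rw [map_sub, hk.X.1, hk.X.2.2]
      match_scalars <;> simp <;> first
        | ring1
        | linear_combination hzw
        | linear_combination -hzw
  have h1 : letters.X 0 0 + letters.X 1 1 + (2 : ℂ) • letters.X 0 1 ∈
      wtAlg (eΔ + fΔ) (act k) hz0 := by
    refine mem_wtAlg hz0 2 ⟨?_, ?_⟩
    · simp [ad_add_left, ad_eΔ_X, ad_fΔ_X, hs]
      module
    · rw [map_add, map_add, map_smul, hk.X.1, hk.X.2.1, hk.X.2.2]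
      match_scalars <;> norm_cast <;> ring
  have h2 : letters.X 0 0 + letters.X 1 1 - (2 : ℂ) • letters.X 0 1 ∈
      wtAlg (eΔ + fΔ) (act k) hz0 := by
    refine mem_wtAlg hz0 (-2) ⟨?_, ?_⟩
    · simp [ad_add_left, ad_eΔ_X, ad_fΔ_X, hs]
      module
    · rw [map_sub, map_add, map_smul, hk.X.1, hk.X.2.1, hk.X.2.2]
      have : z ^ (-2 : ℤ) = w ^ 2 := by
        rw [zpow_neg, ← hw1, inv_pow]; norm_cast
      rw [this]
      match_scalars <;> ring
  have hd : ∀ c k', letters.d c k' 0 + letters.d c k' 1 ∈ wtAlg (eΔ + fΔ) (act k) hz0 ∧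
      letters.d c k' 0 - letters.d c k' 1 ∈ wtAlg (eΔ + fΔ) (act k) hz0 := by
    intro c k'
    have h0 := (hk.d c k').1
    have h1 := (hk.d c k').2
    have hb : (if c then (z + w) / 2 * ((z + w) / 2) - (z - w) / 2 * ((z - w) / 2)
        else (1 : ℂ) ^ 2) = 1 := by
      split_ifs
      · linear_combination hzw
      · simp
    rw [hb, one_smul] at h0 h1
    constructor
    · refine mem_wtAlg hz0 1 ⟨?_, ?_⟩
      · simp [ad_add_left, (isDoublet_d c k').ad_e, (isDoublet_d c k').ad_f]
      · rw [map_add, h0, h1, zpow_one]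
        match_scalars <;> ring
    · refine mem_wtAlg hz0 (-1) ⟨?_, ?_⟩
      · simp [ad_add_left, (isDoublet_d c k').ad_e, (isDoublet_d c k').ad_f]
        abel
      · rw [map_sub, h0, h1, zpow_neg, zpow_one, hw1]
        match_scalars <;> ring
  set S := wtAlg (eΔ + fΔ) (act k) hz0
  refine eq_top_of_letters (mem_wtAlg hz0 0 (by simp [ad_add_left, ad_a, hk.a])) ⟨?_, ?_, ?_⟩
    fun c k' i => ?_
  · rw [show letters.X 0 0 = (1 / 4 : ℂ) • (letters.X 0 0 + letters.X 1 1 + (2 : ℂ) •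
      letters.X 0 1 + (letters.X 0 0 + letters.X 1 1 - (2 : ℂ) • letters.X 0 1) +
      (2 : ℂ) • (letters.X 0 0 - letters.X 1 1)) by module]
    exact S.smul_mem (add_mem (add_mem h1 h2) (S.smul_mem h0 _)) _
  · rw [show letters.X 0 1 = (1 / 4 : ℂ) • (letters.X 0 0 + letters.X 1 1 + (2 : ℂ) •
      letters.X 0 1 - (letters.X 0 0 + letters.X 1 1 - (2 : ℂ) • letters.X 0 1)) by module]
    exact S.smul_mem (sub_mem h1 h2) _
  · rw [show letters.X 1 1 = (1 / 4 : ℂ) • (letters.X 0 0 + letters.X 1 1 + (2 : ℂ) •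
      letters.X 0 1 + (letters.X 0 0 + letters.X 1 1 - (2 : ℂ) • letters.X 0 1) -
      (2 : ℂ) • (letters.X 0 0 - letters.X 1 1)) by module]
    exact S.smul_mem (sub_mem (add_mem h1 h2) (S.smul_mem h0 _)) _
  · obtain ⟨h3, h4⟩ := hd c k'
    fin_cases i
    · have := S.smul_mem (add_mem h3 h4) (1 / 2 : ℂ)
      convert this using 1
      simp only [Fin.zero_eta]
      module
    · have := S.smul_mem (sub_mem h3 h4) (1 / 2 : ℂ)
      convert this using 1
      simp only [Fin.mk_one]
      module

end Torus

/-! ### The algebra of invariants is generated by the distinguished elements -/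

lemma ad_ad {M : Type*} [Ring M] [Algebra ℂ M] (x y m : M) :
    ad (ad x y) m = ad x (ad y m) - ad y (ad x m) := by
  simp only [ad_apply]; noncomm_ring

lemma ad_hΔ_eΔ : ad hΔ eΔ = (2 : ℂ) • eΔ := by
  have h : ad hΔ (inU E) = (1 + 1 : ℂ) • inU E := by simpa using! ad_hΔ_X 0 0
  rw [eΔ, map_sub, map_smul, ad_mul, ad_hΔ_inC, ad_hΔ_inC, h]
  simp
  module

lemma ad_hΔ_fΔ : ad hΔ fΔ = (-2 : ℂ) • fΔ := by
  have h : ad hΔ (inU F) = (-1 + -1 : ℂ) • inU F := by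
    have h1 := ad_hΔ_X 1 1
    rw [letters_X_one_one] at h1
    simpa using! h1
  rw [fΔ, map_add, map_smul, ad_mul, ad_hΔ_inC, ad_hΔ_inC, h]
  simp
  module

/-- The bracket of `hΔ` with `eΔ + fΔ` is `2 eΔ - 2 fΔ`, which together with `eΔ + fΔ` yields `eΔ`.
-/
lemma ad_eΔ_eq_zero {x : Alg} (hh : ad hΔ x = 0) (hef : ad (eΔ + fΔ) x = 0) : ad eΔ x = 0 := by
  have h1 := ad_ad hΔ (eΔ + fΔ) x
  rw [hh, hef, map_zero, map_zero, sub_zero, map_add, ad_hΔ_eΔ, ad_hΔ_fΔ, ad_add_left,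
    ad_smul_left, ad_smul_left] at h1
  rw [ad_add_left] at hef
  have h2 : ad eΔ x = (1 / 4 : ℂ) • ((2 : ℂ) • ad eΔ x + (-2 : ℂ) • ad fΔ x) +
      (1 / 2 : ℂ) • (ad eΔ x + ad fΔ x) := by module
  rw [h2, h1, hef, smul_zero, smul_zero, add_zero]

/-- The span of the words of a given charge. -/
def chargeSpace (c : ℤ) : Submodule ℂ Alg :=
  Submodule.span ℂ {x | ∃ l, letters.gens.wcharge l = c ∧ x = letters.gens.word l}

lemma word_mem_chargeSpace (l : List Gen) :
    letters.gens.word l ∈ chargeSpace (letters.gens.wcharge l) :=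
  Submodule.subset_span ⟨l, rfl, rfl⟩

lemma val_mem_chargeSpace (x : Gen) : letters.gens.val x ∈ chargeSpace (letters.gens.charge x) :=
  Submodule.subset_span ⟨[x], by simp, by simp⟩

lemma ad_aΔ_val (x : Gen) :
    ad aΔ (letters.gens.val x) = (letters.gens.charge x : ℂ) • letters.gens.val x := by
  rcases x with _ | ⟨i, j⟩ | ⟨c, k, i⟩
  · exact ad_aΔ_a.trans (by rw [show letters.gens.charge .cen = 0 from rfl]; simp)
  · exact (ad_aΔ_X i j).trans (by rw [show letters.gens.charge (.mat i j) = 0 from rfl]; simp)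
  · exact ad_aΔ_d c k i

lemma chargeSpace_le (c : ℤ) : chargeSpace c ≤ (ad aΔ).eigenspace (c : ℂ) := by
  rw [chargeSpace, Submodule.span_le]
  rintro _ ⟨l, rfl, rfl⟩
  rw [SetLike.mem_coe, Module.End.mem_eigenspace_iff]
  induction l with
  | nil => simp [ad_one]
  | cons x l ih =>
    rw [GradedGens.word_cons, ad_mul, ih, ad_aΔ_val, GradedGens.wcharge_cons, smul_mul_assoc,
      mul_smul_comm, ← add_smul, Int.cast_add]

lemma chargeSpace_zero_le : chargeSpace 0 ≤ reach good_letters.centralizes := by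
  rw [chargeSpace, Submodule.span_le]
  rintro _ ⟨l, hl, rfl⟩
  have h := GradedGens.word_mem (Nat.lt_succ_self (letters.gens.wdeg l))
  rw [hl] at h
  exact good_letters.filt_le_reach _ _ h

lemma mul_mem_chargeSpace (c c' : ℤ) (x y : Alg) (hx : x ∈ chargeSpace c)
    (hy : y ∈ chargeSpace c') : x * y ∈ chargeSpace (c + c') := by
  have h := Submodule.mul_mem_mul hx hy
  rw [chargeSpace, chargeSpace, Submodule.span_mul_span] at h
  refine Submodule.span_mono ?_ h
  rintro _ ⟨_, ⟨l, rfl, rfl⟩, _, ⟨l', rfl, rfl⟩, rfl⟩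
  exact ⟨l ++ l', by simp, by simp⟩

lemma iSup_chargeSpace (x : Alg) : x ∈ ⨆ c, chargeSpace c := by
  have h : ∀ x, letters.gens.val x ∈
      gradedAlg chargeSpace (word_mem_chargeSpace []) mul_mem_chargeSpace := fun x =>
    Submodule.mem_iSup_of_mem (p := chargeSpace) _ (val_mem_chargeSpace x)
  have htop := eq_top_of_letters (h .cen) ⟨h (.mat 0 0), h (.mat 0 1), h (.mat 1 1)⟩
    fun c k i => h (.vec c k i)
  exact (htop.symm ▸ Algebra.mem_top :
    x ∈ gradedAlg chargeSpace (word_mem_chargeSpace []) mul_mem_chargeSpace)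

/-- Invariance under the centre of `K` gives charge zero, hence membership in `reach`; invariance
under the other two circles makes the Casimir operator vanish, and the two together give membership
in `genAlg`. -/
theorem invariants_eq_genAlg : invariants = genAlg := by
  refine le_antisymm (fun x hx => ?_) genAlg_le_invariants
  obtain ⟨z, w, hw, hzw, hz⟩ := exists_unit
  have ha := ad_aΔ_eq_zero hw hzw hz hx
  have hh := ad_hΔ_eq_zero hw hzw hz hx
  have he := ad_eΔ_eq_zero hh (ad_eΔ_add_fΔ_eq_zero hw hzw hz hx)
  have h0 : x ∈ chargeSpace 0 :=
    mem_zero_of_eigen (T := ad aΔ) (μ := fun c => (c : ℂ)) Int.cast_injective chargeSpace_le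
      (iSup_chargeSpace x) (by simpa using ha)
  refine mem_of_mem_reach good_letters.centralizes (chargeSpace_zero_le h0) ?_
  simp [cas_apply, he, hh]

/-! ### Commutation of the distinguished elements -/

section Commute

variable {z : Alg}

lemma commute_zeta (hX : ∀ i j, Commute z (letters.X i j)) : Commute z zeta :=
  (((hX 0 0).mul_right (hX 1 1)).sub_right ((hX 0 1).mul_right (hX 0 1))).sub_right (hX 0 1)

lemma commute_pair {x y : Fin 2 → Alg} (hx : ∀ i, Commute z (x i)) (hy : ∀ i, Commute z (y i)) :
    Commute z (pair x y) :=
  ((hx 0).mul_right (hy 1)).sub_right ((hx 1).mul_right (hy 0))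

lemma commute_matVec (hX : ∀ i j, Commute z (letters.X i j)) {y : Fin 2 → Alg}
    (hy : ∀ i, Commute z (y i)) (i : Fin 2) : Commute z (letters.matVec y i) :=
  ((hX i 0).mul_right (hy 1)).sub_right ((hX i 1).mul_right (hy 0))

lemma commute_bTilde (hX : ∀ i j, Commute z (letters.X i j)) : Commute z bTilde := by
  rw [bTilde_eq]
  exact (commute_zeta hX).smul_right _

lemma commute_gTilde (hd : ∀ c i, Commute z (letters.d c true i)) : Commute z gTilde := by
  rw [gTilde_eq]
  exact (commute_pair (hd true) (hd false)).neg_right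

lemma commute_iTilde (hX : ∀ i j, Commute z (letters.X i j))
    (hd : ∀ c i, Commute z (letters.d c true i)) : Commute z iTilde := by
  rw [iTilde_eq]
  exact (commute_pair (hd true) (commute_matVec hX (hd false))).smul_right _

end Commute

lemma aTilde_commute_X (i j : Fin 2) : Commute aTilde (letters.X i j) := by
  rw [aTilde_eq, letters_X, commute_iff_eq, ← sub_eq_zero, inU_bracket, bracket_cen_Xg, map_zero]

lemma aTilde_commute_d (c : Bool) (i : Fin 2) : Commute aTilde (letters.d c true i) := by
  rw [aTilde_eq]
  exact inU_comm_inC _ _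

lemma d_commute_X (c : Bool) (k i j : Fin 2) : Commute (letters.d c true k) (letters.X i j) :=
  (rels_letters.X_comm i j c k).symm

lemma bTilde_commute_d (c : Bool) (k : Fin 2) : Commute bTilde (letters.d c true k) :=
  (commute_bTilde (d_commute_X c k)).symm

lemma inC_mul_commute_zeta (x y : Bool × Fin 2) :
    ad (inC (dp x.1 x.2) * inC (dp y.1 y.2)) zeta = 0 := by
  have h : ∀ x : Bool × Fin 2, Commute (inC (dp x.1 x.2)) zeta := fun x =>
    commute_zeta (d_commute_X x.1 x.2)
  rw [ad_apply, sub_eq_zero]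
  exact (h x).mul_left (h y)

/-- The diagonal operators annihilate `zeta`, and so do their Clifford parts; what remains is
commutation with `E`, `F`, `H`. -/
lemma zeta_commute_X (i j : Fin 2) : Commute zeta (letters.X i j) := by
  obtain ⟨he, hf, hh⟩ := ad_zeta
  rw [eΔ, sub_eq_add_neg, ← neg_smul, ad_add_left, ad_smul_left,
    inC_mul_commute_zeta (true, 0) (false, 0), smul_zero, add_zero, ad_apply, sub_eq_zero] at he
  rw [fΔ, ad_add_left, ad_smul_left,
    inC_mul_commute_zeta (true, 1) (false, 1), smul_zero, add_zero, ad_apply, sub_eq_zero] at hf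
  rw [hΔ, ad_add_left, ad_smul_left, ad_add_left, inC_mul_commute_zeta (true, 0) (false, 1),
    inC_mul_commute_zeta (true, 1) (false, 0), add_zero, smul_zero, add_zero, ad_apply,
    sub_eq_zero] at hh
  have h01 : Commute zeta (letters.X 0 1) := by
    rw [letters_X_zero_one]
    exact Commute.smul_right hh.symm _
  fin_cases i <;> fin_cases j
  · exact he.symm
  · exact h01
  · exact (rels_letters.symm 1 0) ▸ h01
  · change Commute zeta (letters.X 1 1)
    rw [letters_X_one_one]
    exact Commute.neg_right hf.symm

lemma bTilde_commute_X (i j : Fin 2) : Commute bTilde (letters.X i j) := by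
  rw [bTilde_eq]
  exact (zeta_commute_X i j).smul_left _

lemma gTilde_commute_X (i j : Fin 2) : Commute gTilde (letters.X i j) :=
  (commute_gTilde fun c k => (d_commute_X c k i j).symm).symm

/-- `ad γ` has eigenvalue 2 on the positive odd doublet and -2 on the negative one, multiplied by
`X` or not, so it annihilates their pairing. -/
lemma gTilde_commute_iTilde : Commute gTilde iTilde := by
  set γ := pair (letters.d true true) (letters.d false true)
  have hX : ∀ i j, ad γ (letters.X i j) = 0 := fun i j => by
    have h := (gTilde_commute_X i j).neg_left
    rw [gTilde_eq, neg_neg] at h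
    rw [ad_apply, sub_eq_zero]
    exact h
  have hneg : ∀ i, ad γ (letters.d false true i) = (-2 : ℂ) • letters.d false true i :=
    rels_letters.ad_odd_pair_neg
  have hm : ∀ i, ad γ (letters.matVec (letters.d false true) i) =
      (-2 : ℂ) • letters.matVec (letters.d false true) i := fun i => by
    simp only [Letters.matVec, map_sub, ad_mul, hX, hneg, zero_mul, zero_add, mul_smul_comm,
      smul_sub]
  have h : ad γ (pair (letters.d true true) (letters.matVec (letters.d false true))) = 0 := by
    rw [Letters.Rels.ad_pair, hm, hm, rels_letters.ad_odd_pair_pos, rels_letters.ad_odd_pair_pos]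
    simp
  rw [ad_apply, sub_eq_zero] at h
  rw [gTilde_eq, iTilde_eq]
  exact (Commute.smul_right h _).neg_left

/-- The distinguished elements commute with each other. -/
lemma commute_of_mem {x y : Alg} (hx : x ∈ ({aTilde, bTilde, iTilde, gTilde} : Set Alg))
    (hy : y ∈ ({aTilde, bTilde, iTilde, gTilde} : Set Alg)) : Commute x y := by
  have hab := commute_bTilde aTilde_commute_X
  have hai := commute_iTilde aTilde_commute_X aTilde_commute_d
  have hag := commute_gTilde aTilde_commute_d
  have hbi := commute_iTilde bTilde_commute_X bTilde_commute_d
  have hbg := commute_gTilde bTilde_commute_d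
  have hgi := gTilde_commute_iTilde
  rcases hx with rfl | rfl | rfl | rfl <;> rcases hy with rfl | rfl | rfl | rfl
  exacts [.refl _, hab, hai, hag, hab.symm, .refl _, hbi, hbg, hai.symm, hbi.symm, .refl _,
    hgi.symm, hag.symm, hbg.symm, hgi, .refl _]

/-! ### The quotient -/

lemma cls_D (hD : D ∈ invariants) : cls hD ⟨D, hD⟩ = 0 := by
  have h : (⟨D, hD⟩ : invariants) ∈ diracIdeal hD := TwoSidedIdeal.subset_span rfl
  exact (RingCon.eq _).2 ((diracIdeal hD).mem_iff _ |>.1 h)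

/-- The proof of invariance is quantified after the induction over `genAlg`, because the parts of a
sum or product get theirs from `genAlg_le_invariants`. -/
lemma cls_mem {hD : D ∈ invariants} {A : Subalgebra ℂ (DiracQuotient hD)}
    (ha : cls hD ⟨aTilde, aTilde_mem⟩ ∈ A) (hb : cls hD ⟨bTilde, bTilde_mem⟩ ∈ A)
    (hi : cls hD ⟨iTilde, iTilde_mem⟩ ∈ A) (hg : cls hD ⟨gTilde, gTilde_mem⟩ ∈ A) {x : Alg}
    (hx : x ∈ genAlg) : ∀ h : x ∈ invariants, cls hD ⟨x, h⟩ ∈ A := by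
  induction hx using Algebra.adjoin_induction with
  | mem x hx =>
    intro h
    rcases hx with rfl | rfl | rfl | rfl | rfl
    · exact ha
    · exact hb
    · exact hi
    · exact hg
    · rw [cls_D]
      exact zero_mem A
  | algebraMap r =>
    intro h
    exact A.algebraMap_mem r
  | add x y hx hy h1 h2 =>
    intro h
    have e : cls hD ⟨x + y, h⟩ = cls hD ⟨x, genAlg_le_invariants hx⟩ +
        cls hD ⟨y, genAlg_le_invariants hy⟩ :=
      RingHom.map_add _ (⟨x, _⟩ : invariants) ⟨y, _⟩
    rw [e]
    exact A.add_mem (h1 _) (h2 _)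
  | mul x y hx hy h1 h2 =>
    intro h
    have e : cls hD ⟨x * y, h⟩ = cls hD ⟨x, genAlg_le_invariants hx⟩ *
        cls hD ⟨y, genAlg_le_invariants hy⟩ :=
      RingHom.map_mul _ (⟨x, _⟩ : invariants) ⟨y, _⟩
    rw [e]
    exact A.mul_mem (h1 _) (h2 _)

lemma adjoin_cls (hD : D ∈ invariants) :
    Algebra.adjoin ℂ ({cls hD ⟨aTilde, aTilde_mem⟩, cls hD ⟨bTilde, bTilde_mem⟩,
      cls hD ⟨iTilde, iTilde_mem⟩, cls hD ⟨gTilde, gTilde_mem⟩} : Set (DiracQuotient hD)) = ⊤ := by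
  refine top_unique fun q _ => ?_
  obtain ⟨x, rfl⟩ := RingCon.mk'_surjective _ q
  exact cls_mem (Algebra.subset_adjoin (Or.inl rfl)) (Algebra.subset_adjoin (Or.inr (Or.inl rfl)))
    (Algebra.subset_adjoin (Or.inr (Or.inr (Or.inl rfl))))
    (Algebra.subset_adjoin (Or.inr (Or.inr (Or.inr rfl)))) (invariants_eq_genAlg ▸ x.2) x.2

lemma mul_comm_of_adjoin_eq_top {A : Type*} [Ring A] [Algebra ℂ A] {s : Set A}
    (hs : Algebra.adjoin ℂ s = ⊤) (hcomm : ∀ x ∈ s, ∀ y ∈ s, Commute x y) (x y : A) :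
    x * y = y * x := by
  have h1 : ∀ x ∈ s, ∀ y : A, Commute x y := fun x hx y =>
    Algebra.commute_of_mem_adjoin_of_forall_mem_commute (hs ▸ Algebra.mem_top) (hcomm x hx)
  exact (Algebra.commute_of_mem_adjoin_of_forall_mem_commute (hs ▸ Algebra.mem_top)
    fun x hx => (h1 x hx y).symm : Commute y x).symm.eq

end DiracSU21

end

/-- The elements `ã, b̃, ĩ, g̃, D` are `K`-invariant, and the quotient of `(U(𝔤) ⊗ C(𝔭))^K` by its
two-sided ideal generated by `D` is generated, as a unital complex algebra, by the classes of
`ã, b̃, ĩ, g̃`, and is commutative. -/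
theorem mainTheorem6 :
    ∃ (ha : DiracSU21.aTilde ∈ DiracSU21.invariants)
      (hb : DiracSU21.bTilde ∈ DiracSU21.invariants)
      (hi : DiracSU21.iTilde ∈ DiracSU21.invariants)
      (hg : DiracSU21.gTilde ∈ DiracSU21.invariants)
      (hD : DiracSU21.D ∈ DiracSU21.invariants),
      Algebra.adjoin ℂ
          ({DiracSU21.cls hD ⟨DiracSU21.aTilde, ha⟩, DiracSU21.cls hD ⟨DiracSU21.bTilde, hb⟩,
            DiracSU21.cls hD ⟨DiracSU21.iTilde, hi⟩, DiracSU21.cls hD ⟨DiracSU21.gTilde, hg⟩} :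
            Set (DiracSU21.DiracQuotient hD)) = ⊤ ∧
        ∀ x y : DiracSU21.DiracQuotient hD, x * y = y * x := by
  refine ⟨DiracSU21.aTilde_mem, DiracSU21.bTilde_mem, DiracSU21.iTilde_mem, DiracSU21.gTilde_mem,
    DiracSU21.D_mem, DiracSU21.adjoin_cls _,
    DiracSU21.mul_comm_of_adjoin_eq_top (DiracSU21.adjoin_cls _) ?_⟩
  -- Commutation holds before passing to the quotient and is transported by the quotient map.
  have key : ∀ x y : DiracSU21.invariants,
      x.1 ∈ ({DiracSU21.aTilde, DiracSU21.bTilde, DiracSU21.iTilde, DiracSU21.gTilde} :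
        Set DiracSU21.Alg) →
      y.1 ∈ ({DiracSU21.aTilde, DiracSU21.bTilde, DiracSU21.iTilde, DiracSU21.gTilde} :
        Set DiracSU21.Alg) →
      Commute (DiracSU21.cls DiracSU21.D_mem x) (DiracSU21.cls DiracSU21.D_mem y) :=
    fun x y hx hy => by
      have h : Commute x y := Subtype.ext (DiracSU21.commute_of_mem hx hy).eq
      exact h.map _
  rintro x (rfl | rfl | rfl | rfl) y (rfl | rfl | rfl | rfl) <;>
    exact key _ _ (by simp) (by simp)
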